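/- Let $\kappa,\kappa'\ge 0$. On $\mathbb R^4$ put $v_0=\frac12(1,1,1,1)$, $v_1=\frac12(1,1,-1,-1)$, $v_2=\frac12(1,-1,1,-1)$, $v_3=\frac12(1,-1,-1,1)$ and $y_i=\langle x,v_i\rangle$. A permutation $w$ acts by $(xw)_i=x_{w(i)}$ and $(wf)(x)=f(xw)$; $\sigma_0$ is the reflection $x\sigma_0=x-(\sum_i x_i)v_0$; for $i,j\in\{1,2,3\}$, $\sigma_{ij},\tau_{ij}$ are the reflections in $y_i-y_j=0$ and $y_i+y_j=0$; $W$ is the group generated by the permutations of coordinates and $\sigma_0$. On polynomials in $x$ let $$\mathcal D_i^Bf=\frac{\partial f}{\partial y_i}+\kappa\sum_{j\ne i}\Big(\frac{f-\sigma_{ij}f}{y_i-y_j}+\frac{f-\tau_{ij}f}{y_i+y_j}\Big),\qquad \mathcal U_i^Bf=\mathcal D_i^B(y_if)-\kappa\sum_{j<i}(\sigma_{ij}+\tau_{ij})f\qquad(1\le i\le3),$$ $$\mathcal D_0f=\frac{\partial f}{\partial y_0}+\frac{\kappa'}{y_0}(f-\sigma_0f),\qquad \mathcal D_i'f=\frac{\partial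 f}{\partial x_i}+\kappa\sum_{j\ne i}\frac{f-(i,j)f}{x_i-x_j}+\frac{\kappa'}{2y_0}(f-\sigma_0f)\qquad(1\le i\le 4),$$ $\Delta_B=\sum_{i=1}^3(\mathcal D_i^B)^2$, $\Delta_h=\sum_{i=1}^4(\mathcal D_i')^2$, and $e^{T}=\sum_n T^n/n!$ (a finite sum on each polynomial when $T$ is a multiple of $\Delta_B$ or $\Delta_h$). Nonsymmetric Jack polynomials in three variables: for polynomials $f$ in $x=(x_1,x_2,x_3)$ let $\mathcal D_if=\partial f/\partial x_i+\kappa\sum_{j\ne i}\frac{f-(i,j)f}{x_i-x_j}$ and $\mathcal U_if=\mathcal D_i(x_if)-\kappa\sum_{j<i}(j,i)f$. For $\alpha\in\mathbb N_0^3$ let $\alpha^+$ be its non-increasing rearrangement, $|\alpha|=\sum_i\alpha_i$, $r(\alpha,i)=\#\{j:\alpha_j>\alpha_i\}+\#\{j\le i:\alpha_j=\alpha_i\}$, and $\xi_i(\alpha)=(3-r(\alpha,i))\kappa+\alpha_i+1$. Write $\alpha\succ\beta$ if $\alpha\ne\beta$ and all partial sums $\sum_{i\le j}\alpha_i\ge\sum_{i\le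 j}\beta_i$, and $\alpha\vartriangleright\beta$ if $|\alpha|=|\beta|$ and either $\alpha^+\succ\beta^+$, or $\alpha^+=\beta^+$ and $\alpha\succ\beta$. Let $\zeta_\alpha$ be the simultaneous eigenfunction $\mathcal U_i\zeta_\alpha=\xi_i(\alpha)\zeta_\alpha$ $(1\le i\le3)$ of the form $\zeta_\alpha=x^\alpha+\sum_{\alpha\vartriangleright\beta}A_{\beta\alpha}x^\beta$. For a partition $\lambda=(\lambda_1\ge\lambda_2\ge\lambda_3\ge0)$ put $$j_\lambda=\sum_{\alpha^+=\lambda}\ \prod_{i<j,\ \alpha_i<\alpha_j}\Big(1-\frac{\kappa}{(r(\alpha,i)-r(\alpha,j))\kappa+\alpha_j-\alpha_i}\Big)\,\zeta_\alpha .$$ For $\gamma\in\mathbb N_0^3$ let $E=\{i:\gamma_i\text{ odd}\}$, $k=\#E$, let $w\in\mathcal S_3$ map $\{1,\dots,k\}$ onto $E$ and $\{k+1,\dots,3\}$ onto its complement, increasingly on both, let $\alpha_i=\lfloor\gamma_{w(i)}/2\rfloor$, and put $p_\gamma(y)=w\big(y_1\cdots y_k\,\zeta_\alpha(y_1^2,y_2^2,y_3^2)\big)$,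 $w$ acting on $(y_1,y_2,y_3)$. Write $y^2=(y_1^2,y_2^2,y_3^2)$. Let $L_n^a(t)=\frac{(a+1)_n}{n!}\sum_{i=0}^n\frac{(-n)_i}{(a+1)_i}\frac{t^i}{i!}$. Finally let $$\mathcal H=-\Delta+\frac{|x|^2}4+2\kappa\sum_{1\le i<j\le4}\frac{\kappa-(i,j)}{(x_i-x_j)^2}+\frac{4\kappa'(\kappa'-\sigma_0)}{(x_1+x_2+x_3+x_4)^2},\qquad \psi_0(x)=\prod_{1\le i<j\le4}|x_i-x_j|^{\kappa}\,|y_0|^{\kappa'}e^{-|x|^2/4}.$$ An eigenfunction of $\mathcal H$ with energy $E$ means a square-integrable function $\psi$ on $\mathbb R^4$ that, off the hyperplanes $x_i=x_j$ $(i\ne j)$ and $\sum_ix_i=0$, is $C^2$, is not identically zero, and satisfies $\mathcal H\psi=E\psi$. Then: 1. For each $\alpha\in\mathbb N_0^3$ the polynomial $\zeta_\alpha$ exists and is unique. 2. For every polynomial $f$ on $\mathbb R^4$, at every point off these hyperplanes, $$\psi_0^{-1}\mathcal H(\psi_0f)=e^{-\Delta_h/2}\Big(\sum_{i=1}^3\mathcal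 U_i^B+\mathcal D_0y_0-\kappa'\sigma_0-2\Big)e^{\Delta_h/2}f .$$ 3. For all $\gamma\in\mathbb N_0^3$ and $n\in\mathbb N_0$, $\big(e^{-\Delta_h/2}(p_\gamma(y)y_0^n)\big)\psi_0$ is an eigenfunction of $\mathcal H$ with energy $|\gamma|+n+6\kappa+\kappa'+2$. 4. For all partitions $\lambda\in\mathbb N_0^3$, $s\in\{0,1\}$ and $n\in\mathbb N_0$, the function $$\Big(e^{-\Delta_B/2}\big((y_1y_2y_3)^s\,j_\lambda(y^2)\big)\,L_n^{\kappa'-1/2}\big(\tfrac{y_0^2}2\big)\Big)\psi_0$$ is $W$-invariant and is an eigenfunction of $\mathcal H$ with energy $2|\lambda|+3s+2n+6\kappa+\kappa'+2$. 5. Conversely, every $W$-invariant eigenfunction of $\mathcal H$ of the form $q\psi_0$ with $q$ a polynomial is a finite linear combination of functions listed in 4 that have the same energy. -/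

import Mathlib

open scoped Laplacian

noncomputable section

namespace DunklFour

/-! ### Reflections and divided differences on polynomials -/

/-- The linear form `⟨x, a⟩` as a polynomial in `x`. -/
def linForm {N : ℕ} (a : Fin N → ℝ) : MvPolynomial (Fin N) ℝ :=
  ∑ i, MvPolynomial.C (a i) * MvPolynomial.X i

/-- The dual vector `2 a / ⟨a, a⟩`. -/
def coroot {N : ℕ} (a : Fin N → ℝ) (i : Fin N) : ℝ :=
  2 * a i / ∑ j, a j ^ 2

/-- The reflection along `a` acting on polynomials:
`f(x) ↦ f(x - (2 ⟨x, a⟩ / ⟨a, a⟩) a)`. For `a = e_i - e_j` it interchanges `x_i` and `x_j`. -/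
def reflPoly {N : ℕ} (a : Fin N → ℝ) : MvPolynomial (Fin N) ℝ →ₐ[ℝ] MvPolynomial (Fin N) ℝ :=
  MvPolynomial.aeval fun i => MvPolynomial.X i - MvPolynomial.C (coroot a i) * linForm a

/-- `f(x - t • (2 a / ⟨a, a⟩))` as a polynomial in `t` over the polynomials in `x`. -/
def shiftAlong {N : ℕ} (a : Fin N → ℝ) :
    MvPolynomial (Fin N) ℝ →ₐ[ℝ] Polynomial (MvPolynomial (Fin N) ℝ) :=
  MvPolynomial.aeval fun i =>
    Polynomial.C (MvPolynomial.X i) - Polynomial.C (MvPolynomial.C (coroot a i)) * Polynomial.X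

/-- The polynomial `(f(x) - f(x s_a)) / ⟨x, a⟩`, where `s_a` is the reflection along `a`;
see `linForm_mul_divDiff`. -/
def divDiff {N : ℕ} (a : Fin N → ℝ) : Module.End ℝ (MvPolynomial (Fin N) ℝ) where
  toFun f := -((shiftAlong a f).divX.eval (linForm a))
  map_add' f g := by
    simp only [map_add, Polynomial.divX_add, Polynomial.eval_add, neg_add]
  map_smul' c f := by
    have h : shiftAlong a (c • f)
        = Polynomial.C (MvPolynomial.C c) * shiftAlong a f := by
      rw [map_smul, Algebra.smul_def]
      rfl
    rw [h, Polynomial.divX_C_mul, Polynomial.eval_mul, Polynomial.eval_C, RingHom.id_apply,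
      MvPolynomial.smul_eq_C_mul, mul_neg]

theorem shiftAlong_coeff_zero {N : ℕ} (a : Fin N → ℝ) (f : MvPolynomial (Fin N) ℝ) :
    (shiftAlong a f).coeff 0 = f := by
  rw [Polynomial.coeff_zero_eq_eval_zero]
  induction f using MvPolynomial.induction_on with
  | C c => simp [shiftAlong, Polynomial.algebraMap_apply, MvPolynomial.algebraMap_eq]
  | add p q hp hq => rw [map_add, Polynomial.eval_add, hp, hq]
  | mul_X p i hp =>
    rw [map_mul, Polynomial.eval_mul, hp]
    simp [shiftAlong]

theorem shiftAlong_eval_linForm {N : ℕ} (a : Fin N → ℝ) (f : MvPolynomial (Fin N) ℝ) :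
    (shiftAlong a f).eval (linForm a) = reflPoly a f := by
  induction f using MvPolynomial.induction_on with
  | C c => simp [shiftAlong, reflPoly, Polynomial.algebraMap_apply, MvPolynomial.algebraMap_eq]
  | add p q hp hq => rw [map_add, Polynomial.eval_add, hp, hq, map_add]
  | mul_X p i hp =>
    rw [map_mul, Polynomial.eval_mul, hp, map_mul]
    simp [shiftAlong, reflPoly]

theorem linForm_mul_divDiff {N : ℕ} (a : Fin N → ℝ) (f : MvPolynomial (Fin N) ℝ) :
    linForm a * divDiff a f = f - reflPoly a f := by
  have h := congrArg (Polynomial.eval (linForm a)) (Polynomial.X_mul_divX_add (shiftAlong a f))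
  rw [Polynomial.eval_add, Polynomial.eval_mul, Polynomial.eval_X, Polynomial.eval_C,
    shiftAlong_coeff_zero, shiftAlong_eval_linForm] at h
  change linForm a * -((shiftAlong a f).divX.eval (linForm a)) = _
  rw [← h]
  ring

/-- The directional derivative `∑ j, a_j ∂/∂x_j`. -/
def dirDeriv {N : ℕ} (a : Fin N → ℝ) : Module.End ℝ (MvPolynomial (Fin N) ℝ) :=
  ∑ j, a j • (MvPolynomial.pderiv j).toLinearMap

/-- `e^T f = ∑ n, T^n f / n!`; it is used only for operators `T` lowering the degree, for which
only finitely many terms are nonzero. -/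
def polyExp {N : ℕ} (T : Module.End ℝ (MvPolynomial (Fin N) ℝ)) (f : MvPolynomial (Fin N) ℝ) :
    MvPolynomial (Fin N) ℝ :=
  ∑ᶠ n : ℕ, (1 / (n.factorial : ℝ)) • (T ^ n) f

/-! ### Type A Dunkl operators and nonsymmetric Jack polynomials -/

/-- The root `e_i - e_j`. -/
def rootA {N : ℕ} (i j : Fin N) : Fin N → ℝ :=
  Pi.single i 1 - Pi.single j 1

/-- `D_i f = ∂f/∂x_i + κ ∑_{j ≠ i} (f(x) - f(x (i,j))) / (x_i - x_j)`. -/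
def dunklA {N : ℕ} (κ : ℝ) (i : Fin N) : Module.End ℝ (MvPolynomial (Fin N) ℝ) :=
  (MvPolynomial.pderiv i).toLinearMap + κ • ∑ j ∈ Finset.univ.erase i, divDiff (rootA i j)

/-- `U_i f = D_i (x_i f) - κ ∑_{j < i} (j,i) f`. -/
def cherednikA {N : ℕ} (κ : ℝ) (i : Fin N) : Module.End ℝ (MvPolynomial (Fin N) ℝ) :=
  dunklA κ i ∘ₗ LinearMap.mulLeft ℝ (MvPolynomial.X i)
    - κ • ∑ j ∈ Finset.Iio i, (reflPoly (rootA j i)).toLinearMap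

/-- The rank `r(α, i)`. -/
def compRank {N : ℕ} (α : Fin N → ℕ) (i : Fin N) : ℕ :=
  (Finset.univ.filter fun j => α i < α j).card
    + (Finset.univ.filter fun j => j ≤ i ∧ α j = α i).card

/-- `ξ_i(α) = (N - r(α,i)) κ + α_i + 1`. -/
def xi {N : ℕ} (κ : ℝ) (α : Fin N → ℕ) (i : Fin N) : ℝ :=
  ((N : ℝ) - compRank α i) * κ + α i + 1

/-- The partition `α⁺`: the entries of `α` in non-increasing order. -/
def sortDesc {N : ℕ} (α : Fin N → ℕ) : Fin N → ℕ :=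
  α ∘ Tuple.sort (fun i => OrderDual.toDual (α i))

/-- `α ≻ β`. -/
def Dominates {N : ℕ} (α β : Fin N → ℕ) : Prop :=
  α ≠ β ∧ ∀ j, ∑ i ∈ Finset.Iic j, β i ≤ ∑ i ∈ Finset.Iic j, α i

/-- `α ▷ β`. -/
def Above {N : ℕ} (α β : Fin N → ℕ) : Prop :=
  ∑ i, α i = ∑ i, β i ∧
    (Dominates (sortDesc α) (sortDesc β) ∨ (sortDesc α = sortDesc β ∧ Dominates α β))

/-- The coefficient of `x^β` in `f`. -/
def coeffAt {N : ℕ} (β : Fin N → ℕ) (f : MvPolynomial (Fin N) ℝ) : ℝ :=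
  MvPolynomial.coeff (Finsupp.equivFunOnFinite.symm β) f

/-- `z` is an `x`-monic simultaneous eigenfunction with label `α`:
`U_i z = ξ_i(α) z` for all `i`, and `z = x^α + ∑_{α ▷ β} A_β x^β`. -/
def IsNSJack {N : ℕ} (κ : ℝ) (α : Fin N → ℕ) (z : MvPolynomial (Fin N) ℝ) : Prop :=
  (∀ i, cherednikA κ i z = xi κ α i • z) ∧ coeffAt α z = 1 ∧
    ∀ β, coeffAt β z ≠ 0 → β = α ∨ Above α β

/-- The nonsymmetric Jack polynomial `ζ_α`: the polynomial satisfying `IsNSJack κ α`. -/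
def nsJack {N : ℕ} (κ : ℝ) (α : Fin N → ℕ) : MvPolynomial (Fin N) ℝ :=
  Classical.epsilon (IsNSJack κ α)

/-- `E_ε(α) = ∏_{i < j, α_i < α_j} (1 + ε κ / ((r(α,i) - r(α,j)) κ + α_j - α_i))`. -/
def jackCoeff {N : ℕ} (ε κ : ℝ) (α : Fin N → ℕ) : ℝ :=
  ∏ p ∈ (Finset.univ : Finset (Fin N × Fin N)).filter (fun p => p.1 < p.2 ∧ α p.1 < α p.2),
    (1 + ε * κ / (((compRank α p.1 : ℝ) - compRank α p.2) * κ + α p.2 - α p.1))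

/-- The symmetric Jack polynomial `j_μ = ∑_{α⁺ = μ} E_{-1}(α) ζ_α` of a partition `μ`; the sum is
over the distinct rearrangements of `μ`. -/
def jack {N : ℕ} (κ : ℝ) (μ : Fin N → ℕ) : MvPolynomial (Fin N) ℝ :=
  ∑ α ∈ (Finset.univ : Finset (Equiv.Perm (Fin N))).image (fun w i => μ (w i)),
    jackCoeff (-1) κ α • nsJack κ α

/-! ### The coordinates `y` and the operators in four variables

Polynomials on `ℝ⁴` are polynomials in `x_1, …, x_4` (indexed by `Fin 4`), and
`y_i = ⟨x, v_i⟩` for `i = 0, …, 3`. -/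

/-- The orthonormal basis `v_0, v_1, v_2, v_3` of `ℝ⁴`. -/
def v : Fin 4 → Fin 4 → ℝ :=
  ![![1 / 2, 1 / 2, 1 / 2, 1 / 2], ![1 / 2, 1 / 2, -1 / 2, -1 / 2],
    ![1 / 2, -1 / 2, 1 / 2, -1 / 2], ![1 / 2, -1 / 2, -1 / 2, 1 / 2]]

/-- `y_i = ⟨x, v_i⟩` as a polynomial in `x`. -/
def y (i : Fin 4) : MvPolynomial (Fin 4) ℝ := linForm (v i)

/-- The normal of the hyperplane `y_i - y_j = 0`, `i, j ∈ {1,2,3}`; `σ_ij` is its reflection. -/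
def rootSigma (i j : Fin 3) : Fin 4 → ℝ := v i.succ - v j.succ

/-- The normal of the hyperplane `y_i + y_j = 0`, `i, j ∈ {1,2,3}`; `τ_ij` is its reflection. -/
def rootTau (i j : Fin 3) : Fin 4 → ℝ := v i.succ + v j.succ

/-- `D_i^B f = ∂f/∂y_i + κ ∑_{j ≠ i} ((f - σ_ij f)/(y_i - y_j) + (f - τ_ij f)/(y_i + y_j))`,
`i ∈ {1,2,3}`. -/
def dunklB (κ : ℝ) (i : Fin 3) : Module.End ℝ (MvPolynomial (Fin 4) ℝ) :=
  dirDeriv (v i.succ)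
    + κ • ∑ j ∈ Finset.univ.erase i, (divDiff (rootSigma i j) + divDiff (rootTau i j))

/-- `U_i^B f = D_i^B (y_i f) - κ ∑_{j < i} (σ_ij + τ_ij) f`. -/
def cherednikB (κ : ℝ) (i : Fin 3) : Module.End ℝ (MvPolynomial (Fin 4) ℝ) :=
  dunklB κ i ∘ₗ LinearMap.mulLeft ℝ (y i.succ)
    - κ • ∑ j ∈ Finset.Iio i, ((reflPoly (rootSigma i j)).toLinearMap
      + (reflPoly (rootTau i j)).toLinearMap)

/-- `D_0 f = ½ ∑ ∂f/∂x_i + κ' (f - f(x σ_0)) / ⟨x, v_0⟩`. -/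
def dunklZero (κ' : ℝ) : Module.End ℝ (MvPolynomial (Fin 4) ℝ) :=
  dirDeriv (v 0) + κ' • divDiff (v 0)

/-- `D'_i f = D_i f + κ' (f - f(x σ_0)) / (2 ⟨x, v_0⟩)`. -/
def dunklPrime (κ κ' : ℝ) (i : Fin 4) : Module.End ℝ (MvPolynomial (Fin 4) ℝ) :=
  dunklA κ i + (κ' / 2) • divDiff (v 0)

/-- `Δ_h = ∑ (D'_i)²`. -/
def laplaceH (κ κ' : ℝ) : Module.End ℝ (MvPolynomial (Fin 4) ℝ) :=
  ∑ i, dunklPrime κ κ' i ^ 2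

/-- `Δ_B = ∑ (D_i^B)²`. -/
def laplaceB (κ : ℝ) : Module.End ℝ (MvPolynomial (Fin 4) ℝ) :=
  ∑ i, dunklB κ i ^ 2

/-- `∑ U_i^B + D_0 y_0 - κ' σ_0 - 2`. -/
def gaugeOp (κ κ' : ℝ) : Module.End ℝ (MvPolynomial (Fin 4) ℝ) :=
  ∑ i, cherednikB κ i + dunklZero κ' ∘ₗ LinearMap.mulLeft ℝ (y 0)
    - κ' • (reflPoly (v 0)).toLinearMap - (2 : ℝ) • LinearMap.id

/-- Substitution of `(y_1, y_2, y_3)` into a polynomial in three variables. -/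
def atY : MvPolynomial (Fin 3) ℝ →ₐ[ℝ] MvPolynomial (Fin 4) ℝ :=
  MvPolynomial.aeval fun i => y i.succ

/-- The permutation `w` attached to `E = {i : γ_i odd}`, `#E = k`: it maps `{1,…,k}` onto `E` and
`{k+1,…,3}` onto the complement of `E`, increasingly on both sets. (`Tuple.sort` is the stable
sorting permutation.) -/
def parityPerm (γ : Fin 3 → ℕ) : Equiv.Perm (Fin 3) :=
  Tuple.sort fun i => if Odd (γ i) then 0 else 1

/-- `p_γ = w (y_{E_k} ζ_α(y²))` as a polynomial in `(y_1, y_2, y_3)`, where `E = {i : γ_i odd}`,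
`k = #E`, `w = parityPerm γ`, `β_i = γ_{w(i)}` (so `γ = w β`) and `α_i = ⌊β_i / 2⌋`. -/
def pPoly (κ : ℝ) (γ : Fin 3 → ℕ) : MvPolynomial (Fin 3) ℝ :=
  MvPolynomial.rename (parityPerm γ)
    ((∏ i ∈ Finset.univ.filter
        (fun i : Fin 3 => i.val < (Finset.univ.filter fun j => Odd (γ j)).card),
        MvPolynomial.X i)
      * MvPolynomial.expand 2 (nsJack κ fun i => γ (parityPerm γ i) / 2))

/-- The Laguerre polynomial
`L_n^a(t) = ((a+1)_n / n!) ∑_{i ≤ n} ((-n)_i / (a+1)_i) t^i / i!`. -/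
def laguerre (n : ℕ) (a : ℝ) : Polynomial ℝ :=
  Polynomial.C ((ascPochhammer ℝ n).eval (a + 1) / n.factorial)
    * ∑ i ∈ Finset.range (n + 1),
        Polynomial.C ((ascPochhammer ℝ i).eval (-(n : ℝ)) / (ascPochhammer ℝ i).eval (a + 1)
          / i.factorial) * Polynomial.X ^ i

/-- `e^{-Δ_h/2}(p_γ(y) y_0^n)`. -/
def hermitePoly (κ κ' : ℝ) (γ : Fin 3 → ℕ) (n : ℕ) : MvPolynomial (Fin 4) ℝ :=
  polyExp ((-1 / 2 : ℝ) • laplaceH κ κ') (atY (pPoly κ γ) * y 0 ^ n)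

/-- `e^{-Δ_B/2}((y_1 y_2 y_3)^s j_μ(y²)) L_n^{κ'-1/2}(y_0²/2)`. -/
def invariantPoly (κ κ' : ℝ) (μ : Fin 3 → ℕ) (s n : ℕ) : MvPolynomial (Fin 4) ℝ :=
  polyExp ((-1 / 2 : ℝ) • laplaceB κ)
      ((y 1 * y 2 * y 3) ^ s * atY (MvPolynomial.expand 2 (jack κ μ)))
    * Polynomial.aeval ((1 / 2 : ℝ) • y 0 ^ 2) (laguerre n (κ' - 1 / 2))

/-! ### The Hamiltonian -/

/-- `x w`, with `(x w)_i = x_{w(i)}`. -/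
def permAct (x : EuclideanSpace ℝ (Fin 4)) (w : Equiv.Perm (Fin 4)) : EuclideanSpace ℝ (Fin 4) :=
  WithLp.toLp 2 fun i => x (w i)

/-- `x σ_0 = x - (∑ x_i) v_0`. -/
def sigmaZero (x : EuclideanSpace ℝ (Fin 4)) : EuclideanSpace ℝ (Fin 4) :=
  x - (∑ i, x i) • WithLp.toLp 2 (v 0)

/-- Evaluation of a polynomial at a point. -/
def evalAt (f : MvPolynomial (Fin 4) ℝ) (x : EuclideanSpace ℝ (Fin 4)) : ℝ :=
  MvPolynomial.eval (fun i => x i) f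

/-- The points off the singular hyperplanes `x_i = x_j` and `x_1 + x_2 + x_3 + x_4 = 0`. -/
def regularSet : Set (EuclideanSpace ℝ (Fin 4)) :=
  {x | (∀ i j, i ≠ j → x i ≠ x j) ∧ ∑ i, x i ≠ 0}

/-- `H = -Δ + |x|²/4 + 2κ ∑_{i<j} (κ - (i,j))/(x_i - x_j)² + 4κ'(κ' - σ_0)/(∑ x_i)²`. -/
def hamiltonian (κ κ' : ℝ) (f : EuclideanSpace ℝ (Fin 4) → ℝ) (x : EuclideanSpace ℝ (Fin 4)) : ℝ :=
  -(Δ f) x + ‖x‖ ^ 2 / 4 * f x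
    + 2 * κ * ∑ i, ∑ j ∈ Finset.Ioi i,
        (κ * f x - f (permAct x (Equiv.swap i j))) / (x i - x j) ^ 2
    + 4 * κ' * (κ' * f x - f (sigmaZero x)) / (∑ i, x i) ^ 2

/-- `ψ_0(x) = ∏_{i<j} |x_i - x_j|^κ |y_0|^κ' exp(-|x|²/4)`. -/
def psiZero (κ κ' : ℝ) (x : EuclideanSpace ℝ (Fin 4)) : ℝ :=
  (∏ i, ∏ j ∈ Finset.Ioi i, |x i - x j| ^ κ) * |evalAt (y 0) x| ^ κ'
    * Real.exp (-(1 / 4) * ‖x‖ ^ 2)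

/-- `ψ` is an eigenfunction of the Hamiltonian with energy `E`: it is square-integrable, twice
continuously differentiable off the singular hyperplanes and not identically zero there, and
`H ψ = E ψ` holds off the singular hyperplanes. -/
structure IsEigenfunction (κ κ' E : ℝ) (ψ : EuclideanSpace ℝ (Fin 4) → ℝ) : Prop where
  memLp : MeasureTheory.MemLp ψ 2 MeasureTheory.volume
  contDiffOn : ContDiffOn ℝ 2 ψ regularSet
  exists_ne_zero : ∃ x ∈ regularSet, ψ x ≠ 0
  eigen : ∀ x ∈ regularSet, hamiltonian κ κ' ψ x = E * ψ x

/-- Invariance under `W`, the group generated by the permutations of coordinates and `σ_0`. -/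
def WInvariant (ψ : EuclideanSpace ℝ (Fin 4) → ℝ) : Prop :=
  (∀ (w : Equiv.Perm (Fin 4)) x, ψ (permAct x w) = ψ x) ∧ ∀ x, ψ (sigmaZero x) = ψ x

end DunklFour

end

open DunklFour

open scoped Laplacian

noncomputable section

namespace DunklFour

open MvPolynomial

variable {N : ℕ}

/-! ### Linear forms and reflections -/

/-! The operator $\mathcal H$ is conjugate to the Euler operator, so its eigenfunctions of the form
polynomial times $\psi_0$ correspond to homogeneous polynomials.

At regular points $\psi_0^{-1}\mathcal H\psi_0 = E+(2+6\kappa+\kappa')-\Delta_h$, where $E=\sum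
x_i\partial_i$ (`conjugated_hamiltonian`). This compares the logarithmic derivatives of $\psi_0$
with the explicit form of a Dunkl Laplacian (`eval_dunklLap`). On the other side, the reflections in
$\sum\mathcal U_i^B+\mathcal D_0y_0-\kappa'\sigma_0-2$ cancel and leave $E+(2+6\kappa+\kappa')$
(`gaugeOp_apply`). Since $\Delta_h$ lowers degree by two,
$e^{-\Delta_h/2}Ee^{\Delta_h/2}=E-\Delta_h$ (`euler_polyExp`). Hence $q\psi_0$ is an eigenfunction
exactly when $e^{\Delta_h/2}q$ is nonzero and homogeneous, and the degree gives the energy. Square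
integrability comes from the Gaussian and from $\kappa,\kappa'\ge0$.

The operators in $x$ and in $y$ all belong to one Dunkl system, with roots $e_i-e_j$ and $v_0$: the
six forms $y_i\pm y_j$ are the $x_i-x_j$ up to sign (the coincidence $D_3=A_3$). Its Laplacian does
not depend on the orthonormal basis, so $\Delta_h=\Delta_B+\mathcal D_0^2$. The summands commute and
act on separate variables, so $e^{-\Delta_h/2}$ factors; on $y_0^{2n}$ the second factor gives
$(-2)^nn!\,L_n^{\kappa'-1/2}(y_0^2/2)$ (`polyExp_seed_jack`).

The $\zeta_\alpha$ exist and are unique because the $\mathcal U_i$ commute, are triangular on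
monomials, and have simple joint spectrum: $\xi(\alpha)$ determines $\alpha$ (`xi_injective`). An
adjacent transposition acts on a pair $\zeta_\alpha,\zeta_{\alpha s}$ by an explicit two-term
formula, and the coefficients in $j_\lambda$ are those that make each pair symmetric. The
$j_\lambda$ are triangular against monomials, so they span the symmetric polynomials
(`mem_span_jack`).

For the converse, $W$ acts on $y_1,y_2,y_3$ by permutations and even sign changes, and on $y_0$ by
sign. A $W$-invariant polynomial is therefore a sum of terms $(y_1y_2y_3)^sf(y^2)y_0^{2n}$ with
$s\in\{0,1\}$ and $f$ symmetric; expanding $f$ in the $j_\lambda$ of its degree finishes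
(`mem_span_invariantPoly`). -/

theorem linForm_add (a b : Fin N → ℝ) : linForm (a + b) = linForm a + linForm b := by
  simp [linForm, add_mul, Finset.sum_add_distrib]

theorem linForm_smul (c : ℝ) (a : Fin N → ℝ) : linForm (c • a) = C c * linForm a := by
  simp [linForm, Finset.mul_sum, mul_assoc]

theorem linForm_neg (a : Fin N → ℝ) : linForm (-a) = -linForm a := by
  simp [linForm]

theorem linForm_sub (a b : Fin N → ℝ) : linForm (a - b) = linForm a - linForm b := by
  rw [sub_eq_add_neg, linForm_add, linForm_neg, sub_eq_add_neg]

@[simp] theorem linForm_zero : linForm (0 : Fin N → ℝ) = 0 := by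
  simp [linForm]

theorem linForm_single (i : Fin N) : linForm (Pi.single i 1) = X i := by
  rw [linForm, Finset.sum_eq_single i]
  · simp
  · intro j _ hj; simp [hj]
  · simp

theorem eval_linForm (a x : Fin N → ℝ) : eval x (linForm a) = a ⬝ᵥ x := by
  simp [linForm, dotProduct]

theorem linForm_ne_zero {a : Fin N → ℝ} (ha : a ≠ 0) : linForm a ≠ 0 := by
  intro h
  have h1 := eval_linForm a a
  rw [h, map_zero] at h1
  exact ha (dotProduct_self_eq_zero.1 h1.symm)

theorem isHomogeneous_linForm (a : Fin N → ℝ) : (linForm a).IsHomogeneous 1 :=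
  IsHomogeneous.sum _ _ _ fun i _ => isHomogeneous_C_mul_X _ i

/-- Two linear maps agree if they agree on `1` and multiplication by a linear form propagates
agreement. -/
theorem induction_linForm {p : MvPolynomial (Fin N) ℝ → Prop} (f : MvPolynomial (Fin N) ℝ)
    (h1 : p 1) (hadd : ∀ f g, p f → p g → p (f + g)) (hsmul : ∀ (c : ℝ) f, p f → p (c • f))
    (hmul : ∀ u f, p f → p (linForm u * f)) : p f := by
  induction f using MvPolynomial.induction_on with
  | C c =>
    have := hsmul c 1 h1
    rwa [smul_eq_C_mul, mul_one] at this
  | add f g hf hg => exact hadd f g hf hg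
  | mul_X f i hf =>
    have := hmul (Pi.single i 1) f hf
    rwa [linForm_single, mul_comm] at this

/-- The reflection along `a` on vectors. -/
def vecRefl (a u : Fin N → ℝ) : Fin N → ℝ := u - (coroot a ⬝ᵥ u) • a

theorem coroot_eq (a : Fin N → ℝ) : coroot a = (2 / (a ⬝ᵥ a)) • a := by
  ext i
  simp only [coroot, Pi.smul_apply, smul_eq_mul, dotProduct, ← sq]
  ring

@[simp] theorem coroot_zero : coroot (0 : Fin N → ℝ) = 0 := by
  simp [coroot_eq]

theorem coroot_neg (a : Fin N → ℝ) : coroot (-a) = -coroot a := by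
  simp [coroot_eq]

theorem dotProduct_self_ne_zero {a : Fin N → ℝ} (ha : a ≠ 0) : a ⬝ᵥ a ≠ 0 :=
  fun h => ha (dotProduct_self_eq_zero.1 h)

theorem coroot_dot_self {a : Fin N → ℝ} (ha : a ≠ 0) : coroot a ⬝ᵥ a = 2 := by
  rw [coroot_eq, smul_dotProduct, smul_eq_mul, div_mul_cancel₀ _ (dotProduct_self_ne_zero ha)]

@[simp] theorem vecRefl_zero (u : Fin N → ℝ) : vecRefl 0 u = u := by
  simp [vecRefl]

theorem vecRefl_neg (a u : Fin N → ℝ) : vecRefl (-a) u = vecRefl a u := by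
  simp [vecRefl, coroot_neg]

theorem vecRefl_smul_right (a u : Fin N → ℝ) (c : ℝ) :
    vecRefl a (c • u) = c • vecRefl a u := by
  simp only [vecRefl, dotProduct_smul, smul_sub, smul_smul, smul_eq_mul]

theorem vecRefl_sub_right (a u w : Fin N → ℝ) :
    vecRefl a (u - w) = vecRefl a u - vecRefl a w := by
  simp only [vecRefl, dotProduct_sub, sub_smul]
  abel

theorem vecRefl_vecRefl (a u : Fin N → ℝ) : vecRefl a (vecRefl a u) = u := by
  by_cases ha : a = 0
  · simp [ha]
  · simp only [vecRefl, dotProduct_sub, dotProduct_smul, coroot_dot_self ha, smul_eq_mul]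
    module

theorem vecRefl_dot (a u w : Fin N → ℝ) : vecRefl a u ⬝ᵥ w = u ⬝ᵥ vecRefl a w := by
  simp only [vecRefl, coroot_eq, dotProduct_sub, sub_dotProduct, dotProduct_smul, smul_dotProduct,
    smul_eq_mul, dotProduct_comm a u]
  ring

theorem vecRefl_dot_vecRefl (a u w : Fin N → ℝ) : vecRefl a u ⬝ᵥ vecRefl a w = u ⬝ᵥ w := by
  rw [vecRefl_dot, vecRefl_vecRefl]

theorem coroot_vecRefl (b a : Fin N → ℝ) : coroot (vecRefl b a) = vecRefl b (coroot a) := by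
  rw [coroot_eq, coroot_eq, vecRefl_dot_vecRefl, vecRefl_smul_right]

theorem vecRefl_conj (b a u : Fin N → ℝ) :
    vecRefl (vecRefl b a) (vecRefl b u) = vecRefl b (vecRefl a u) := by
  rw [vecRefl, vecRefl.eq_1 a u, coroot_vecRefl, vecRefl_dot_vecRefl, vecRefl_sub_right,
    vecRefl_smul_right]

theorem reflPoly_linForm (a u : Fin N → ℝ) :
    reflPoly a (linForm u) = linForm (vecRefl a u) := by
  rw [vecRefl, linForm_sub, linForm_smul]
  simp only [linForm, reflPoly, map_sum, map_mul, aeval_X, algHom_C, algebraMap_eq, mul_sub,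
    Finset.sum_sub_distrib]
  congr 1
  rw [dotProduct, map_sum, Finset.sum_mul]
  refine Finset.sum_congr rfl fun i _ => ?_
  rw [← mul_assoc, ← map_mul, mul_comm (u i)]

theorem algHom_ext_linForm {A : Type*} [CommSemiring A] [Algebra ℝ A]
    {φ ψ : MvPolynomial (Fin N) ℝ →ₐ[ℝ] A} (h : ∀ u, φ (linForm u) = ψ (linForm u)) : φ = ψ := by
  refine MvPolynomial.algHom_ext fun i => ?_
  rw [← linForm_single]
  exact h _

theorem reflPoly_conj (b a : Fin N → ℝ) (f : MvPolynomial (Fin N) ℝ) :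
    reflPoly (vecRefl b a) (reflPoly b f) = reflPoly b (reflPoly a f) := by
  have : (reflPoly (vecRefl b a)).comp (reflPoly b) = (reflPoly b).comp (reflPoly a) :=
    algHom_ext_linForm fun u => by simp [reflPoly_linForm, vecRefl_conj]
  exact DFunLike.congr_fun this f

theorem reflPoly_neg (a : Fin N → ℝ) : reflPoly (-a) = reflPoly a :=
  algHom_ext_linForm fun u => by simp [reflPoly_linForm, vecRefl_neg]

/-! ### Divided differences and derivatives -/

-- The families of roots below are indexed by all ordered pairs, diagonal included, so zero roots
-- occur. There the defining equation reads $0=0$, and the value has to be read off `shiftAlong`.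
@[simp] theorem divDiff_zero_root (f : MvPolynomial (Fin N) ℝ) : divDiff 0 f = 0 := by
  have h : shiftAlong (0 : Fin N → ℝ) f = Polynomial.C f := by
    have : shiftAlong (0 : Fin N → ℝ) = (Algebra.ofId (MvPolynomial (Fin N) ℝ) _).restrictScalars ℝ :=
      MvPolynomial.algHom_ext fun i => by simp [shiftAlong, Algebra.ofId_apply]
    rw [this]; rfl
  change -((shiftAlong 0 f).divX.eval (linForm 0)) = 0
  rw [h, Polynomial.divX_C]
  simp

/-- The polynomial ring is a domain, so for a nonzero root the defining equation determines the
divided difference. Identities between divided differences are checked after multiplication by the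
root. -/
theorem divDiff_eq_of_mul {a : Fin N → ℝ} (ha : a ≠ 0) {f g : MvPolynomial (Fin N) ℝ}
    (h : linForm a * g = f - reflPoly a f) : divDiff a f = g :=
  mul_left_cancel₀ (linForm_ne_zero ha) ((linForm_mul_divDiff a f).trans h.symm)

theorem divDiff_neg_root (a : Fin N → ℝ) (f : MvPolynomial (Fin N) ℝ) :
    divDiff (-a) f = -divDiff a f := by
  by_cases ha : a = 0
  · simp [ha]
  · refine divDiff_eq_of_mul (neg_ne_zero.2 ha) ?_
    rw [linForm_neg, neg_mul_neg, linForm_mul_divDiff, reflPoly_neg]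

theorem divDiff_mul (a : Fin N → ℝ) (p f : MvPolynomial (Fin N) ℝ) :
    divDiff a (p * f) = p * divDiff a f + divDiff a p * reflPoly a f := by
  by_cases ha : a = 0
  · simp [ha]
  · refine divDiff_eq_of_mul ha ?_
    have h1 := linForm_mul_divDiff a f
    have h2 := linForm_mul_divDiff a p
    rw [map_mul]
    linear_combination p * h1 + reflPoly a f * h2

theorem divDiff_linForm (a u : Fin N → ℝ) : divDiff a (linForm u) = C (coroot a ⬝ᵥ u) := by
  by_cases ha : a = 0
  · simp [ha]
  · refine divDiff_eq_of_mul ha ?_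
    rw [reflPoly_linForm, vecRefl, linForm_sub, linForm_smul]
    ring

theorem divDiff_linForm_mul (a u : Fin N → ℝ) (f : MvPolynomial (Fin N) ℝ) :
    divDiff a (linForm u * f) = linForm u * divDiff a f + (coroot a ⬝ᵥ u) • reflPoly a f := by
  rw [divDiff_mul, divDiff_linForm, smul_eq_C_mul]

theorem vecRefl_ne_zero {a : Fin N → ℝ} (b : Fin N → ℝ) (ha : a ≠ 0) : vecRefl b a ≠ 0 := by
  intro h
  apply ha
  rw [← vecRefl_vecRefl b a, h]
  simp [vecRefl]

theorem reflPoly_divDiff (b a : Fin N → ℝ) (f : MvPolynomial (Fin N) ℝ) :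
    reflPoly b (divDiff a f) = divDiff (vecRefl b a) (reflPoly b f) := by
  by_cases ha : a = 0
  · have : vecRefl b 0 = (0 : Fin N → ℝ) := by simp [vecRefl]
    simp [ha, this]
  · refine (divDiff_eq_of_mul (vecRefl_ne_zero b ha) ?_).symm
    rw [← reflPoly_linForm, ← map_mul, linForm_mul_divDiff, map_sub, reflPoly_conj]

@[simp] theorem divDiff_one (a : Fin N → ℝ) : divDiff a 1 = 0 := by
  by_cases ha : a = 0
  · simp [ha]
  · exact divDiff_eq_of_mul ha (by simp)

theorem dirDeriv_apply (ξ : Fin N → ℝ) (f : MvPolynomial (Fin N) ℝ) :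
    dirDeriv ξ f = ∑ j, ξ j • pderiv j f := by
  simp [dirDeriv]

theorem dirDeriv_mul (ξ : Fin N → ℝ) (f g : MvPolynomial (Fin N) ℝ) :
    dirDeriv ξ (f * g) = dirDeriv ξ f * g + f * dirDeriv ξ g := by
  simp only [dirDeriv_apply, Derivation.leibniz, smul_add, Finset.sum_add_distrib, Finset.sum_mul,
    Finset.mul_sum, smul_eq_mul]
  rw [add_comm]
  congr 1 <;> refine Finset.sum_congr rfl fun i _ => ?_
  · rw [smul_mul_assoc, mul_comm]
  · rw [mul_smul_comm]

theorem dirDeriv_one (ξ : Fin N → ℝ) : dirDeriv ξ (1 : MvPolynomial (Fin N) ℝ) = 0 := by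
  simp [dirDeriv_apply]

theorem dirDeriv_linForm (ξ u : Fin N → ℝ) : dirDeriv ξ (linForm u) = C (ξ ⬝ᵥ u) := by
  have h : ∀ j, pderiv j (linForm u) = C (u j) := by
    intro j
    rw [linForm, map_sum, Finset.sum_eq_single j]
    · simp
    · intro i _ hi; simp [pderiv_X_of_ne hi]
    · simp
  simp [dirDeriv_apply, h, dotProduct, smul_eq_C_mul]

theorem reflPoly_dirDeriv (b ξ : Fin N → ℝ) (f : MvPolynomial (Fin N) ℝ) :
    reflPoly b (dirDeriv ξ f) = dirDeriv (vecRefl b ξ) (reflPoly b f) := by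
  induction f using induction_linForm with
  | h1 => simp [dirDeriv_one]
  | hadd f g hf hg => simp only [map_add, hf, hg]
  | hsmul c f hf => simp only [map_smul, hf]
  | hmul u f hf =>
    simp only [dirDeriv_mul, map_add, map_mul, hf, reflPoly_linForm, dirDeriv_linForm,
      vecRefl_dot_vecRefl, algHom_C, algebraMap_eq]

theorem dirDeriv_add (ξ η : Fin N → ℝ) : dirDeriv (ξ + η) = dirDeriv ξ + dirDeriv η := by
  simp [dirDeriv, add_smul, Finset.sum_add_distrib]

theorem dirDeriv_smul (c : ℝ) (ξ : Fin N → ℝ) : dirDeriv (c • ξ) = c • dirDeriv ξ := by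
  simp [dirDeriv, Finset.smul_sum, smul_smul]

/-! ### Dunkl operators of a finite family of roots -/

section Family

variable {ι : Type*} [Fintype ι]

/-- The Dunkl operator in the direction `ξ` of the roots `a i` with multiplicities `k i`. -/
def dunkl (a : ι → Fin N → ℝ) (k : ι → ℝ) (ξ : Fin N → ℝ) :
    Module.End ℝ (MvPolynomial (Fin N) ℝ) :=
  dirDeriv ξ + ∑ i, (k i * (a i ⬝ᵥ ξ)) • divDiff (a i)

/-- The family of roots with multiplicities is stable, up to signs, under its reflections. -/
def ReflStable (a : ι → Fin N → ℝ) (k : ι → ℝ) : Prop :=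
  ∀ i, ∃ π : Equiv.Perm ι, ∀ j, k (π j) = k j ∧
    (a (π j) = vecRefl (a i) (a j) ∨ a (π j) = -vecRefl (a i) (a j))

variable (a : ι → Fin N → ℝ) (k : ι → ℝ)

theorem dunkl_apply (ξ : Fin N → ℝ) (f : MvPolynomial (Fin N) ℝ) :
    dunkl a k ξ f = dirDeriv ξ f + ∑ i, (k i * (a i ⬝ᵥ ξ)) • divDiff (a i) f := by
  simp [dunkl]

theorem dunkl_one (ξ : Fin N → ℝ) : dunkl a k ξ 1 = 0 := by
  simp [dunkl_apply, dirDeriv_one]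

theorem dunkl_add (ξ η : Fin N → ℝ) : dunkl a k (ξ + η) = dunkl a k ξ + dunkl a k η := by
  simp only [dunkl, dirDeriv_add, dotProduct_add, mul_add, add_smul, Finset.sum_add_distrib]
  abel

theorem dunkl_smul (c : ℝ) (ξ : Fin N → ℝ) : dunkl a k (c • ξ) = c • dunkl a k ξ := by
  simp only [dunkl, dirDeriv_smul, dotProduct_smul, smul_add, Finset.smul_sum, smul_smul,
    smul_eq_mul]
  congr 1
  exact Finset.sum_congr rfl fun i _ => by ring_nf

/-- The Dunkl operators as a linear function of the direction. -/
def dunklLin : (Fin N → ℝ) →ₗ[ℝ] Module.End ℝ (MvPolynomial (Fin N) ℝ) where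
  toFun := dunkl a k
  map_add' := dunkl_add a k
  map_smul' := dunkl_smul a k

/-- The basic commutation relation. A linear map on polynomials is determined by its value at `1`
and its commutators with linear forms, so operator identities below reduce to this one. -/
theorem dunkl_linForm_mul (ξ u : Fin N → ℝ) (f : MvPolynomial (Fin N) ℝ) :
    dunkl a k ξ (linForm u * f) = linForm u * dunkl a k ξ f + (ξ ⬝ᵥ u) • f
      + ∑ i, (k i * (a i ⬝ᵥ ξ) * (coroot (a i) ⬝ᵥ u)) • reflPoly (a i) f := by
  simp only [dunkl_apply, dirDeriv_mul, dirDeriv_linForm, divDiff_linForm_mul, smul_add,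
    Finset.sum_add_distrib, mul_add, Finset.mul_sum, mul_smul_comm, smul_smul]
  rw [← smul_eq_C_mul]
  abel

variable {a k}

/-- The permutation `π` reindexes the sum over roots. A sign change of a root is harmless, because
both the pairing with the direction and the divided difference change sign. -/
theorem reflPoly_dunkl (h : ReflStable a k) (i : ι) (ξ : Fin N → ℝ)
    (f : MvPolynomial (Fin N) ℝ) :
    reflPoly (a i) (dunkl a k ξ f) = dunkl a k (vecRefl (a i) ξ) (reflPoly (a i) f) := by
  obtain ⟨π, hπ⟩ := h i
  simp only [dunkl_apply, map_add, map_sum, map_smul, reflPoly_dirDeriv, reflPoly_divDiff]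
  congr 1
  rw [← Equiv.sum_comp π fun j =>
    (k j * (a j ⬝ᵥ vecRefl (a i) ξ)) • divDiff (a j) (reflPoly (a i) f)]
  refine Finset.sum_congr rfl fun j _ => ?_
  obtain ⟨h1, h2 | h2⟩ := hπ j
  · rw [h1, h2, vecRefl_dot_vecRefl]
  · rw [h1, h2, neg_dotProduct, vecRefl_dot_vecRefl, divDiff_neg_root, mul_neg, neg_smul_neg]

theorem dunkl_vecRefl (b ξ : Fin N → ℝ) :
    dunkl a k (vecRefl b ξ) = dunkl a k ξ - (coroot b ⬝ᵥ ξ) • dunkl a k b := by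
  change dunklLin a k (vecRefl b ξ) = dunklLin a k ξ - _ • dunklLin a k b
  rw [vecRefl, map_sub, map_smul]

theorem dunkl_reflPoly (h : ReflStable a k) (i : ι) (ξ : Fin N → ℝ)
    (f : MvPolynomial (Fin N) ℝ) :
    dunkl a k ξ (reflPoly (a i) f) = reflPoly (a i) (dunkl a k ξ f)
      - (coroot (a i) ⬝ᵥ ξ) • reflPoly (a i) (dunkl a k (a i) f) := by
  rw [← map_smul, ← map_sub]
  have := reflPoly_dunkl h i (vecRefl (a i) ξ) f
  rw [vecRefl_vecRefl] at this
  rw [← this, dunkl_vecRefl]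
  simp

/-- Dunkl operators commute. -/
theorem dunkl_comm (h : ReflStable a k) (ξ η : Fin N → ℝ) (f : MvPolynomial (Fin N) ℝ) :
    dunkl a k ξ (dunkl a k η f) = dunkl a k η (dunkl a k ξ f) := by
  induction f using induction_linForm with
  | h1 => simp [dunkl_one]
  | hadd f g hf hg => simp only [map_add, hf, hg]
  | hsmul c f hf => simp only [map_smul, hf]
  | hmul u f hf =>
    simp only [dunkl_linForm_mul, map_add, map_sum, map_smul, dunkl_reflPoly h, hf, smul_sub,
      Finset.sum_sub_distrib]
    -- The corrections from moving past reflections are symmetric in `ξ` and `η`, because a coroot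
    -- is a multiple of its root.
    have e : ∑ i, (k i * (a i ⬝ᵥ η) * (coroot (a i) ⬝ᵥ u)) •
          (coroot (a i) ⬝ᵥ ξ) • reflPoly (a i) (dunkl a k (a i) f)
        = ∑ i, (k i * (a i ⬝ᵥ ξ) * (coroot (a i) ⬝ᵥ u)) •
          (coroot (a i) ⬝ᵥ η) • reflPoly (a i) (dunkl a k (a i) f) := by
      refine Finset.sum_congr rfl fun i _ => ?_
      rw [smul_smul, smul_smul, coroot_eq, smul_dotProduct, smul_dotProduct, smul_dotProduct]
      simp only [smul_eq_mul]
      congr 1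
      ring
    rw [e]
    abel

/-! ### The Dunkl Laplacian -/

variable (a k)

/-- The sum of the squares of the Dunkl operators in the directions `w j`. -/
def dunklLap {M : Type*} [Fintype M] (w : M → Fin N → ℝ) :
    Module.End ℝ (MvPolynomial (Fin N) ℝ) :=
  ∑ j, dunkl a k (w j) ^ 2

theorem dunklLap_apply {M : Type*} [Fintype M] (w : M → Fin N → ℝ)
    (f : MvPolynomial (Fin N) ℝ) :
    dunklLap a k w f = ∑ j, dunkl a k (w j) (dunkl a k (w j) f) := by
  simp [dunklLap, sq]

variable {a k}

/-- The reflection along `a i` negates its own direction. For a zero root both sides vanish. -/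
theorem dunkl_self_reflPoly (h : ReflStable a k) (i : ι) (f : MvPolynomial (Fin N) ℝ) :
    dunkl a k (a i) (reflPoly (a i) f) = -reflPoly (a i) (dunkl a k (a i) f) := by
  by_cases ha : a i = 0
  · have : dunkl a k (0 : Fin N → ℝ) = 0 := map_zero (dunklLin a k)
    simp [ha, this]
  · rw [dunkl_reflPoly h, coroot_dot_self ha]
    module

theorem sum_dot_smul_dunkl {M : Type*} [Fintype M] {w : M → Fin N → ℝ}
    (hw : ∀ u, ∑ j, (w j ⬝ᵥ u) • w j = u) (u : Fin N → ℝ) (f : MvPolynomial (Fin N) ℝ) :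
    ∑ j, (w j ⬝ᵥ u) • dunkl a k (w j) f = dunkl a k u f := by
  conv_rhs => rw [← hw u]
  change _ = dunklLin a k _ f
  rw [map_sum, LinearMap.sum_apply]
  simp only [map_smul]
  rfl

/-- This is $[\Delta,u]=2T_u$. Commuting `u` past the two Dunkl operators produces reflection terms
with the reflection inside and outside; they cancel because $T_a$ anticommutes with $s_a$. -/
theorem dunklLap_linForm_mul (h : ReflStable a k) {M : Type*} [Fintype M] {w : M → Fin N → ℝ}
    (hw : ∀ u, ∑ j, (w j ⬝ᵥ u) • w j = u) (u : Fin N → ℝ) (f : MvPolynomial (Fin N) ℝ) :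
    dunklLap a k w (linForm u * f)
      = linForm u * dunklLap a k w f + (2 : ℝ) • dunkl a k u f := by
  simp only [dunklLap_apply, dunkl_linForm_mul, map_add, map_sum, map_smul,
    Finset.sum_add_distrib, sum_dot_smul_dunkl hw, Finset.mul_sum]
  rw [Finset.sum_comm]
  conv_lhs =>
    arg 2
    rw [Finset.sum_comm]
  -- Summing over the frame `w` replaces the directions `w j` by the single direction `a i`.
  have e : ∀ i, ∑ j, (k i * (a i ⬝ᵥ w j) * (coroot (a i) ⬝ᵥ u)) •
        dunkl a k (w j) (reflPoly (a i) f)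
      = (k i * (coroot (a i) ⬝ᵥ u)) • dunkl a k (a i) (reflPoly (a i) f) := by
    intro i
    rw [← sum_dot_smul_dunkl hw, Finset.smul_sum]
    refine Finset.sum_congr rfl fun j _ => ?_
    rw [smul_smul, dotProduct_comm (w j)]
    ring_nf
  have e' : ∀ i, ∑ j, (k i * (a i ⬝ᵥ w j) * (coroot (a i) ⬝ᵥ u)) •
        reflPoly (a i) (dunkl a k (w j) f)
      = (k i * (coroot (a i) ⬝ᵥ u)) • reflPoly (a i) (dunkl a k (a i) f) := by
    intro i
    rw [← sum_dot_smul_dunkl hw, map_sum, Finset.smul_sum]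
    refine Finset.sum_congr rfl fun j _ => ?_
    rw [map_smul, smul_smul, dotProduct_comm (w j)]
    ring_nf
  simp only [e, e', dunkl_self_reflPoly h, smul_neg, Finset.sum_neg_distrib]
  module

/-- A linear map is determined by its value at `1` and its commutators with linear forms. -/
theorem eq_of_linForm_mul {A B : Module.End ℝ (MvPolynomial (Fin N) ℝ)} (h1 : A 1 = B 1)
    {T : (Fin N → ℝ) → MvPolynomial (Fin N) ℝ → MvPolynomial (Fin N) ℝ}
    (hA : ∀ u f, A (linForm u * f) = linForm u * A f + T u f)
    (hB : ∀ u f, B (linForm u * f) = linForm u * B f + T u f) : A = B := by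
  refine LinearMap.ext fun f => ?_
  induction f using induction_linForm with
  | h1 => exact h1
  | hadd f g hf hg => simp only [map_add, hf, hg]
  | hsmul c f hf => simp only [map_smul, hf]
  | hmul u f hf => rw [hA, hB, hf]

theorem dunklLap_one {M : Type*} [Fintype M] (w : M → Fin N → ℝ) : dunklLap a k w 1 = 0 := by
  simp [dunklLap_apply, dunkl_one]

/-- The commutator $2T_u$ with a linear form does not involve the frame, so neither does the
Laplacian. -/
theorem dunklLap_eq (h : ReflStable a k) {M M' : Type*} [Fintype M] [Fintype M']
    {w : M → Fin N → ℝ} {w' : M' → Fin N → ℝ} (hw : ∀ u, ∑ j, (w j ⬝ᵥ u) • w j = u)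
    (hw' : ∀ u, ∑ j, (w' j ⬝ᵥ u) • w' j = u) : dunklLap a k w = dunklLap a k w' :=
  eq_of_linForm_mul (by simp [dunklLap_one]) (dunklLap_linForm_mul h hw)
    (dunklLap_linForm_mul h hw')

theorem reflPoly_dunklLap (h : ReflStable a k) {M : Type*} [Fintype M] {w : M → Fin N → ℝ}
    (hw : ∀ u, ∑ j, (w j ⬝ᵥ u) • w j = u) (i : ι) (f : MvPolynomial (Fin N) ℝ) :
    reflPoly (a i) (dunklLap a k w f) = dunklLap a k w (reflPoly (a i) f) := by
  have hw' : ∀ u, ∑ j, (vecRefl (a i) (w j) ⬝ᵥ u) • vecRefl (a i) (w j) = u := by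
    intro u
    have hs : ∀ g : M → Fin N → ℝ, vecRefl (a i) (∑ j, g j) = ∑ j, vecRefl (a i) (g j) := by
      intro g
      simp only [vecRefl, dotProduct_sum, Finset.sum_smul, Finset.sum_sub_distrib]
    conv_rhs => rw [← vecRefl_vecRefl (a i) u, ← hw (vecRefl (a i) u), hs]
    refine Finset.sum_congr rfl fun j _ => ?_
    rw [vecRefl_smul_right, vecRefl_dot]
  -- The reflected vectors form a frame again. It is used on the right only, where equivariance of
  -- the Dunkl operators produces it.
  rw [dunklLap_eq h hw hw']
  conv_lhs => rw [← dunklLap_eq h hw hw']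
  simp only [dunklLap_apply, map_sum, reflPoly_dunkl h]

end Family

/-! ### The Euler operator -/

/-- `∑ x_i ∂/∂x_i`. -/
def euler : Module.End ℝ (MvPolynomial (Fin N) ℝ) :=
  ∑ i, LinearMap.mulLeft ℝ (X i) ∘ₗ (pderiv i).toLinearMap

theorem euler_apply (f : MvPolynomial (Fin N) ℝ) : euler f = ∑ i, X i * pderiv i f := by
  simp [euler]

theorem euler_of_isHomogeneous {f : MvPolynomial (Fin N) ℝ} {d : ℕ} (h : f.IsHomogeneous d) :
    euler f = (d : ℝ) • f := by
  rw [euler_apply, h.sum_X_mul_pderiv, Nat.cast_smul_eq_nsmul]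

theorem euler_mul (f g : MvPolynomial (Fin N) ℝ) : euler (f * g) = euler f * g + f * euler g := by
  simp only [euler_apply, Derivation.leibniz, smul_eq_mul, mul_add, Finset.sum_add_distrib,
    Finset.sum_mul, Finset.mul_sum]
  rw [add_comm]
  congr 1 <;> exact Finset.sum_congr rfl fun i _ => by ring

theorem euler_linForm_mul (u : Fin N → ℝ) (f : MvPolynomial (Fin N) ℝ) :
    euler (linForm u * f) = linForm u * euler f + linForm u * f := by
  rw [euler_mul, euler_of_isHomogeneous (isHomogeneous_linForm u), Nat.cast_one, one_smul, add_comm]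

theorem euler_one : euler (1 : MvPolynomial (Fin N) ℝ) = 0 := by
  simp [euler_apply]

theorem euler_monomial (m : Fin N →₀ ℕ) (c : ℝ) :
    euler (monomial m c) = (m.degree : ℝ) • monomial m c :=
  euler_of_isHomogeneous (isHomogeneous_monomial c rfl)

theorem coeff_euler (m : Fin N →₀ ℕ) (f : MvPolynomial (Fin N) ℝ) :
    coeff m (euler f) = m.degree * coeff m f := by
  induction f using MvPolynomial.induction_on' with
  | monomial n c =>
    rw [euler_monomial, coeff_smul, coeff_monomial, smul_eq_mul]
    split_ifs with h
    · rw [h]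
    · simp
  | add f g hf hg => rw [map_add, coeff_add, coeff_add, hf, hg, mul_add]

theorem reflPoly_euler (a : Fin N → ℝ) (f : MvPolynomial (Fin N) ℝ) :
    reflPoly a (euler f) = euler (reflPoly a f) := by
  induction f using induction_linForm with
  | h1 => simp [euler_one]
  | hadd f g hf hg => simp only [map_add, hf, hg]
  | hsmul c f hf => simp only [map_smul, hf]
  | hmul u f hf => simp only [euler_linForm_mul, map_add, map_mul, hf, reflPoly_linForm]

theorem euler_divDiff (a : Fin N → ℝ) (f : MvPolynomial (Fin N) ℝ) :
    euler (divDiff a f) = divDiff a (euler f) - divDiff a f := by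
  by_cases ha : a = 0
  · simp [ha]
  · refine eq_sub_of_add_eq (divDiff_eq_of_mul ha ?_).symm
    have := congrArg euler (linForm_mul_divDiff a f)
    rw [euler_linForm_mul, map_sub, ← reflPoly_euler] at this
    rw [mul_add, this]

theorem euler_dirDeriv (ξ : Fin N → ℝ) (f : MvPolynomial (Fin N) ℝ) :
    euler (dirDeriv ξ f) = dirDeriv ξ (euler f) - dirDeriv ξ f := by
  induction f using induction_linForm with
  | h1 => simp [euler_one, dirDeriv_one]
  | hadd f g hf hg => simp only [map_add, hf, hg]; abel
  | hsmul c f hf => simp only [map_smul, hf, smul_sub]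
  | hmul u f hf =>
    simp only [euler_linForm_mul, map_add, dirDeriv_mul, hf, dirDeriv_linForm, ← smul_eq_C_mul,
      map_smul]
    ring

theorem euler_dunkl {ι : Type*} [Fintype ι] (a : ι → Fin N → ℝ) (k : ι → ℝ) (ξ : Fin N → ℝ)
    (f : MvPolynomial (Fin N) ℝ) :
    euler (dunkl a k ξ f) = dunkl a k ξ (euler f) - dunkl a k ξ f := by
  simp only [dunkl_apply, map_add, map_sum, map_smul, euler_dirDeriv, euler_divDiff, smul_sub,
    Finset.sum_sub_distrib]
  abel

/-- Comparing coefficients, every monomial that occurs has degree `c`; so `c` is a natural number.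
This is what quantises the energies. -/
theorem isHomogeneous_of_euler {f : MvPolynomial (Fin N) ℝ} {c : ℝ} (hf : f ≠ 0)
    (h : euler f = c • f) : ∃ d : ℕ, c = d ∧ f.IsHomogeneous d := by
  have key : ∀ m, coeff m f ≠ 0 → (m.degree : ℝ) = c := by
    intro m hm
    have := congrArg (coeff m) h
    rw [coeff_euler, coeff_smul, smul_eq_mul] at this
    exact mul_right_cancel₀ hm this
  obtain ⟨m, hm⟩ := ne_zero_iff.1 hf
  refine ⟨m.degree, (key m hm).symm, fun n hn => ?_⟩
  have : n.degree = m.degree := by exact_mod_cast (key n hn).trans (key m hm).symm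
  rw [← this, Finsupp.degree_eq_weight_one (R := ℕ)]
  rfl

/-! ### Exponentials of operators of degree `-2` -/

/-- The operator lowers the degree by two. -/
def LowersTwo (A : Module.End ℝ (MvPolynomial (Fin N) ℝ)) : Prop :=
  ∀ f, euler (A f) = A (euler f) - (2 : ℝ) • A f

namespace LowersTwo

variable {A B : Module.End ℝ (MvPolynomial (Fin N) ℝ)}

theorem smul (hA : LowersTwo A) (c : ℝ) : LowersTwo (c • A) := fun f => by
  simp only [LinearMap.smul_apply, map_smul, hA f]
  module

theorem sum {ι : Type*} (s : Finset ι) {A : ι → Module.End ℝ (MvPolynomial (Fin N) ℝ)}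
    (h : ∀ i ∈ s, LowersTwo (A i)) : LowersTwo (∑ i ∈ s, A i) := fun f => by
  simp only [LinearMap.sum_apply, map_sum, Finset.smul_sum, ← Finset.sum_sub_distrib]
  exact Finset.sum_congr rfl fun i hi => h i hi f

theorem sq_of_euler {T : Module.End ℝ (MvPolynomial (Fin N) ℝ)}
    (h : ∀ f, euler (T f) = T (euler f) - T f) : LowersTwo (T ^ 2) := fun f => by
  simp only [sq, Module.End.mul_apply, h, map_sub]
  module

theorem pow (hA : LowersTwo A) (n : ℕ) (f : MvPolynomial (Fin N) ℝ) :
    euler ((A ^ n) f) = (A ^ n) (euler f) - (2 * n : ℝ) • (A ^ n) f := by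
  induction n generalizing f with
  | zero => simp
  | succ n ih =>
    rw [pow_succ', Module.End.mul_apply, hA, ih, Module.End.mul_apply, map_sub, map_smul]
    push_cast
    module

/-- On a homogeneous component of degree `d`, a nonzero image would be an Euler eigenvector with
eigenvalue $d-2i-2j$, which has to be a natural number. One bound for both operators is needed for
the exponential of a sum. -/
theorem exists_pow_pow_eq_zero (hA : LowersTwo A) (hB : LowersTwo B)
    (f : MvPolynomial (Fin N) ℝ) : ∃ M, ∀ i j, M ≤ i + j → (A ^ i) ((B ^ j) f) = 0 := by
  refine ⟨f.totalDegree + 1, fun i j hij => ?_⟩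
  rw [← sum_homogeneousComponent f, map_sum, map_sum]
  refine Finset.sum_eq_zero fun d hd => ?_
  have hh := euler_of_isHomogeneous (homogeneousComponent_isHomogeneous d f)
  by_contra hne
  have h2 : euler ((A ^ i) ((B ^ j) (homogeneousComponent d f)))
      = (d - 2 * j - 2 * i : ℝ) • (A ^ i) ((B ^ j) (homogeneousComponent d f)) := by
    rw [hA.pow, hB.pow, hh, map_sub, map_smul, map_smul, map_smul]
    module
  obtain ⟨e, he, -⟩ := isHomogeneous_of_euler hne h2
  have h3 : d < f.totalDegree + 1 := Finset.mem_range.1 hd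
  have h4 : (d : ℤ) - 2 * j - 2 * i = e := by exact_mod_cast he
  omega

theorem exists_pow_eq_zero (hA : LowersTwo A) (f : MvPolynomial (Fin N) ℝ) :
    ∃ M, ∀ n, M ≤ n → (A ^ n) f = 0 := by
  obtain ⟨M, hM⟩ := hA.exists_pow_pow_eq_zero hA f
  exact ⟨M, fun n hn => by simpa using hM n 0 (by simpa using hn)⟩

end LowersTwo

theorem polyExp_eq_sum {T : Module.End ℝ (MvPolynomial (Fin N) ℝ)} {f : MvPolynomial (Fin N) ℝ}
    {M : ℕ} (h : ∀ n, M ≤ n → (T ^ n) f = 0) :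
    polyExp T f = ∑ n ∈ Finset.range M, (1 / (n.factorial : ℝ)) • (T ^ n) f := by
  refine finsum_eq_sum_of_support_subset _ fun n hn => ?_
  by_contra hc
  exact hn (by simp only [h n (by simpa using hc), smul_zero])

section

variable {A B : Module.End ℝ (MvPolynomial (Fin N) ℝ)}

theorem polyExp_comm (hA : LowersTwo A) {S : Module.End ℝ (MvPolynomial (Fin N) ℝ)}
    (hS : ∀ f, S (A f) = A (S f)) (f : MvPolynomial (Fin N) ℝ) :
    S (polyExp A f) = polyExp A (S f) := by
  obtain ⟨M, hM⟩ := hA.exists_pow_eq_zero f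
  have hp : ∀ n, (A ^ n) (S f) = S ((A ^ n) f) := by
    intro n
    induction n with
    | zero => rfl
    | succ n ih => rw [pow_succ', Module.End.mul_apply, ih, Module.End.mul_apply, hS]
  rw [polyExp_eq_sum hM, polyExp_eq_sum (M := M) fun n hn => by rw [hp, hM n hn, map_zero], map_sum]
  simp only [map_smul, hp]

theorem polyExp_smul (hA : LowersTwo A) (c : ℝ) (f : MvPolynomial (Fin N) ℝ) :
    polyExp A (c • f) = c • polyExp A f := by
  have := polyExp_comm (S := c • LinearMap.id) hA (fun f => by simp) f
  simpa using this.symm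

theorem polyExp_add_right (hA : LowersTwo A) (f g : MvPolynomial (Fin N) ℝ) :
    polyExp A (f + g) = polyExp A f + polyExp A g := by
  obtain ⟨M, hM⟩ := hA.exists_pow_eq_zero f
  obtain ⟨M', hM'⟩ := hA.exists_pow_eq_zero g
  rw [polyExp_eq_sum (M := max M M') fun n hn => hM n (le_of_max_le_left hn),
    polyExp_eq_sum (M := max M M') fun n hn => hM' n (le_of_max_le_right hn),
    polyExp_eq_sum (M := max M M') fun n hn => by
      rw [map_add, hM n (le_of_max_le_left hn), hM' n (le_of_max_le_right hn), add_zero],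
    ← Finset.sum_add_distrib]
  simp only [map_add, smul_add]

/-- `e^A` as a linear map. -/
def polyExpLin (hA : LowersTwo A) : Module.End ℝ (MvPolynomial (Fin N) ℝ) where
  toFun := polyExp A
  map_add' := polyExp_add_right hA
  map_smul' := polyExp_smul hA

/-- The binomial theorem for commuting operators, followed by the Cauchy product of two sums that
are finite on `f`. -/
theorem polyExp_add (hA : LowersTwo A) (hB : LowersTwo B) (hAB : Commute A B)
    (f : MvPolynomial (Fin N) ℝ) : polyExp (A + B) f = polyExp A (polyExp B f) := by
  obtain ⟨M, hM⟩ := hA.exists_pow_pow_eq_zero hB f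
  have hpow : ∀ n, (1 / (n.factorial : ℝ)) • ((A + B) ^ n) f
      = ∑ p ∈ Finset.HasAntidiagonal.antidiagonal n, (1 / (p.1.factorial : ℝ) * (1 / (p.2.factorial : ℝ))) •
        (A ^ p.1) ((B ^ p.2) f) := by
    intro n
    rw [hAB.add_pow', LinearMap.sum_apply, Finset.smul_sum]
    refine Finset.sum_congr rfl fun p hp => ?_
    rw [LinearMap.smul_apply, Module.End.mul_apply, ← Nat.cast_smul_eq_nsmul ℝ, smul_smul]
    congr 1
    have hp' := Finset.HasAntidiagonal.mem_antidiagonal.1 hp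
    have h1 := Nat.add_choose_mul_factorial_mul_factorial p.2 p.1
    rw [add_comm, hp'] at h1
    have h2 : (n.choose p.1 : ℝ) * p.2.factorial * p.1.factorial = n.factorial := by
      exact_mod_cast h1
    have := Nat.factorial_ne_zero n
    have := Nat.factorial_ne_zero p.1
    have := Nat.factorial_ne_zero p.2
    field_simp
    linarith
  -- For `i, j < M` the index `i + j` stays below `M + M`, so the square of pairs can be regrouped
  -- by `i + j`.
  rw [polyExp_eq_sum (T := A + B) (M := M + M) (f := f)]
  · rw [polyExp_eq_sum (T := B) (M := M) fun n hn => by simpa using hM 0 n (by simpa using hn)]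
    change _ = polyExpLin hA _
    rw [map_sum]
    have hexp : ∀ j, polyExpLin hA ((B ^ j) f)
        = ∑ i ∈ Finset.range M, (1 / (i.factorial : ℝ)) • (A ^ i) ((B ^ j) f) := fun j =>
      polyExp_eq_sum fun n hn => hM n j (by omega)
    simp only [map_smul, hexp, Finset.smul_sum, smul_smul]
    rw [Finset.sum_comm, ← Finset.sum_product',
      ← Finset.sum_fiberwise_of_maps_to (s := Finset.range M ×ˢ Finset.range M)
        (t := Finset.range (M + M)) (g := fun p : ℕ × ℕ => p.1 + p.2)]
    · refine Finset.sum_congr rfl fun n _ => ?_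
      rw [hpow]
      symm
      -- A pair on the antidiagonal but outside the square has `i + j ≥ M`, and its term vanishes.
      refine Finset.sum_subset_zero_on_sdiff ?_ ?_ ?_
      · intro p hp
        simp only [Finset.mem_filter] at hp
        exact Finset.HasAntidiagonal.mem_antidiagonal.2 hp.2
      · intro p hp
        simp only [Finset.mem_sdiff, Finset.HasAntidiagonal.mem_antidiagonal, Finset.mem_filter,
          Finset.mem_product, Finset.mem_range, not_and] at hp
        rw [hM p.1 p.2 (by by_contra hc; exact hp.2 ⟨by omega, by omega⟩ hp.1), smul_zero]
      · intro p _
        rw [mul_comm]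
    · intro p hp
      simp only [Finset.mem_product, Finset.mem_range] at hp ⊢
      omega
  · intro n hn
    have h0 : (1 / (n.factorial : ℝ)) • ((A + B) ^ n) f = 0 := by
      rw [hpow]
      refine Finset.sum_eq_zero fun p hp => ?_
      have := Finset.HasAntidiagonal.mem_antidiagonal.1 hp
      rw [hM p.1 p.2 (by omega), smul_zero]
    exact (smul_eq_zero.1 h0).resolve_left (by positivity)

theorem polyExp_zero (f : MvPolynomial (Fin N) ℝ) : polyExp 0 f = f := by
  rw [polyExp_eq_sum (M := 1) fun n hn => by
    rw [zero_pow (by omega), LinearMap.zero_apply]]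
  simp

theorem polyExp_neg_polyExp (hA : LowersTwo A) (f : MvPolynomial (Fin N) ℝ) :
    polyExp (-A) (polyExp A f) = f := by
  have hA' : LowersTwo (-A) := by
    rw [show -A = (-1 : ℝ) • A by module]
    exact hA.smul (-1)
  rw [← polyExp_add hA' hA (Commute.neg_left (Commute.refl A)), neg_add_cancel, polyExp_zero]

/-- Commuting Euler past $A^n$ contributes $-2n$, which turns $A^n/n!$ into $-2A\cdot
A^{n-1}/(n-1)!$. -/
theorem euler_polyExp (hA : LowersTwo A) (f : MvPolynomial (Fin N) ℝ) :
    euler (polyExp A f) = polyExp A (euler f - (2 : ℝ) • A f) := by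
  obtain ⟨M₁, hM₁⟩ := hA.exists_pow_eq_zero f
  obtain ⟨M₂, hM₂⟩ := hA.exists_pow_eq_zero (euler f)
  obtain ⟨M, h1, h2⟩ : ∃ M, M₁ ≤ M ∧ M₂ ≤ M := ⟨max M₁ M₂, le_max_left _ _, le_max_right _ _⟩
  change euler (polyExp A f) = polyExpLin hA (euler f - (2 : ℝ) • A f)
  rw [map_sub, map_smul]
  change _ = polyExp A (euler f) - (2 : ℝ) • polyExp A (A f)
  rw [polyExp_eq_sum (f := f) (M := M + 1) fun n hn => hM₁ n (by omega),
    polyExp_eq_sum (f := euler f) (M := M + 1) fun n hn => hM₂ n (by omega),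
    polyExp_eq_sum (f := A f) (M := M) fun n hn => by
      rw [← Module.End.mul_apply, ← pow_succ, hM₁ (n + 1) (by omega)]]
  simp only [map_sum, map_smul, hA.pow, smul_sub, Finset.sum_sub_distrib]
  congr 1
  -- The term `n = 0` carries the factor `2 * 0`; dropping it shifts the index by one.
  rw [Finset.sum_range_succ', Finset.smul_sum]
  simp only [Nat.cast_zero, mul_zero, zero_smul, smul_zero, add_zero]
  refine Finset.sum_congr rfl fun n _ => ?_
  rw [pow_succ, Module.End.mul_apply, smul_smul, smul_smul, Nat.factorial_succ]
  congr 1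
  have := Nat.factorial_ne_zero n
  push_cast
  field_simp

end

theorem lowersTwo_dunklLap {ι : Type*} [Fintype ι] (a : ι → Fin N → ℝ) (k : ι → ℝ)
    {M : Type*} [Fintype M] (w : M → Fin N → ℝ) : LowersTwo (dunklLap a k w) :=
  LowersTwo.sum _ fun j _ => LowersTwo.sq_of_euler (euler_dunkl a k (w j))

/-! ### The roots `e_i - e_j` -/

theorem rootA_self (i : Fin N) : rootA i i = 0 := sub_self _

theorem rootA_swap (i j : Fin N) : rootA j i = -rootA i j := (neg_sub _ _).symm

theorem rootA_dot (i j : Fin N) (u : Fin N → ℝ) : rootA i j ⬝ᵥ u = u i - u j := by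
  simp [rootA, sub_dotProduct]

theorem coroot_rootA (i j : Fin N) : coroot (rootA i j) = rootA i j := by
  by_cases h : i = j
  · rw [h, rootA_self, coroot_zero]
  · have : rootA i j ⬝ᵥ rootA i j = 2 := by
      rw [rootA_dot]
      simp [rootA, h, Ne.symm h]
      norm_num
    rw [coroot_eq, this]
    simp

theorem single_comp_swap (i j l : Fin N) :
    (Pi.single l 1 : Fin N → ℝ) ∘ Equiv.swap i j = Pi.single (Equiv.swap i j l) 1 := by
  ext m
  simp only [Function.comp, Pi.single_apply]
  congr 1
  rw [eq_iff_iff]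
  exact ⟨fun h => by rw [← h, Equiv.swap_apply_self], fun h => by rw [h, Equiv.swap_apply_self]⟩

theorem vecRefl_rootA (i j : Fin N) (u : Fin N → ℝ) :
    vecRefl (rootA i j) u = u ∘ Equiv.swap i j := by
  rw [vecRefl, coroot_rootA, rootA_dot]
  ext l
  simp only [rootA, Pi.sub_apply, Pi.smul_apply, smul_eq_mul, Function.comp, Pi.single_apply,
    Equiv.swap_apply_def]
  split_ifs <;> simp_all

theorem reflPoly_rootA (i j : Fin N) : reflPoly (rootA i j) = rename (Equiv.swap i j) := by
  refine MvPolynomial.algHom_ext fun l => ?_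
  rw [← linForm_single, reflPoly_linForm, vecRefl_rootA, single_comp_swap, linForm_single,
    linForm_single, rename_X]

/-- The family of all roots `e_i - e_j`. -/
def rootsA (p : Fin N × Fin N) : Fin N → ℝ := rootA p.1 p.2

theorem rootA_comp_swap (i j p q : Fin N) :
    rootA p q ∘ Equiv.swap i j = rootA (Equiv.swap i j p) (Equiv.swap i j q) := by
  rw [rootA, rootA, ← single_comp_swap, ← single_comp_swap]
  rfl

theorem reflStable_rootsA (c : ℝ) : ReflStable (rootsA (N := N)) fun _ => c := by
  rintro ⟨i, j⟩
  refine ⟨(Equiv.swap i j).prodCongr (Equiv.swap i j), fun p => ⟨rfl, Or.inl ?_⟩⟩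
  rw [rootsA, rootsA, rootsA, vecRefl_rootA, rootA_comp_swap]
  rfl

theorem divDiff_rootA_swap (i j : Fin N) (f : MvPolynomial (Fin N) ℝ) :
    divDiff (rootA j i) f = -divDiff (rootA i j) f := by
  rw [rootA_swap, divDiff_neg_root]

theorem dirDeriv_single (i : Fin N) (f : MvPolynomial (Fin N) ℝ) :
    dirDeriv (Pi.single i 1) f = pderiv i f := by
  rw [dirDeriv_apply, Finset.sum_eq_single i]
  · simp
  · intro j _ hj; simp [hj]
  · simp

theorem dunklA_apply (κ : ℝ) (i : Fin N) (f : MvPolynomial (Fin N) ℝ) :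
    dunklA κ i f = pderiv i f + κ • ∑ j, divDiff (rootA i j) f := by
  simp only [dunklA, LinearMap.add_apply, LinearMap.smul_apply, LinearMap.sum_apply]
  congr 2
  rw [← Finset.add_sum_erase _ _ (Finset.mem_univ i), rootA_self, divDiff_zero_root, zero_add]

/-- Each root occurs as `(i, j)` and as `(j, i)`, with equal contributions. This is why the
multiplicity of an ordered pair is `κ / 2`. -/
theorem sum_rootA_single (κ : ℝ) (i : Fin N) (f : MvPolynomial (Fin N) ℝ) :
    ∑ p : Fin N × Fin N, (κ / 2 * (rootA p.1 p.2 ⬝ᵥ Pi.single i 1)) • divDiff (rootA p.1 p.2) f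
      = κ • ∑ j, divDiff (rootA i j) f := by
  have h1 : ∑ p : Fin N × Fin N, (κ / 2 * (Pi.single i (1 : ℝ) : Fin N → ℝ) p.1) •
      divDiff (rootA p.1 p.2) f = (κ / 2) • ∑ j, divDiff (rootA i j) f := by
    rw [Fintype.sum_prod_type, Finset.sum_eq_single i]
    · simp [Finset.smul_sum]
    · intro j _ hj; simp [hj]
    · simp
  have h2 : ∑ p : Fin N × Fin N, (κ / 2 * (Pi.single i (1 : ℝ) : Fin N → ℝ) p.2) •
      divDiff (rootA p.1 p.2) f = -((κ / 2) • ∑ j, divDiff (rootA i j) f) := by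
    rw [Fintype.sum_prod_type_right, Finset.sum_eq_single i]
    · simp [Finset.smul_sum, divDiff_rootA_swap i]
    · intro j _ hj; simp [hj]
    · simp
  simp only [rootA_dot, mul_sub, sub_smul, Finset.sum_sub_distrib]
  rw [h1, h2]
  module

theorem dunklA_eq (κ : ℝ) (i : Fin N) :
    dunklA κ i = dunkl rootsA (fun _ => κ / 2) (Pi.single i 1) := by
  refine LinearMap.ext fun f => ?_
  rw [dunklA_apply, dunkl_apply, dirDeriv_single]
  exact congrArg _ (sum_rootA_single κ i f).symm

theorem sum_single_dot_smul (u : Fin N → ℝ) :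
    ∑ j, ((Pi.single j 1 : Fin N → ℝ) ⬝ᵥ u) • (Pi.single j 1 : Fin N → ℝ) = u := by
  ext l
  simp [Finset.sum_apply, Pi.single_apply]

/-! ### Sums of Dunkl operators over a basis -/

theorem sum_linForm_mul_dirDeriv {M : Type*} [Fintype M] {w : M → Fin N → ℝ}
    (hw : ∀ u, ∑ j, (w j ⬝ᵥ u) • w j = u) (f : MvPolynomial (Fin N) ℝ) :
    ∑ j, linForm (w j) * dirDeriv (w j) f = euler f := by
  have hL : ∀ u, ∑ j, linForm (w j) * C (w j ⬝ᵥ u) = linForm u := by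
    intro u
    conv_rhs => rw [← hw u]
    have hs : ∀ g : M → Fin N → ℝ, linForm (∑ j, g j) = ∑ j, linForm (g j) := fun g =>
      map_sum (AddMonoidHom.mk' linForm linForm_add) g _
    rw [hs]
    exact Finset.sum_congr rfl fun j _ => by rw [linForm_smul, mul_comm]
  induction f using induction_linForm with
  | h1 => simp [dirDeriv_one, euler_one]
  | hadd f g hf hg => simp only [map_add, mul_add, Finset.sum_add_distrib, hf, hg]
  | hsmul c f hf => rw [map_smul, ← hf, Finset.smul_sum]; simp only [map_smul, mul_smul_comm]
  | hmul u f hf =>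
    rw [euler_linForm_mul, ← hf]
    simp only [dirDeriv_mul, dirDeriv_linForm, mul_add, Finset.sum_add_distrib, ← mul_assoc,
      ← Finset.sum_mul, hL]
    rw [add_comm, Finset.mul_sum]
    congr 1
    exact Finset.sum_congr rfl fun j _ => by ring

/-- The frame disappears from all terms except the constant `∑ j, w j ⬝ᵥ w j`, which is the
dimension for an orthonormal basis. Only Euler, that constant and reflections remain. -/
theorem sum_dunkl_linForm_mul {ι : Type*} [Fintype ι] (a : ι → Fin N → ℝ) (k : ι → ℝ)
    {M : Type*} [Fintype M] {w : M → Fin N → ℝ} (hw : ∀ u, ∑ j, (w j ⬝ᵥ u) • w j = u)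
    (f : MvPolynomial (Fin N) ℝ) :
    ∑ j, dunkl a k (w j) (linForm (w j) * f) = euler f + (∑ j, w j ⬝ᵥ w j) • f
      + ∑ i, k i • (f - reflPoly (a i) f + (a i ⬝ᵥ coroot (a i)) • reflPoly (a i) f) := by
  have hL : ∀ u, ∑ j, (u ⬝ᵥ w j) • linForm (w j) = linForm u := by
    intro u
    conv_rhs => rw [← hw u]
    have hs : ∀ g : M → Fin N → ℝ, linForm (∑ j, g j) = ∑ j, linForm (g j) := fun g =>
      map_sum (AddMonoidHom.mk' linForm linForm_add) g _
    rw [hs]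
    exact Finset.sum_congr rfl fun j _ => by
      rw [linForm_smul, smul_eq_C_mul, dotProduct_comm]
  have hd : ∀ u z, ∑ j, (u ⬝ᵥ w j) * (z ⬝ᵥ w j) = u ⬝ᵥ z := by
    intro u z
    conv_rhs => rw [← hw z]
    rw [dotProduct_sum]
    exact Finset.sum_congr rfl fun j _ => by
      rw [dotProduct_smul, smul_eq_mul, dotProduct_comm z, mul_comm]
  have e1 : ∑ j, linForm (w j) * ∑ i, (k i * (a i ⬝ᵥ w j)) • divDiff (a i) f
      = ∑ i, k i • (f - reflPoly (a i) f) := by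
    simp only [Finset.mul_sum]
    rw [Finset.sum_comm]
    refine Finset.sum_congr rfl fun i _ => ?_
    rw [← linForm_mul_divDiff, ← hL, Finset.sum_mul, Finset.smul_sum]
    exact Finset.sum_congr rfl fun j _ => by
      rw [mul_smul_comm, mul_smul, smul_mul_assoc]
  have e2 : ∑ j, ∑ i, (k i * (a i ⬝ᵥ w j) * (coroot (a i) ⬝ᵥ w j)) • reflPoly (a i) f
      = ∑ i, k i • (a i ⬝ᵥ coroot (a i)) • reflPoly (a i) f := by
    rw [Finset.sum_comm]
    refine Finset.sum_congr rfl fun i _ => ?_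
    rw [← hd, Finset.sum_smul, Finset.smul_sum]
    exact Finset.sum_congr rfl fun j _ => by rw [smul_smul, mul_assoc]
  simp only [dunkl_linForm_mul, Finset.sum_add_distrib, smul_add]
  rw [e2, Finset.sum_smul]
  simp only [dunkl_apply, mul_add, Finset.sum_add_distrib]
  rw [e1, sum_linForm_mul_dirDeriv hw]
  abel

/-! ### The root system in four variables -/

/-- The roots `e_i - e_j` together with `v_0`. -/
def roots4 : Option (Fin 4 × Fin 4) → Fin 4 → ℝ
  | none => v 0
  | some p => rootA p.1 p.2

/-- The multiplicities: `κ` for each pair of roots `±(e_i - e_j)` and `κ'` for `v_0`. -/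
def mult4 (κ κ' : ℝ) : Option (Fin 4 × Fin 4) → ℝ
  | none => κ'
  | some _ => κ / 2

/-- The Dunkl operators in four variables. -/
abbrev dunkl4 (κ κ' : ℝ) (ξ : Fin 4 → ℝ) : Module.End ℝ (MvPolynomial (Fin 4) ℝ) :=
  dunkl roots4 (mult4 κ κ') ξ

theorem v_zero_apply (i : Fin 4) : v 0 i = 1 / 2 := by
  fin_cases i <;> rfl

theorem v_dot_v (i j : Fin 4) : v i ⬝ᵥ v j = if i = j then 1 else 0 := by
  fin_cases i <;> fin_cases j <;> simp [v, dotProduct, Fin.sum_univ_four] <;> norm_num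

theorem v_ne_zero (i : Fin 4) : v i ≠ 0 := by
  intro h
  have := v_dot_v i i
  simp [h] at this

theorem coroot_v (i : Fin 4) : coroot (v i) = (2 : ℝ) • v i := by
  rw [coroot_eq, v_dot_v]
  simp

theorem sum_v_dot_smul (u : Fin 4 → ℝ) : ∑ j, (v j ⬝ᵥ u) • v j = u := by
  ext l
  fin_cases l <;> simp [v, dotProduct, Fin.sum_univ_four] <;> ring

theorem vecRefl_v_self (i : Fin 4) : vecRefl (v i) (v i) = -v i := by
  rw [vecRefl, coroot_dot_self (v_ne_zero i)]
  module

theorem vecRefl_v_zero_rootA (i j : Fin 4) : vecRefl (v 0) (rootA i j) = rootA i j := by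
  rw [vecRefl, coroot_v, smul_dotProduct, dotProduct_comm, rootA_dot, v_zero_apply, v_zero_apply]
  simp

/-- `v 0` is orthogonal to every `e_i - e_j`: its reflection fixes those roots and negates `v 0`,
while transpositions permute them and fix `v 0`. -/
theorem reflStable_roots4 (κ κ' : ℝ) : ReflStable roots4 (mult4 κ κ') := by
  rintro (_ | ⟨i, j⟩)
  · refine ⟨Equiv.refl _, ?_⟩
    rintro (_ | ⟨p, q⟩)
    · refine ⟨rfl, Or.inr ?_⟩
      change v 0 = -vecRefl (v 0) (v 0)
      rw [vecRefl_v_self, neg_neg]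
    · exact ⟨rfl, Or.inl (vecRefl_v_zero_rootA p q).symm⟩
  · refine ⟨((Equiv.swap i j).prodCongr (Equiv.swap i j)).optionCongr, ?_⟩
    rintro (_ | ⟨p, q⟩)
    · refine ⟨rfl, Or.inl ?_⟩
      change v 0 = vecRefl (rootA i j) (v 0)
      rw [vecRefl_rootA]
      ext l
      simp [v_zero_apply]
    · refine ⟨rfl, Or.inl ?_⟩
      change rootA (Equiv.swap i j p) (Equiv.swap i j q) = vecRefl (rootA i j) (rootA p q)
      rw [vecRefl_rootA, rootA_comp_swap]

theorem dunkl4_apply (κ κ' : ℝ) (ξ : Fin 4 → ℝ) (f : MvPolynomial (Fin 4) ℝ) :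
    dunkl4 κ κ' ξ f = dirDeriv ξ f + (κ' * (v 0 ⬝ᵥ ξ)) • divDiff (v 0) f
      + ∑ p : Fin 4 × Fin 4, (κ / 2 * (rootA p.1 p.2 ⬝ᵥ ξ)) • divDiff (rootA p.1 p.2) f := by
  rw [dunkl4, dunkl_apply, Fintype.sum_option, add_assoc]
  rfl

theorem dunklPrime_eq (κ κ' : ℝ) (i : Fin 4) :
    dunklPrime κ κ' i = dunkl4 κ κ' (Pi.single i 1) := by
  refine LinearMap.ext fun f => ?_
  rw [dunkl4_apply, sum_rootA_single, dunklPrime, LinearMap.add_apply, dunklA_apply,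
    LinearMap.smul_apply, dirDeriv_single, dotProduct_single, v_zero_apply]
  module

theorem sum_pairs_four (κ : ℝ) (ξ : Fin 4 → ℝ) (f : MvPolynomial (Fin 4) ℝ) :
    ∑ p : Fin 4 × Fin 4, (κ / 2 * (rootA p.1 p.2 ⬝ᵥ ξ)) • divDiff (rootA p.1 p.2) f
      = κ • ((ξ 0 - ξ 1) • divDiff (rootA 0 1) f + (ξ 0 - ξ 2) • divDiff (rootA 0 2) f
        + (ξ 0 - ξ 3) • divDiff (rootA 0 3) f + (ξ 1 - ξ 2) • divDiff (rootA 1 2) f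
        + (ξ 1 - ξ 3) • divDiff (rootA 1 3) f + (ξ 2 - ξ 3) • divDiff (rootA 2 3) f) := by
  simp only [Fintype.sum_prod_type, Fin.sum_univ_four, rootA_dot, rootA_self, divDiff_zero_root,
    divDiff_rootA_swap 0 1, divDiff_rootA_swap 0 2, divDiff_rootA_swap 0 3,
    divDiff_rootA_swap 1 2, divDiff_rootA_swap 1 3, divDiff_rootA_swap 2 3]
  module

/-- `v 0` is orthogonal to the roots `e_i - e_j`, so `κ` drops out. It is a free parameter here, and
is later set to `0` or to the `κ` at hand. -/
theorem dunklZero_eq (κ κ' : ℝ) : dunklZero κ' = dunkl4 κ κ' (v 0) := by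
  refine LinearMap.ext fun f => ?_
  rw [dunkl4_apply, sum_pairs_four, v_dot_v]
  simp [v_zero_apply, dunklZero]

/-- This and the next five identities are the coincidence of the root systems $D_3$ (in
$y_1,y_2,y_3$) and $A_3$ (in $x$). -/
theorem rootSigma_zero_one : rootSigma 0 1 = rootA 1 2 := by
  ext l; fin_cases l <;> simp [rootSigma, rootA, v] <;> norm_num

theorem rootSigma_zero_two : rootSigma 0 2 = rootA 1 3 := by
  ext l; fin_cases l <;> simp [rootSigma, rootA, v] <;> norm_num

theorem rootSigma_one_two : rootSigma 1 2 = rootA 2 3 := by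
  ext l; fin_cases l <;> simp [rootSigma, rootA, v] <;> norm_num

theorem rootTau_zero_one : rootTau 0 1 = rootA 0 3 := by
  ext l; fin_cases l <;> simp [rootTau, rootA, v] <;> norm_num

theorem rootTau_zero_two : rootTau 0 2 = rootA 0 2 := by
  ext l; fin_cases l <;> simp [rootTau, rootA, v] <;> norm_num

theorem rootTau_one_two : rootTau 1 2 = rootA 0 1 := by
  ext l; fin_cases l <;> simp [rootTau, rootA, v] <;> norm_num

theorem rootSigma_swap (i j : Fin 3) : rootSigma j i = -rootSigma i j := (neg_sub _ _).symm

theorem rootTau_swap (i j : Fin 3) : rootTau j i = rootTau i j := add_comm _ _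

/-- The directions `v 1, v 2, v 3` are orthogonal to `v 0`, so the value of `κ'` is irrelevant. -/
theorem dunklB_eq (κ κ' : ℝ) (i : Fin 3) : dunklB κ i = dunkl4 κ κ' (v i.succ) := by
  refine LinearMap.ext fun f => ?_
  have h0 : v 0 ⬝ᵥ v i.succ = 0 := by rw [v_dot_v, if_neg (Fin.succ_ne_zero i).symm]
  rw [dunkl4_apply, sum_pairs_four, h0, dunklB]
  simp only [LinearMap.add_apply, LinearMap.smul_apply, LinearMap.sum_apply, mul_zero, zero_smul,
    add_zero]
  congr 2
  fin_cases i
  · have : Finset.univ.erase (0 : Fin 3) = {1, 2} := by decide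
    simp only [Fin.zero_eta, this]
    rw [Finset.sum_pair (by decide), rootSigma_zero_one, rootSigma_zero_two, rootTau_zero_one,
      rootTau_zero_two]
    simp [v]
    module
  · have : Finset.univ.erase (1 : Fin 3) = {0, 2} := by decide
    simp only [Fin.mk_one, this]
    rw [Finset.sum_pair (by decide), rootSigma_swap 0 1, rootTau_swap 0 1, rootSigma_zero_one,
      rootSigma_one_two, rootTau_zero_one, rootTau_one_two, divDiff_neg_root]
    simp [v]
    module
  · have : Finset.univ.erase (2 : Fin 3) = {0, 1} := by decide
    simp only [Fin.reduceFinMk, this]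
    rw [Finset.sum_pair (by decide), rootSigma_swap 0 2, rootSigma_swap 1 2, rootTau_swap 0 2,
      rootTau_swap 1 2, rootSigma_zero_two, rootSigma_one_two, rootTau_zero_two, rootTau_one_two,
      divDiff_neg_root, divDiff_neg_root]
    simp [v]
    module

theorem laplaceH_eq (κ κ' : ℝ) :
    laplaceH κ κ' = dunklLap roots4 (mult4 κ κ') fun i : Fin 4 => Pi.single i 1 := by
  simp only [laplaceH, dunklLap, dunklPrime_eq]

/-- The standard basis and the basis `v` define the same Laplacian. -/
theorem laplaceH_eq_add (κ κ' : ℝ) : laplaceH κ κ' = laplaceB κ + dunklZero κ' ^ 2 := by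
  rw [laplaceH_eq, dunklLap_eq (reflStable_roots4 κ κ') sum_single_dot_smul sum_v_dot_smul,
    dunklLap, Fin.sum_univ_succ, add_comm, dunklZero_eq κ, laplaceB]
  simp only [dunklB_eq κ κ']

theorem lowersTwo_laplaceH (κ κ' : ℝ) : LowersTwo (laplaceH κ κ') := by
  rw [laplaceH_eq]
  exact lowersTwo_dunklLap _ _ _

theorem lowersTwo_dunklZero_sq (κ' : ℝ) : LowersTwo (dunklZero κ' ^ 2) := by
  rw [dunklZero_eq 0]
  exact LowersTwo.sq_of_euler (euler_dunkl _ _ _)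

theorem lowersTwo_laplaceB (κ : ℝ) : LowersTwo (laplaceB κ) := by
  simp only [laplaceB, dunklB_eq κ 0]
  exact LowersTwo.sum _ fun j _ => LowersTwo.sq_of_euler (euler_dunkl _ _ _)

theorem commute_dunkl4 (κ κ' : ℝ) (ξ η : Fin 4 → ℝ) :
    Commute (dunkl4 κ κ' ξ) (dunkl4 κ κ' η) := by
  rw [commute_iff_eq]
  refine LinearMap.ext fun f => ?_
  rw [Module.End.mul_apply, Module.End.mul_apply]
  exact dunkl_comm (reflStable_roots4 κ κ') ξ η f

theorem commute_laplaceB_dunklZero_sq (κ κ' : ℝ) : Commute (laplaceB κ) (dunklZero κ' ^ 2) := by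
  have h : laplaceB κ = ∑ i : Fin 3, dunkl4 κ κ' (v i.succ) ^ 2 := by
    simp only [laplaceB, dunklB_eq κ κ']
  rw [dunklZero_eq κ, h]
  exact Commute.sum_left _ _ _ fun j _ => (commute_dunkl4 κ κ' _ _).pow_pow 2 2

theorem sum_pairs_refl (κ : ℝ) (f : MvPolynomial (Fin 4) ℝ) :
    ∑ p : Fin 4 × Fin 4, (κ / 2) • (f - reflPoly (rootA p.1 p.2) f
        + (rootA p.1 p.2 ⬝ᵥ coroot (rootA p.1 p.2)) • reflPoly (rootA p.1 p.2) f)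
      = (6 * κ) • f + κ • (reflPoly (rootA 0 1) f + reflPoly (rootA 0 2) f
        + reflPoly (rootA 0 3) f + reflPoly (rootA 1 2) f + reflPoly (rootA 1 3) f
        + reflPoly (rootA 2 3) f) := by
  have hz : reflPoly (0 : Fin 4 → ℝ) f = f := by
    have : reflPoly (0 : Fin 4 → ℝ) = AlgHom.id ℝ _ :=
      algHom_ext_linForm fun u => by simp [reflPoly_linForm]
    rw [this]; rfl
  have hs : ∀ i : Fin 4, f - reflPoly (rootA i i) f
      + (rootA i i ⬝ᵥ coroot (rootA i i)) • reflPoly (rootA i i) f = 0 := by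
    intro i
    rw [rootA_self, hz, coroot_zero, zero_dotProduct]
    module
  have hd : ∀ i j : Fin 4, i ≠ j → f - reflPoly (rootA i j) f
      + (rootA i j ⬝ᵥ coroot (rootA i j)) • reflPoly (rootA i j) f
      = f + reflPoly (rootA i j) f := by
    intro i j h
    have : rootA i j ⬝ᵥ coroot (rootA i j) = 2 := by
      rw [coroot_rootA, rootA_dot]
      simp [rootA, h, h.symm]
      norm_num
    rw [this]
    module
  have hr : ∀ i j : Fin 4, reflPoly (rootA i j) = reflPoly (rootA j i) := by
    intro i j
    rw [rootA_swap, reflPoly_neg]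
  simp only [Fintype.sum_prod_type, Fin.sum_univ_four, hs, hd 0 1 (by decide), hd 0 2 (by decide),
    hd 0 3 (by decide), hd 1 0 (by decide), hd 1 2 (by decide), hd 1 3 (by decide),
    hd 2 0 (by decide), hd 2 1 (by decide), hd 2 3 (by decide), hd 3 0 (by decide),
    hd 3 1 (by decide), hd 3 2 (by decide)]
  rw [hr 1 0, hr 2 0, hr 3 0, hr 2 1, hr 3 1, hr 3 2]
  module

theorem sum_sigma_tau (f : MvPolynomial (Fin 4) ℝ) :
    ∑ i : Fin 3, ∑ j ∈ Finset.Iio i, (reflPoly (rootSigma i j) f + reflPoly (rootTau i j) f)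
      = reflPoly (rootA 0 1) f + reflPoly (rootA 0 2) f + reflPoly (rootA 0 3) f
        + reflPoly (rootA 1 2) f + reflPoly (rootA 1 3) f + reflPoly (rootA 2 3) f := by
  have hI0 : Finset.Iio (0 : Fin 3) = ∅ := by decide
  have hI1 : Finset.Iio (1 : Fin 3) = {0} := by decide
  have hI2 : Finset.Iio (2 : Fin 3) = {0, 1} := by decide
  rw [Fin.sum_univ_three, hI0, hI1, hI2, Finset.sum_empty, Finset.sum_singleton,
    Finset.sum_pair (by decide), rootSigma_swap 0 1, rootSigma_swap 0 2, rootSigma_swap 1 2,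
    rootTau_swap 0 1, rootTau_swap 0 2, rootTau_swap 1 2]
  simp only [reflPoly_neg, rootSigma_zero_one, rootSigma_zero_two, rootSigma_one_two,
    rootTau_zero_one, rootTau_zero_two, rootTau_one_two]
  abel

/-- The sum of the operators $T_{v_j}y_j$ is $E+4+\kappa\sum(1+s)+\kappa'(1+\sigma_0)$ over the six
transpositions $s$. The subtracted terms remove exactly these reflections and the `2`, leaving a
scalar shift of Euler. -/
theorem gaugeOp_apply (κ κ' : ℝ) (f : MvPolynomial (Fin 4) ℝ) :
    gaugeOp κ κ' f = euler f + (2 + 6 * κ + κ') • f := by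
  have h1 : ∑ i : Fin 3, dunklB κ i (y i.succ * f) + dunklZero κ' (y 0 * f)
      = ∑ j : Fin 4, dunkl4 κ κ' (v j) (linForm (v j) * f) := by
    conv_rhs => rw [Fin.sum_univ_succ]
    rw [add_comm, dunklZero_eq κ]
    simp only [dunklB_eq κ κ', y]
  have h2 : ∑ j, v j ⬝ᵥ v j = 4 := by simp [v_dot_v]
  have h3 : v 0 ⬝ᵥ coroot (v 0) = 2 := by rw [coroot_v, dotProduct_smul, v_dot_v]; simp
  have h4 : ∑ i, mult4 κ κ' i • (f - reflPoly (roots4 i) f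
      + (roots4 i ⬝ᵥ coroot (roots4 i)) • reflPoly (roots4 i) f)
      = κ' • (f + reflPoly (v 0) f) + ((6 * κ) • f + κ • (reflPoly (rootA 0 1) f
        + reflPoly (rootA 0 2) f + reflPoly (rootA 0 3) f + reflPoly (rootA 1 2) f
        + reflPoly (rootA 1 3) f + reflPoly (rootA 2 3) f)) := by
    rw [Fintype.sum_option, ← sum_pairs_refl]
    refine congrArg₂ (· + ·) ?_ rfl
    change κ' • (f - reflPoly (v 0) f + (v 0 ⬝ᵥ coroot (v 0)) • reflPoly (v 0) f) = _
    rw [h3]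
    module
  have h5 : gaugeOp κ κ' f = (∑ i : Fin 3, dunklB κ i (y i.succ * f) + dunklZero κ' (y 0 * f))
      - κ • ∑ i : Fin 3, ∑ j ∈ Finset.Iio i,
        (reflPoly (rootSigma i j) f + reflPoly (rootTau i j) f)
      - κ' • reflPoly (v 0) f - (2 : ℝ) • f := by
    simp only [gaugeOp, cherednikB, LinearMap.sub_apply, LinearMap.add_apply, LinearMap.sum_apply,
      LinearMap.comp_apply, LinearMap.mulLeft_apply, LinearMap.smul_apply, LinearMap.id_apply,
      AlgHom.toLinearMap_apply, Finset.sum_sub_distrib, Finset.smul_sum]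
    abel
  rw [h5, h1, sum_dunkl_linForm_mul _ _ sum_v_dot_smul, h2, h4, sum_sigma_tau]
  module

/-- The operator `e^{-Δ_h/2} ∘ gaugeOp ∘ e^{Δ_h/2}`. -/
theorem polyExp_gaugeOp_polyExp (κ κ' : ℝ) (f : MvPolynomial (Fin 4) ℝ) :
    polyExp ((-1 / 2 : ℝ) • laplaceH κ κ')
        (gaugeOp κ κ' (polyExp ((1 / 2 : ℝ) • laplaceH κ κ') f))
      = euler f + (2 + 6 * κ + κ') • f - laplaceH κ κ' f := by
  have hL := (lowersTwo_laplaceH κ κ').smul (1 / 2)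
  rw [gaugeOp_apply, euler_polyExp hL, ← polyExp_smul hL, ← polyExp_add_right hL,
    show (-1 / 2 : ℝ) • laplaceH κ κ' = -((1 / 2 : ℝ) • laplaceH κ κ') by module,
    polyExp_neg_polyExp hL, LinearMap.smul_apply]
  module

/-! ### The Dunkl Laplacian at regular points -/

theorem eval_reflPoly (a x : Fin N → ℝ) (f : MvPolynomial (Fin N) ℝ) :
    eval x (reflPoly a f) = eval (vecRefl a x) f := by
  induction f using induction_linForm with
  | h1 => simp
  | hadd f g hf hg => simp only [map_add, hf, hg]
  | hsmul c f hf => simp only [map_smul, smul_eval, hf]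
  | hmul u f hf => simp only [map_mul, reflPoly_linForm, eval_linForm, vecRefl_dot, hf]

theorem eval_divDiff {a x : Fin N → ℝ} (h : a ⬝ᵥ x ≠ 0) (f : MvPolynomial (Fin N) ℝ) :
    eval x (divDiff a f) = (eval x f - eval x (reflPoly a f)) / (a ⬝ᵥ x) := by
  have := congrArg (eval x) (linForm_mul_divDiff a f)
  rw [map_mul, eval_linForm, map_sub] at this
  rw [← this, mul_div_cancel_left₀ _ h]

theorem pderiv_linForm (u : Fin N → ℝ) (i : Fin N) : pderiv i (linForm u) = C (u i) := by
  rw [← dirDeriv_single, dirDeriv_linForm]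
  simp

/-- Both sides have the same commutator with a linear form, so induction on `f` applies. Off the
hyperplanes of the nonzero roots the divided differences are honest quotients. -/
theorem eval_dunklLap {ι : Type*} [Fintype ι] {a : ι → Fin N → ℝ} {k : ι → ℝ}
    (h : ReflStable a k) {M : Type*} [Fintype M] {w : M → Fin N → ℝ}
    (hw : ∀ u, ∑ j, (w j ⬝ᵥ u) • w j = u) {x : Fin N → ℝ}
    (hx : ∀ i, a i ≠ 0 → a i ⬝ᵥ x ≠ 0) (f : MvPolynomial (Fin N) ℝ) :
    eval x (dunklLap a k w f) = ∑ i, eval x (pderiv i (pderiv i f))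
      + ∑ i, k i * (2 * eval x (dirDeriv (a i) f) / (a i ⬝ᵥ x)
        - (a i ⬝ᵥ a i) * (eval x f - eval x (reflPoly (a i) f)) / (a i ⬝ᵥ x) ^ 2) := by
  induction f using induction_linForm with
  | h1 => simp [dunklLap_one, dirDeriv_one]
  | hadd f g hf hg =>
    rw [map_add, map_add, hf, hg, add_add_add_comm, ← Finset.sum_add_distrib,
      ← Finset.sum_add_distrib]
    congr 1 <;> refine Finset.sum_congr rfl fun i _ => ?_
    · simp only [map_add]
    · simp only [map_add]
      ring
  | hsmul c f hf =>
    rw [map_smul, smul_eval, hf, mul_add, Finset.mul_sum, Finset.mul_sum]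
    congr 1 <;> refine Finset.sum_congr rfl fun i _ => ?_
    · simp only [Derivation.map_smul, smul_eval]
    · simp only [map_smul, smul_eval]
      ring
  | hmul u f hf =>
    rw [dunklLap_linForm_mul h hw, map_add, map_mul, hf, smul_eval, dunkl_apply, map_add, map_sum,
      eval_linForm]
    have e1 : ∑ i, eval x (pderiv i (pderiv i (linForm u * f)))
        = (u ⬝ᵥ x) * ∑ i, eval x (pderiv i (pderiv i f)) + 2 * eval x (dirDeriv u f) := by
      rw [dirDeriv_apply, map_sum, Finset.mul_sum, Finset.mul_sum, ← Finset.sum_add_distrib]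
      refine Finset.sum_congr rfl fun i _ => ?_
      simp only [Derivation.leibniz, pderiv_linForm, map_add, smul_eq_mul, map_mul, pderiv_C,
        eval_C, eval_linForm, smul_eval, map_zero]
      ring
    rw [e1, mul_add, mul_add, Finset.mul_sum, Finset.mul_sum]
    have e2 : ∀ i, k i * (2 * eval x (dirDeriv (a i) (linForm u * f)) / (a i ⬝ᵥ x)
          - (a i ⬝ᵥ a i) * (eval x (linForm u * f) - eval x (reflPoly (a i) (linForm u * f)))
            / (a i ⬝ᵥ x) ^ 2)
        = (u ⬝ᵥ x) * (k i * (2 * eval x (dirDeriv (a i) f) / (a i ⬝ᵥ x)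
          - (a i ⬝ᵥ a i) * (eval x f - eval x (reflPoly (a i) f)) / (a i ⬝ᵥ x) ^ 2))
          + 2 * eval x ((k i * (a i ⬝ᵥ u)) • divDiff (a i) f) := by
      intro i
      by_cases ha : a i = 0
      · simp [ha]
      · have hA := hx i ha
        have hq := dotProduct_self_ne_zero ha
        rw [dirDeriv_mul, dirDeriv_linForm, map_mul (reflPoly _), reflPoly_linForm, smul_eval,
          eval_divDiff hA]
        simp only [map_add, map_mul, eval_C, eval_linForm, vecRefl, sub_dotProduct,
          smul_dotProduct, smul_eq_mul, coroot_eq]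
        field_simp
        ring
    simp only [e2, Finset.sum_add_distrib, ← Finset.mul_sum]
    ring

/-! ### The regular set and the base state -/

local notation "E4" => EuclideanSpace ℝ (Fin 4)

theorem isOpen_regularSet : IsOpen regularSet := by
  have : regularSet = (⋂ i : Fin 4, ⋂ j : Fin 4, ⋂ _ : i ≠ j, {x : E4 | x i ≠ x j})
      ∩ {x : E4 | ∑ i, x i ≠ 0} := by
    ext x
    simp [regularSet]
  rw [this]
  refine IsOpen.inter (isOpen_iInter_of_finite fun i => isOpen_iInter_of_finite fun j =>
    isOpen_iInter_of_finite fun _ => isOpen_ne_fun (by fun_prop) (by fun_prop))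
    (isOpen_ne_fun (by fun_prop) (by fun_prop))

theorem evalAt_y_zero (x : E4) : evalAt (y 0) x = (∑ i, x i) / 2 := by
  rw [evalAt, y, eval_linForm, dotProduct]
  simp only [v_zero_apply]
  rw [← Finset.mul_sum]
  ring

/-- The logarithm of the base state on the regular set. -/
def logPsi (κ κ' : ℝ) (x : E4) : ℝ :=
  κ * (∑ i, ∑ j ∈ Finset.Ioi i, Real.log (x i - x j)) + κ' * Real.log ((∑ i, x i) / 2)
    + -(1 / 4) * ∑ i, x i ^ 2

/-- Since `Real.log t = Real.log |t|`, one formula without absolute values serves all chambers of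
the regular set. -/
theorem psiZero_eq_exp (κ κ' : ℝ) {x : E4} (hx : x ∈ regularSet) :
    psiZero κ κ' x = Real.exp (logPsi κ κ' x) := by
  have hr : ∀ (c : ℝ) {t : ℝ}, t ≠ 0 → |t| ^ c = Real.exp (c * Real.log t) := by
    intro c t ht
    rw [Real.rpow_def_of_pos (abs_pos.2 ht), Real.log_abs, mul_comm]
  rw [psiZero, logPsi, Real.exp_add, Real.exp_add, Finset.mul_sum, Real.exp_sum]
  have hs : ∑ i, x i ≠ 0 := hx.2
  congr 1
  · congr 1
    · refine Finset.prod_congr rfl fun i _ => ?_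
      rw [Finset.mul_sum, Real.exp_sum]
      refine Finset.prod_congr rfl fun j hj => ?_
      exact hr _ (sub_ne_zero.2 (hx.1 i j (Finset.mem_Ioi.1 hj).ne))
    · rw [evalAt_y_zero, hr _ (by positivity)]
  · rw [EuclideanSpace.norm_sq_eq]
    simp

theorem psiZero_pos (κ κ' : ℝ) {x : E4} (hx : x ∈ regularSet) : 0 < psiZero κ κ' x := by
  rw [psiZero_eq_exp κ κ' hx]
  exact Real.exp_pos _

theorem contDiff_evalAt (f : MvPolynomial (Fin 4) ℝ) : ContDiff ℝ 2 (evalAt f) := by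
  unfold evalAt
  induction f using MvPolynomial.induction_on with
  | C c => simpa using contDiff_const
  | add p q hp hq => simpa using hp.add hq
  | mul_X p i hp => simpa using hp.mul (by fun_prop)

theorem contDiffAt_psiZero (κ κ' : ℝ) {x : E4} (hx : x ∈ regularSet) :
    ContDiffAt ℝ 2 (psiZero κ κ') x := by
  have h : psiZero κ κ' =ᶠ[nhds x] fun z => Real.exp (logPsi κ κ' z) := by
    filter_upwards [isOpen_regularSet.mem_nhds hx] with z hz using psiZero_eq_exp κ κ' hz
  refine ContDiffAt.congr_of_eventuallyEq (ContDiffAt.exp ?_) h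
  unfold logPsi
  have hs : ∑ i, x i ≠ 0 := hx.2
  refine ContDiffAt.add (ContDiffAt.add (contDiffAt_const.mul ?_) (contDiffAt_const.mul ?_)) ?_
  · refine ContDiffAt.sum fun i _ => ContDiffAt.sum fun j hj => ContDiffAt.log (by fun_prop) ?_
    exact sub_ne_zero.2 (hx.1 i j (Finset.mem_Ioi.1 hj).ne)
  · exact ContDiffAt.log (by fun_prop) (by positivity)
  · fun_prop

theorem contDiffOn_evalAt_mul_psiZero (κ κ' : ℝ) (f : MvPolynomial (Fin 4) ℝ) :
    ContDiffOn ℝ 2 (fun x => evalAt f x * psiZero κ κ' x) regularSet := fun _ hx =>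
  ((contDiff_evalAt f).contDiffAt.mul (contDiffAt_psiZero κ κ' hx)).contDiffWithinAt

/-! ### Derivatives along the coordinate axes -/

local notation "bas" => fun i : Fin 4 => (EuclideanSpace.single i (1 : ℝ) : E4)

theorem hasLineDerivAt_mul {f g : E4 → ℝ} {f' g' : ℝ} {x u : E4}
    (hf : HasLineDerivAt ℝ f f' x u) (hg : HasLineDerivAt ℝ g g' x u) :
    HasLineDerivAt ℝ (fun z => f z * g z) (f' * g x + f x * g') x u := by
  have := HasDerivAt.fun_mul (c := fun t : ℝ => f (x + t • u)) (d := fun t : ℝ => g (x + t • u))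
    hf hg
  simpa [HasLineDerivAt] using this

theorem hasLineDerivAt_add {f g : E4 → ℝ} {f' g' : ℝ} {x u : E4}
    (hf : HasLineDerivAt ℝ f f' x u) (hg : HasLineDerivAt ℝ g g' x u) :
    HasLineDerivAt ℝ (fun z => f z + g z) (f' + g') x u := HasDerivAt.add hf hg

theorem hasLineDerivAt_coord (x : E4) (i p : Fin 4) :
    HasLineDerivAt ℝ (fun z : E4 => z p) (if p = i then 1 else 0) x (bas i) := by
  have : HasDerivAt (fun t : ℝ => x p + t * (if p = i then 1 else 0))
      (1 * (if p = i then (1 : ℝ) else 0)) 0 :=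
    ((hasDerivAt_id (0 : ℝ)).mul_const _).const_add _
  simpa [HasLineDerivAt, Pi.single_apply] using this

theorem hasLineDerivAt_evalAt (f : MvPolynomial (Fin 4) ℝ) (x : E4) (i : Fin 4) :
    HasLineDerivAt ℝ (evalAt f) (evalAt (pderiv i f) x) x (bas i) := by
  unfold evalAt
  induction f using MvPolynomial.induction_on with
  | C c => simpa [HasLineDerivAt] using hasDerivAt_const (0 : ℝ) c
  | add p q hp hq => simpa using hasLineDerivAt_add hp hq
  | mul_X p j hp =>
    have := hasLineDerivAt_mul hp (hasLineDerivAt_coord x i j)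
    simp only [map_mul, eval_X, Derivation.leibniz, smul_eq_mul, map_add, pderiv_X]
    convert this using 1
    rw [add_comm, mul_comm]
    congr 2
    by_cases h : j = i
    · subst h; simp
    · simp [h]

/-- The logarithmic derivative of the base state in the direction of the `i`-th axis. -/
def logDeriv (κ κ' : ℝ) (i : Fin 4) (x : E4) : ℝ :=
  κ * (∑ p, ∑ q ∈ Finset.Ioi p,
      ((if p = i then 1 else 0) - (if q = i then 1 else 0)) / (x p - x q))
    + κ' / (∑ p, x p) - x i / 2

/-- The derivative of `logDeriv`. -/
def logDeriv2 (κ κ' : ℝ) (i : Fin 4) (x : E4) : ℝ :=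
  -κ * (∑ p, ∑ q ∈ Finset.Ioi p,
      ((if p = i then 1 else 0) - (if q = i then 1 else 0)) ^ 2 / (x p - x q) ^ 2)
    - κ' / (∑ p, x p) ^ 2 - 1 / 2

theorem hasLineDerivAt_sum_coord (x : E4) (i : Fin 4) :
    HasLineDerivAt ℝ (fun z : E4 => ∑ p, z p) 1 x (bas i) := by
  have := HasDerivAt.fun_sum (u := Finset.univ) fun p _ => hasLineDerivAt_coord x i p
  simpa [HasLineDerivAt] using this

theorem hasLineDerivAt_sub_coord (x : E4) (i p q : Fin 4) :
    HasLineDerivAt ℝ (fun z : E4 => z p - z q)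
      ((if p = i then 1 else 0) - (if q = i then 1 else 0)) x (bas i) :=
  HasDerivAt.sub (hasLineDerivAt_coord x i p) (hasLineDerivAt_coord x i q)

theorem hasLineDerivAt_logPsi (κ κ' : ℝ) {x : E4} (hx : x ∈ regularSet) (i : Fin 4) :
    HasLineDerivAt ℝ (logPsi κ κ') (logDeriv κ κ' i x) x (bas i) := by
  have hs : ∑ p, x p ≠ 0 := hx.2
  have h1 : HasLineDerivAt ℝ (fun z : E4 => ∑ p, ∑ q ∈ Finset.Ioi p, Real.log (z p - z q))
      (∑ p, ∑ q ∈ Finset.Ioi p,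
        ((if p = i then 1 else 0) - (if q = i then 1 else 0)) / (x p - x q)) x (bas i) := by
    refine HasDerivAt.fun_sum fun p _ => HasDerivAt.fun_sum fun q hq => ?_
    have hpq : x p - x q ≠ 0 := sub_ne_zero.2 (hx.1 p q (Finset.mem_Ioi.1 hq).ne)
    have := HasDerivAt.log (hasLineDerivAt_sub_coord x i p q) (by simpa using hpq)
    simpa using this
  have h2 : HasLineDerivAt ℝ (fun z : E4 => Real.log ((∑ p, z p) / 2)) (1 / ∑ p, x p) x
      (bas i) := by
    have := HasDerivAt.log ((hasLineDerivAt_sum_coord x i).div_const 2) (by simpa using hs)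
    refine HasDerivAt.congr_deriv this ?_
    simp only [zero_smul, add_zero]
    field_simp
  have h3 : HasLineDerivAt ℝ (fun z : E4 => ∑ p, z p ^ 2) (2 * x i) x (bas i) := by
    have := HasDerivAt.fun_sum (u := Finset.univ) fun p _ =>
      HasDerivAt.pow (hasLineDerivAt_coord x i p) 2
    simpa [HasLineDerivAt] using this
  have := ((h1.const_mul κ).add (h2.const_mul κ')).add (h3.const_mul (-(1 / 4)))
  refine HasDerivAt.congr_deriv this ?_
  rw [logDeriv]
  ring

theorem hasLineDerivAt_logDeriv (κ κ' : ℝ) {x : E4} (hx : x ∈ regularSet) (i : Fin 4) :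
    HasLineDerivAt ℝ (logDeriv κ κ' i) (logDeriv2 κ κ' i x) x (bas i) := by
  have hs : ∑ p, x p ≠ 0 := hx.2
  have h1 : HasLineDerivAt ℝ (fun z : E4 => ∑ p, ∑ q ∈ Finset.Ioi p,
        (((if p = i then 1 else 0) - (if q = i then 1 else 0) : ℝ)) / (z p - z q))
      (∑ p, ∑ q ∈ Finset.Ioi p,
        -(((if p = i then 1 else 0) - (if q = i then 1 else 0)) ^ 2 / (x p - x q) ^ 2)) x
      (bas i) := by
    refine HasDerivAt.fun_sum fun p _ => HasDerivAt.fun_sum fun q hq => ?_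
    have hpq : x p - x q ≠ 0 := sub_ne_zero.2 (hx.1 p q (Finset.mem_Ioi.1 hq).ne)
    have := (hasDerivAt_const (0 : ℝ)
      (((if p = i then 1 else 0) - (if q = i then 1 else 0) : ℝ))).div
      (hasLineDerivAt_sub_coord x i p q) (by simpa using hpq)
    refine HasDerivAt.congr_deriv this ?_
    simp only [zero_smul, add_zero]
    ring
  have h2 : HasLineDerivAt ℝ (fun z : E4 => κ' / (∑ p, z p)) (-(κ' / (∑ p, x p) ^ 2)) x
      (bas i) := by
    have := (hasDerivAt_const (0 : ℝ) κ').div (hasLineDerivAt_sum_coord x i) (by simpa using hs)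
    refine HasDerivAt.congr_deriv this ?_
    simp only [zero_smul, add_zero]
    ring
  have h3 : HasLineDerivAt ℝ (fun z : E4 => z i / 2) (1 / 2) x (bas i) := by
    have := (hasLineDerivAt_coord x i i).div_const 2
    simpa [HasLineDerivAt] using this
  have := ((h1.const_mul κ).add h2).sub h3
  refine HasDerivAt.congr_deriv this ?_
  simp only [logDeriv2, Finset.sum_neg_distrib]
  ring

theorem hasLineDerivAt_psiZero (κ κ' : ℝ) {x : E4} (hx : x ∈ regularSet) (i : Fin 4) :
    HasLineDerivAt ℝ (psiZero κ κ') (psiZero κ κ' x * logDeriv κ κ' i x) x (bas i) := by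
  have h : psiZero κ κ' =ᶠ[nhds x] fun z => Real.exp (logPsi κ κ' z) := by
    filter_upwards [isOpen_regularSet.mem_nhds hx] with z hz using psiZero_eq_exp κ κ' hz
  refine HasLineDerivAt.congr_of_eventuallyEq ?_ h
  have := HasDerivAt.exp (hasLineDerivAt_logPsi κ κ' hx i)
  rw [psiZero_eq_exp κ κ' hx]
  simpa [HasLineDerivAt] using this

theorem hasLineDerivAt_psiZero_mul (κ κ' : ℝ) {g : E4 → ℝ} {g' : ℝ} {x : E4}
    (hx : x ∈ regularSet) (i : Fin 4) (hg : HasLineDerivAt ℝ g g' x (bas i)) :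
    HasLineDerivAt ℝ (fun z => psiZero κ κ' z * g z)
      (psiZero κ κ' x * (logDeriv κ κ' i x * g x + g')) x (bas i) := by
  refine HasDerivAt.congr_deriv (hasLineDerivAt_mul (hasLineDerivAt_psiZero κ κ' hx i) hg) ?_
  ring

/-- For a $C^2$ function the second derivative along `u` can be computed with one-variable calculus,
provided that the first line derivative is known near `x` and not only at `x`. -/
theorem iteratedFDeriv_two_of_hasLineDerivAt {G G₁ : E4 → ℝ} {c : ℝ} {x u : E4}
    (hG : ContDiffAt ℝ 2 G x) (h1 : ∀ᶠ z in nhds x, HasLineDerivAt ℝ G (G₁ z) z u)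
    (h2 : HasLineDerivAt ℝ G₁ c x u) : iteratedFDeriv ℝ 2 G x ![u, u] = c := by
  rw [iteratedFDeriv_two_apply]
  have hd : ∀ᶠ z in nhds x, DifferentiableAt ℝ G z := by
    filter_upwards [hG.eventually (by simp)] with z hz using hz.differentiableAt (by simp)
  have heq : (fun z => fderiv ℝ G z u) =ᶠ[nhds x] G₁ := by
    filter_upwards [h1, hd] with z hz hz'
    exact (hz'.hasFDerivAt.hasLineDerivAt u).unique hz
  have hfd : DifferentiableAt ℝ (fderiv ℝ G) x :=
    (hG.fderiv_right (m := 1) (by norm_num)).differentiableAt (by simp)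
  have h3 : HasFDerivAt (fun z => fderiv ℝ G z u) ((fderiv ℝ (fderiv ℝ G) x).flip u) x := by
    have := hfd.hasFDerivAt.clm_apply (hasFDerivAt_const u x)
    rwa [ContinuousLinearMap.comp_zero, zero_add] at this
  have h4 := (h3.hasLineDerivAt u).congr_of_eventuallyEq heq.symm
  simpa using h4.unique h2

theorem laplacian_psiZero_mul (κ κ' : ℝ) (f : MvPolynomial (Fin 4) ℝ) {x : E4}
    (hx : x ∈ regularSet) :
    (Δ fun z => psiZero κ κ' z * evalAt f z) x = psiZero κ κ' x * ∑ i,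
      (evalAt (pderiv i (pderiv i f)) x + 2 * logDeriv κ κ' i x * evalAt (pderiv i f) x
        + (logDeriv κ κ' i x ^ 2 + logDeriv2 κ κ' i x) * evalAt f x) := by
  rw [InnerProductSpace.laplacian_eq_iteratedFDeriv_orthonormalBasis _
    (EuclideanSpace.basisFun (Fin 4) ℝ), Finset.mul_sum]
  refine Finset.sum_congr rfl fun i _ => ?_
  rw [EuclideanSpace.basisFun_apply]
  have hG := (contDiffAt_psiZero κ κ' hx).mul (contDiff_evalAt f).contDiffAt
  have h1 : ∀ᶠ z in nhds x, HasLineDerivAt ℝ (fun z => psiZero κ κ' z * evalAt f z)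
      (psiZero κ κ' z * (logDeriv κ κ' i z * evalAt f z + evalAt (pderiv i f) z)) z (bas i) := by
    filter_upwards [isOpen_regularSet.mem_nhds hx] with z hz
    exact hasLineDerivAt_psiZero_mul κ κ' hz i (hasLineDerivAt_evalAt f z i)
  have h2 := hasLineDerivAt_psiZero_mul κ κ' hx i (hasLineDerivAt_add
    (hasLineDerivAt_mul (hasLineDerivAt_logDeriv κ κ' hx i) (hasLineDerivAt_evalAt f x i))
    (hasLineDerivAt_evalAt (pderiv i f) x i))
  rw [iteratedFDeriv_two_of_hasLineDerivAt hG h1 h2]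
  ring


/-! ### Symmetries of the base state -/

theorem evalAt_permAct (f : MvPolynomial (Fin 4) ℝ) (x : E4) (w : Equiv.Perm (Fin 4)) :
    evalAt f (permAct x w) = evalAt (rename w f) x := by
  rw [evalAt, evalAt, eval_rename]
  rfl

theorem sigmaZero_eq (x : E4) : sigmaZero x = WithLp.toLp 2 (vecRefl (v 0) fun i => x i) := by
  ext i
  simp only [sigmaZero, vecRefl, coroot_v, PiLp.sub_apply, PiLp.smul_apply, Pi.sub_apply,
    Pi.smul_apply, dotProduct, v_zero_apply, smul_eq_mul, ← Finset.mul_sum]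
  ring

theorem evalAt_sigmaZero (f : MvPolynomial (Fin 4) ℝ) (x : E4) :
    evalAt f (sigmaZero x) = evalAt (reflPoly (v 0) f) x := by
  rw [evalAt, evalAt, eval_reflPoly, sigmaZero_eq]

theorem norm_permAct (x : E4) (w : Equiv.Perm (Fin 4)) : ‖permAct x w‖ = ‖x‖ := by
  rw [EuclideanSpace.norm_eq, EuclideanSpace.norm_eq]
  congr 1
  exact Equiv.sum_comp w fun i => ‖x i‖ ^ 2

theorem norm_sigmaZero (x : E4) : ‖sigmaZero x‖ = ‖x‖ := by
  have h : ∀ u : Fin 4 → ℝ, ‖(WithLp.toLp 2 u : E4)‖ = √(u ⬝ᵥ u) := by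
    intro u
    rw [EuclideanSpace.norm_eq]
    simp [dotProduct, sq]
  rw [sigmaZero_eq, h, vecRefl_dot_vecRefl, ← h]

theorem sum_sigmaZero (x : E4) : ∑ i, sigmaZero x i = -∑ i, x i := by
  simp only [sigmaZero, PiLp.sub_apply, PiLp.smul_apply, v_zero_apply, smul_eq_mul,
    Finset.sum_sub_distrib]
  simp
  ring

theorem sigmaZero_sub (x : E4) (i j : Fin 4) : sigmaZero x i - sigmaZero x j = x i - x j := by
  simp only [sigmaZero, PiLp.sub_apply, PiLp.smul_apply, v_zero_apply]
  ring

/-- Written as a Vandermonde determinant, the product visibly changes only by a sign inside the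
absolute value when the coordinates are permuted. -/
theorem prod_abs_sub_rpow (κ : ℝ) (x : Fin 4 → ℝ) :
    ∏ i, ∏ j ∈ Finset.Ioi i, |x i - x j| ^ κ = |(Matrix.vandermonde x).det| ^ κ := by
  rw [Matrix.det_vandermonde, Finset.abs_prod,
    ← Real.finsetProd_rpow _ _ fun i _ => abs_nonneg _]
  refine Finset.prod_congr rfl fun i _ => ?_
  rw [Finset.abs_prod, ← Real.finsetProd_rpow _ _ fun i _ => abs_nonneg _]
  exact Finset.prod_congr rfl fun j _ => by rw [abs_sub_comm]

theorem psiZero_permAct (κ κ' : ℝ) (x : E4) (w : Equiv.Perm (Fin 4)) :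
    psiZero κ κ' (permAct x w) = psiZero κ κ' x := by
  have h1 : ∏ i, ∏ j ∈ Finset.Ioi i, |permAct x w i - permAct x w j| ^ κ
      = ∏ i, ∏ j ∈ Finset.Ioi i, |x i - x j| ^ κ := by
    rw [prod_abs_sub_rpow, prod_abs_sub_rpow]
    have : Matrix.vandermonde (fun i => permAct x w i)
        = (Matrix.vandermonde fun i => x i).submatrix w id := by
      ext i j
      simp [Matrix.vandermonde, permAct]
    change |(Matrix.vandermonde (fun i => permAct x w i)).det| ^ κ = _
    rw [this, Matrix.det_permute, abs_mul]
    rcases Int.units_eq_one_or (Equiv.Perm.sign w) with h | h <;> simp [h]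
  have h2 : evalAt (y 0) (permAct x w) = evalAt (y 0) x := by
    rw [evalAt_y_zero, evalAt_y_zero]
    congr 1
    exact Equiv.sum_comp w fun i => x i
  rw [psiZero, psiZero, h1, h2, norm_permAct]

theorem psiZero_sigmaZero (κ κ' : ℝ) (x : E4) :
    psiZero κ κ' (sigmaZero x) = psiZero κ κ' x := by
  rw [psiZero, psiZero, norm_sigmaZero, evalAt_y_zero, evalAt_y_zero, sum_sigmaZero, neg_div,
    abs_neg]
  simp only [sigmaZero_sub]

/-! ### The conjugated Hamiltonian -/

theorem sum_Ioi_four (g : Fin 4 → Fin 4 → ℝ) :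
    ∑ i, ∑ j ∈ Finset.Ioi i, g i j = g 0 1 + g 0 2 + g 0 3 + g 1 2 + g 1 3 + g 2 3 := by
  have h0 : Finset.Ioi (0 : Fin 4) = {1, 2, 3} := by decide
  have h1 : Finset.Ioi (1 : Fin 4) = {2, 3} := by decide
  have h2 : Finset.Ioi (2 : Fin 4) = {3} := by decide
  have h3 : Finset.Ioi (3 : Fin 4) = ∅ := by decide
  rw [Fin.sum_univ_four, h0, h1, h2, h3]
  simp
  ring

theorem eval_laplaceH (κ κ' : ℝ) (f : MvPolynomial (Fin 4) ℝ) {x : E4} (hx : x ∈ regularSet) :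
    evalAt (laplaceH κ κ' f) x = ∑ i, evalAt (pderiv i (pderiv i f)) x
      + 2 * κ * ∑ i, ∑ j ∈ Finset.Ioi i,
        ((evalAt (pderiv i f) x - evalAt (pderiv j f) x) / (x i - x j)
          - (evalAt f x - evalAt (rename (Equiv.swap i j) f) x) / (x i - x j) ^ 2)
      + κ' * (2 * (∑ i, evalAt (pderiv i f) x) / (∑ i, x i)
        - 4 * (evalAt f x - evalAt (reflPoly (v 0) f) x) / (∑ i, x i) ^ 2) := by
  have hv0 : ∀ u : Fin 4 → ℝ, v 0 ⬝ᵥ u = (∑ i, u i) / 2 := by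
    intro u
    simp only [dotProduct, v_zero_apply, ← Finset.mul_sum]
    ring
  have hreg : ∀ i, roots4 i ≠ 0 → roots4 i ⬝ᵥ (fun i => x i) ≠ 0 := by
    rintro (_ | ⟨p, q⟩) h
    · change v 0 ⬝ᵥ _ ≠ 0
      rw [hv0]
      exact div_ne_zero hx.2 two_ne_zero
    · change rootA p q ⬝ᵥ _ ≠ 0
      rw [rootA_dot]
      refine sub_ne_zero.2 (hx.1 p q ?_)
      rintro rfl
      exact h (rootA_self p)
  have hd : ∀ p q, eval (fun i => x i) (dirDeriv (rootA p q) f)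
      = evalAt (pderiv p f) x - evalAt (pderiv q f) x := by
    intro p q
    have : dirDeriv (rootA p q) f = pderiv p f - pderiv q f := by
      rw [rootA, sub_eq_add_neg, ← neg_one_smul ℝ (Pi.single q 1), dirDeriv_add, dirDeriv_smul,
        LinearMap.add_apply, LinearMap.smul_apply, dirDeriv_single, dirDeriv_single]
      module
    rw [this, map_sub]
    rfl
  have hd0 : eval (fun i => x i) (dirDeriv (v 0) f) = (∑ i, evalAt (pderiv i f) x) / 2 := by
    rw [dirDeriv_apply, map_sum]
    simp only [smul_eval, v_zero_apply, ← Finset.mul_sum]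
    rw [one_div, inv_mul_eq_div]
    rfl
  have hq : ∀ p q : Fin 4, p ≠ q → rootA p q ⬝ᵥ rootA p q = 2 := by
    intro p q h
    rw [rootA_dot]
    simp [rootA, h, h.symm]
    norm_num
  set g : Fin 4 → Fin 4 → ℝ := fun p q =>
    (evalAt (pderiv p f) x - evalAt (pderiv q f) x) / (x p - x q)
      - (evalAt f x - evalAt (rename (Equiv.swap p q) f) x) / (x p - x q) ^ 2 with hg
  have hgs : ∀ p q, g p q = g q p := by
    intro p q
    simp only [hg]
    rw [Equiv.swap_comm, ← neg_sub (x q) (x p), neg_sq, ← neg_sub (evalAt (pderiv q f) x),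
      neg_div_neg_eq]
  have hpair : ∀ p q : Fin 4, κ / 2 * (2 * eval (fun i => x i) (dirDeriv (rootA p q) f)
      / (rootA p q ⬝ᵥ fun i => x i) - (rootA p q ⬝ᵥ rootA p q) * (eval (fun i => x i) f
        - eval (fun i => x i) (reflPoly (rootA p q) f)) / (rootA p q ⬝ᵥ fun i => x i) ^ 2)
      = if p = q then 0 else κ * g p q := by
    intro p q
    split_ifs with h
    · simp [h, rootA_self]
    · rw [hd, rootA_dot, hq p q h, reflPoly_rootA, hg]
      simp only [evalAt]
      ring
  rw [evalAt, laplaceH_eq, eval_dunklLap (reflStable_roots4 κ κ') sum_single_dot_smul hreg,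
    Fintype.sum_option]
  change _ + (κ' * (2 * eval (fun i => x i) (dirDeriv (v 0) f) / (v 0 ⬝ᵥ fun i => x i)
    - (v 0 ⬝ᵥ v 0) * (eval (fun i => x i) f - eval (fun i => x i) (reflPoly (v 0) f))
      / (v 0 ⬝ᵥ fun i => x i) ^ 2)
    + ∑ p : Fin 4 × Fin 4, κ / 2 * (2 * eval (fun i => x i) (dirDeriv (rootA p.1 p.2) f)
      / (rootA p.1 p.2 ⬝ᵥ fun i => x i) - (rootA p.1 p.2 ⬝ᵥ rootA p.1 p.2)
        * (eval (fun i => x i) f - eval (fun i => x i) (reflPoly (rootA p.1 p.2) f))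
          / (rootA p.1 p.2 ⬝ᵥ fun i => x i) ^ 2)) = _
  have hvv : v 0 ⬝ᵥ v 0 = 1 := by rw [v_dot_v, if_pos rfl]
  rw [hvv]
  simp only [hpair, hd0, hv0]
  rw [sum_Ioi_four, Fintype.sum_prod_type]
  have hs : ∑ i, x i ≠ 0 := hx.2
  -- By the symmetry `hgs`, each unordered pair is counted twice.
  have e1 : ∑ p : Fin 4, ∑ q : Fin 4, (if p = q then 0 else κ * g p q)
      = 2 * κ * (g 0 1 + g 0 2 + g 0 3 + g 1 2 + g 1 3 + g 2 3) := by
    simp only [Fin.sum_univ_four, Fin.reduceEq, if_true, if_false]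
    rw [hgs 1 0, hgs 2 0, hgs 3 0, hgs 2 1, hgs 3 1, hgs 3 2]
    ring
  rw [e1]
  change ∑ i, evalAt (pderiv i (pderiv i f)) x
      + (κ' * (2 * ((∑ i, evalAt (pderiv i f) x) / 2) / ((∑ i, x i) / 2)
          - 1 * (evalAt f x - evalAt (reflPoly (v 0) f) x) / ((∑ i, x i) / 2) ^ 2)
        + 2 * κ * (g 0 1 + g 0 2 + g 0 3 + g 1 2 + g 1 3 + g 2 3))
    = ∑ i, evalAt (pderiv i (pderiv i f)) x
      + 2 * κ * (g 0 1 + g 0 2 + g 0 3 + g 1 2 + g 1 3 + g 2 3)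
      + κ' * (2 * (∑ i, evalAt (pderiv i f) x) / (∑ i, x i)
        - 4 * (evalAt f x - evalAt (reflPoly (v 0) f) x) / (∑ i, x i) ^ 2)
  clear_value g
  field_simp
  ring

/-- The diagonal part of $|\nabla\log\psi_0|^2$ cancels the potentials with $\kappa^2$, $\kappa'^2$
and $|x|^2/4$, and the second derivatives of $\log\psi_0$ turn the exchange terms into those of
$\Delta_h$. The pairing of the singular part with $-x/2$ gives $6\kappa+\kappa'$, and the Gaussian
gives $4\cdot\frac12=2$. -/
theorem conjugated_hamiltonian (κ κ' : ℝ) (f : MvPolynomial (Fin 4) ℝ) {x : E4}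
    (hx : x ∈ regularSet) :
    (psiZero κ κ' x)⁻¹ * hamiltonian κ κ' (fun z => psiZero κ κ' z * evalAt f z) x
      = evalAt (euler f + (2 + 6 * κ + κ') • f - laplaceH κ κ' f) x := by
  have hp := (psiZero_pos κ κ' hx).ne'
  have hE : evalAt (euler f) x = ∑ i, x i * evalAt (pderiv i f) x := by
    rw [evalAt, euler_apply, map_sum]
    simp [evalAt]
  have hn : ‖x‖ ^ 2 = ∑ i, x i ^ 2 := by
    rw [EuclideanSpace.norm_sq_eq]; simp
  have h1 : evalAt (euler f + (2 + 6 * κ + κ') • f - laplaceH κ κ' f) x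
      = evalAt (euler f) x + (2 + 6 * κ + κ') * evalAt f x - evalAt (laplaceH κ κ' f) x := by
    simp [evalAt, smul_eval]
  have h2 : (psiZero κ κ' x)⁻¹ * hamiltonian κ κ' (fun z => psiZero κ κ' z * evalAt f z) x
      = -(∑ i, (evalAt (pderiv i (pderiv i f)) x
          + 2 * logDeriv κ κ' i x * evalAt (pderiv i f) x
          + (logDeriv κ κ' i x ^ 2 + logDeriv2 κ κ' i x) * evalAt f x))
        + (∑ i, x i ^ 2) / 4 * evalAt f x
        + 2 * κ * ∑ i, ∑ j ∈ Finset.Ioi i,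
          (κ * evalAt f x - evalAt (rename (Equiv.swap i j) f) x) / (x i - x j) ^ 2
        + 4 * κ' * (κ' * evalAt f x - evalAt (reflPoly (v 0) f) x) / (∑ i, x i) ^ 2 := by
    rw [hamiltonian, laplacian_psiZero_mul κ κ' f hx, hn]
    simp only [psiZero_permAct, psiZero_sigmaZero, evalAt_permAct, evalAt_sigmaZero]
    have e : ∀ i j : Fin 4, (κ * (psiZero κ κ' x * evalAt f x)
        - psiZero κ κ' x * evalAt (rename (Equiv.swap i j) f) x) / (x i - x j) ^ 2
        = psiZero κ κ' x * ((κ * evalAt f x - evalAt (rename (Equiv.swap i j) f) x)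
          / (x i - x j) ^ 2) := fun i j => by ring
    have alg : ∀ {p : ℝ} (A n g B r S : ℝ), p ≠ 0 → p⁻¹ * (-(p * A) + n / 4 * (p * g)
        + 2 * κ * (p * B) + 4 * κ' * (κ' * (p * g) - p * r) / S ^ 2)
        = -A + n / 4 * g + 2 * κ * B + 4 * κ' * (κ' * g - r) / S ^ 2 := by
      intro p A n g B r S hp
      field_simp
    simp only [e, ← Finset.mul_sum]
    exact alg _ _ _ _ _ _ hp
  rw [h1, h2, hE, eval_laplaceH κ κ' f hx]
  have hs : ∑ i, x i ≠ 0 := hx.2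
  have hd : ∀ i j : Fin 4, i ≠ j → (x i - x j)⁻¹ * (x i - x j) = 1 := fun i j h =>
    inv_mul_cancel₀ (sub_ne_zero.2 (hx.1 i j h))
  -- The mixed $\kappa^2$ terms of roots sharing an index cancel in triples. Other pairs of distinct
  -- roots are orthogonal and produce no mixed terms.
  have ht : ∀ i j l : Fin 4, i ≠ j → i ≠ l → j ≠ l →
      (x i - x j)⁻¹ * (x i - x l)⁻¹ - (x i - x j)⁻¹ * (x j - x l)⁻¹
        + (x i - x l)⁻¹ * (x j - x l)⁻¹ = 0 := by
    intro i j l h h' h''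
    have a1 := sub_ne_zero.2 (hx.1 i j h)
    have a2 := sub_ne_zero.2 (hx.1 i l h')
    have a3 := sub_ne_zero.2 (hx.1 j l h'')
    field_simp
    ring
  have t1 := ht 0 1 2 (by decide) (by decide) (by decide)
  have t2 := ht 0 1 3 (by decide) (by decide) (by decide)
  have t3 := ht 0 2 3 (by decide) (by decide) (by decide)
  have t4 := ht 1 2 3 (by decide) (by decide) (by decide)
  have d1 := hd 0 1 (by decide)
  have d2 := hd 0 2 (by decide)
  have d3 := hd 0 3 (by decide)
  have d4 := hd 1 2 (by decide)
  have d5 := hd 1 3 (by decide)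
  have d6 := hd 2 3 (by decide)
  have d7 : (∑ i, x i)⁻¹ * (∑ i, x i) = 1 := inv_mul_cancel₀ hs
  simp only [logDeriv, logDeriv2, sum_Ioi_four]
  simp only [Fin.sum_univ_four, Fin.reduceEq, if_true, if_false, div_eq_mul_inv, ← inv_pow] at d7 ⊢
  -- With the inverses as independent variables, the claim is a polynomial identity modulo the
  -- relations `t1`–`t4` and `d1`–`d7`.
  generalize (x 0 - x 1)⁻¹ = u01 at *
  generalize (x 0 - x 2)⁻¹ = u02 at *
  generalize (x 0 - x 3)⁻¹ = u03 at *
  generalize (x 1 - x 2)⁻¹ = u12 at *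
  generalize (x 1 - x 3)⁻¹ = u13 at *
  generalize (x 2 - x 3)⁻¹ = u23 at *
  generalize (x 0 + x 1 + x 2 + x 3)⁻¹ = us at *
  linear_combination (-2 * κ ^ 2 * evalAt f x) * (t1 + t2 + t3 + t4)
    + (κ * evalAt f x) * (d1 + d2 + d3 + d4 + d5 + d6) + (κ' * evalAt f x) * d7

/-! ### Nonvanishing and square integrability -/

theorem exists_regular_evalAt_ne_zero {q : MvPolynomial (Fin 4) ℝ} (hq : q ≠ 0) :
    ∃ x ∈ regularSet, evalAt q x ≠ 0 := by
  -- A point where `q` times all the hyperplane forms does not vanish is regular and is not a zero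
  -- of `q`. It exists because a nonzero real polynomial is a nonzero function.
  have hne : q * ((∏ p ∈ (Finset.univ : Finset (Fin 4 × Fin 4)).filter (fun p => p.1 ≠ p.2),
      linForm (rootA p.1 p.2)) * linForm (fun _ => 1)) ≠ 0 := by
    refine mul_ne_zero hq (mul_ne_zero (Finset.prod_ne_zero_iff.2 fun p hp => ?_) ?_)
    · refine linForm_ne_zero fun h => ?_
      have := congrFun h p.1
      simp [rootA, (Finset.mem_filter.1 hp).2] at this
    · refine linForm_ne_zero fun h => ?_
      simpa using congrFun h 0
  obtain ⟨x, hx⟩ : ∃ x : Fin 4 → ℝ, eval x (q * _) ≠ 0 := by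
    by_contra! hc
    exact hne (MvPolynomial.funext fun x => by rw [hc x, map_zero])
  rw [map_mul, map_mul, map_prod] at hx
  have h1 := left_ne_zero_of_mul hx
  have h2 := right_ne_zero_of_mul hx
  refine ⟨WithLp.toLp 2 x, ⟨fun i j hij heq => ?_, ?_⟩, h1⟩
  · refine Finset.prod_ne_zero_iff.1 (left_ne_zero_of_mul h2) (i, j) (by simpa using hij) ?_
    rw [eval_linForm, rootA_dot, sub_eq_zero]
    exact heq
  · have := right_ne_zero_of_mul h2
    rw [eval_linForm] at this
    simpa [dotProduct] using this

/-- Polynomial growth. -/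
def PolyGrowth (g : E4 → ℝ) : Prop := ∃ (C : ℝ) (n : ℕ), ∀ x, |g x| ≤ C * (1 + ‖x‖) ^ n

theorem PolyGrowth.mul {g h : E4 → ℝ} (hg : PolyGrowth g) (hh : PolyGrowth h) :
    PolyGrowth fun x => g x * h x := by
  obtain ⟨C, n, hC⟩ := hg
  obtain ⟨D, m, hD⟩ := hh
  refine ⟨C * D, n + m, fun x => ?_⟩
  rw [abs_mul, pow_add, mul_mul_mul_comm]
  exact mul_le_mul (hC x) (hD x) (abs_nonneg _) ((abs_nonneg _).trans (hC x))

theorem PolyGrowth.const (c : ℝ) : PolyGrowth fun _ => c := ⟨|c|, 0, fun x => by simp⟩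

theorem PolyGrowth.add {g h : E4 → ℝ} (hg : PolyGrowth g) (hh : PolyGrowth h) :
    PolyGrowth fun x => g x + h x := by
  obtain ⟨C, n, hC⟩ := hg
  obtain ⟨D, m, hD⟩ := hh
  have hpos : ∀ (C : ℝ) (n : ℕ) (x : E4) (t : ℝ), |t| ≤ C * (1 + ‖x‖) ^ n → 0 ≤ C := by
    intro C n x t h
    have h1 : 0 < (1 + ‖x‖) ^ n := by positivity
    exact nonneg_of_mul_nonneg_left ((abs_nonneg _).trans h) h1
  have hC0 := hpos C n 0 _ (hC 0)
  have hD0 := hpos D m 0 _ (hD 0)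
  refine ⟨C + D, n + m, fun x => ?_⟩
  have h1 : 1 ≤ 1 + ‖x‖ := le_add_of_nonneg_right (norm_nonneg x)
  have e1 : C * (1 + ‖x‖) ^ n ≤ C * (1 + ‖x‖) ^ (n + m) :=
    mul_le_mul_of_nonneg_left (pow_le_pow_right₀ h1 (by omega)) hC0
  have e2 : D * (1 + ‖x‖) ^ m ≤ D * (1 + ‖x‖) ^ (n + m) :=
    mul_le_mul_of_nonneg_left (pow_le_pow_right₀ h1 (by omega)) hD0
  rw [add_mul]
  exact (abs_add_le _ _).trans (add_le_add ((hC x).trans e1) ((hD x).trans e2))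

theorem PolyGrowth.prod {ι : Type*} (s : Finset ι) {g : ι → E4 → ℝ}
    (h : ∀ i ∈ s, PolyGrowth (g i)) : PolyGrowth fun x => ∏ i ∈ s, g i x := by
  classical
  induction s using Finset.induction_on with
  | empty => simpa using PolyGrowth.const 1
  | insert i s hi ih =>
    simp only [Finset.prod_insert hi]
    exact (h i (Finset.mem_insert_self i s)).mul (ih fun j hj => h j (Finset.mem_insert_of_mem hj))

theorem polyGrowth_coord (i : Fin 4) : PolyGrowth fun x => x i :=
  ⟨1, 1, fun x => by
    have := PiLp.norm_apply_le x i
    rw [Real.norm_eq_abs] at this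
    rw [one_mul, pow_one]
    exact this.trans (by linarith)⟩

theorem polyGrowth_evalAt (f : MvPolynomial (Fin 4) ℝ) : PolyGrowth (evalAt f) := by
  unfold evalAt
  induction f using MvPolynomial.induction_on with
  | C c => simpa using PolyGrowth.const c
  | add p q hp hq => simpa using hp.add hq
  | mul_X p i hp => simpa using hp.mul (polyGrowth_coord i)

/-- Nonnegativity of the exponent is essential: it is where `κ, κ' ≥ 0` enters the growth estimate
for $\psi_0$. -/
theorem PolyGrowth.rpow {g : E4 → ℝ} (hg : PolyGrowth g) {c : ℝ} (hc : 0 ≤ c) :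
    PolyGrowth fun x => |g x| ^ c := by
  obtain ⟨C, n, hC⟩ := hg
  refine ⟨(|C| + 1) ^ c, ⌈n * c⌉₊, fun x => ?_⟩
  have h1 : 1 ≤ 1 + ‖x‖ := le_add_of_nonneg_right (norm_nonneg x)
  have h2 : |g x| ≤ (|C| + 1) * (1 + ‖x‖) ^ n :=
    (hC x).trans (mul_le_mul_of_nonneg_right ((le_abs_self C).trans (by linarith)) (by positivity))
  rw [abs_of_nonneg (by positivity)]
  calc |g x| ^ c ≤ ((|C| + 1) * (1 + ‖x‖) ^ n) ^ c :=
        Real.rpow_le_rpow (abs_nonneg _) h2 hc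
    _ = (|C| + 1) ^ c * (1 + ‖x‖) ^ (n * c) := by
        rw [Real.mul_rpow (by positivity) (by positivity), ← Real.rpow_natCast,
          ← Real.rpow_mul (by positivity)]
    _ ≤ (|C| + 1) ^ c * (1 + ‖x‖) ^ ⌈n * c⌉₊ := by
        refine mul_le_mul_of_nonneg_left ?_ (by positivity)
        rw [← Real.rpow_natCast]
        exact Real.rpow_le_rpow_of_exponent_le h1 (Nat.le_ceil _)

theorem integrable_gaussian {b : ℝ} (hb : 0 < b) :
    MeasureTheory.Integrable fun x : E4 => Real.exp (-b * ‖x‖ ^ 2) := by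
  have := (GaussianFourier.integrable_cexp_neg_mul_sq_norm_add (V := E4) (b := (b : ℂ))
    (by simpa using hb) 0 0).re
  refine this.congr (Filter.Eventually.of_forall fun x => ?_)
  simp only [zero_mul, add_zero]
  rw [show -(b : ℂ) * (‖x‖ : ℂ) ^ 2 = ((-b * ‖x‖ ^ 2 : ℝ) : ℂ) by push_cast; ring,
    ← Complex.ofReal_exp]
  rfl

/-- Half of the Gaussian exponent absorbs the polynomial growth; the other half is
square-integrable. -/
theorem memLp_growth_mul_gaussian {g : E4 → ℝ} (hg : PolyGrowth g) (hc : Continuous g) :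
    MeasureTheory.MemLp (fun x => g x * Real.exp (-(1 / 4) * ‖x‖ ^ 2)) 2
      MeasureTheory.volume := by
  obtain ⟨C, n, hC⟩ := hg
  have hG : MeasureTheory.MemLp (fun x : E4 => Real.exp (-(1 / 8) * ‖x‖ ^ 2)) 2
      MeasureTheory.volume := by
    rw [MeasureTheory.memLp_two_iff_integrable_sq
      (Continuous.aestronglyMeasurable (by fun_prop))]
    refine (integrable_gaussian (b := 1 / 4) (by norm_num)).congr
      (Filter.Eventually.of_forall fun x => ?_)
    simp only
    rw [← Real.exp_nat_mul]
    congr 1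
    push_cast
    ring
  refine hG.of_le_mul (c := |C| * (16 ^ n * n.factorial * Real.exp (1 / 8)))
    (Continuous.aestronglyMeasurable (by fun_prop)) (Filter.Eventually.of_forall fun x => ?_)
  have h1 : 1 ≤ 1 + ‖x‖ := le_add_of_nonneg_right (norm_nonneg x)
  -- With $t=(1+\|x\|^2)/8$ one has $1+\|x\|\le16t$ and $t^n\le n!\,e^t$, which explains the
  -- constant.
  have h2 : (1 + ‖x‖) ^ n ≤ 16 ^ n * n.factorial * Real.exp ((1 + ‖x‖ ^ 2) / 8) := by
    have e1 : 1 + ‖x‖ ≤ 16 * ((1 + ‖x‖ ^ 2) / 8) := by nlinarith [sq_nonneg (‖x‖ - 1)]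
    have e2 := Real.pow_div_factorial_le_exp (x := (1 + ‖x‖ ^ 2) / 8) (by positivity) n
    rw [div_le_iff₀ (by positivity)] at e2
    calc (1 + ‖x‖) ^ n ≤ (16 * ((1 + ‖x‖ ^ 2) / 8)) ^ n := pow_le_pow_left₀ (by positivity) e1 n
      _ = 16 ^ n * ((1 + ‖x‖ ^ 2) / 8) ^ n := mul_pow _ _ _
      _ ≤ 16 ^ n * (Real.exp ((1 + ‖x‖ ^ 2) / 8) * n.factorial) := by gcongr
      _ = _ := by ring
  rw [Real.norm_eq_abs, Real.norm_eq_abs, abs_mul, abs_of_pos (Real.exp_pos _),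
    abs_of_pos (Real.exp_pos _)]
  calc |g x| * Real.exp (-(1 / 4) * ‖x‖ ^ 2)
      ≤ |C| * (16 ^ n * n.factorial * Real.exp ((1 + ‖x‖ ^ 2) / 8))
        * Real.exp (-(1 / 4) * ‖x‖ ^ 2) := by
        refine mul_le_mul_of_nonneg_right ((hC x).trans ?_) (Real.exp_pos _).le
        exact mul_le_mul (le_abs_self C) h2 (by positivity) (abs_nonneg C)
    _ = |C| * (16 ^ n * n.factorial * Real.exp (1 / 8)) * Real.exp (-(1 / 8) * ‖x‖ ^ 2) := by
        have : Real.exp ((1 + ‖x‖ ^ 2) / 8) * Real.exp (-(1 / 4) * ‖x‖ ^ 2)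
            = Real.exp (1 / 8) * Real.exp (-(1 / 8) * ‖x‖ ^ 2) := by
          rw [← Real.exp_add, ← Real.exp_add]
          congr 1
          ring
        linear_combination (|C| * (16 ^ n * n.factorial)) * this

theorem memLp_evalAt_mul_psiZero {κ κ' : ℝ} (hκ : 0 ≤ κ) (hκ' : 0 ≤ κ')
    (f : MvPolynomial (Fin 4) ℝ) :
    MeasureTheory.MemLp (fun x => evalAt f x * psiZero κ κ' x) 2 MeasureTheory.volume := by
  have hs : ∀ i j : Fin 4, PolyGrowth fun x => x i - x j := fun i j => by
    have := polyGrowth_evalAt (X i - X j)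
    have h : evalAt (X i - X j) = fun x => x i - x j := by
      ext x
      simp [evalAt]
    rwa [h] at this
  have hg : PolyGrowth fun x => evalAt f x *
      ((∏ i, ∏ j ∈ Finset.Ioi i, |x i - x j| ^ κ) * |evalAt (y 0) x| ^ κ') :=
    (polyGrowth_evalAt f).mul ((PolyGrowth.prod _ fun i _ => PolyGrowth.prod _ fun j _ =>
      (hs i j).rpow hκ).mul ((polyGrowth_evalAt (y 0)).rpow hκ'))
  have hc : Continuous fun x : E4 => evalAt f x *
      ((∏ i, ∏ j ∈ Finset.Ioi i, |x i - x j| ^ κ) * |evalAt (y 0) x| ^ κ') := by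
    refine (contDiff_evalAt f).continuous.mul (Continuous.mul ?_ ?_)
    · refine continuous_finsetProd _ fun i _ => continuous_finsetProd _ fun j _ => ?_
      exact Continuous.rpow_const (by fun_prop) fun x => Or.inr hκ
    · exact ((contDiff_evalAt (y 0)).continuous.abs).rpow_const fun x => Or.inr hκ'
  have := memLp_growth_mul_gaussian hg hc
  refine this.ae_eq (Filter.Eventually.of_forall fun x => ?_)
  simp only [psiZero]
  ring

/-- A nonzero polynomial `q` with `E q + (2 + 6κ + κ') q - Δ_h q = e q` gives an eigenfunction. -/
theorem isEigenfunction_of_eq {κ κ' : ℝ} (hκ : 0 ≤ κ) (hκ' : 0 ≤ κ') {e : ℝ}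
    {q : MvPolynomial (Fin 4) ℝ} (hq : q ≠ 0)
    (h : euler q + (2 + 6 * κ + κ') • q - laplaceH κ κ' q = e • q) :
    IsEigenfunction κ κ' e fun x => evalAt q x * psiZero κ κ' x where
  memLp := memLp_evalAt_mul_psiZero hκ hκ' q
  contDiffOn := contDiffOn_evalAt_mul_psiZero κ κ' q
  exists_ne_zero := by
    obtain ⟨x, hx, hne⟩ := exists_regular_evalAt_ne_zero hq
    exact ⟨x, hx, mul_ne_zero hne (psiZero_pos κ κ' hx).ne'⟩
  eigen x hx := by
    have h1 := conjugated_hamiltonian κ κ' q hx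
    rw [h, inv_mul_eq_iff_eq_mul₀ (psiZero_pos κ κ' hx).ne'] at h1
    simp only [mul_comm (evalAt q _)]
    rw [h1, evalAt, smul_eval, evalAt]
    ring

/-- The eigenvalue equation holds only at regular points, but a polynomial that vanishes at all of
them is zero. -/
theorem eq_of_isEigenfunction {κ κ' e : ℝ} {q : MvPolynomial (Fin 4) ℝ}
    (h : IsEigenfunction κ κ' e fun x => evalAt q x * psiZero κ κ' x) :
    q ≠ 0 ∧ euler q + (2 + 6 * κ + κ') • q - laplaceH κ κ' q = e • q := by
  constructor
  · rintro rfl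
    obtain ⟨x, -, hx⟩ := h.exists_ne_zero
    simp [evalAt] at hx
  · by_contra hne
    obtain ⟨x, hx, hne'⟩ := exists_regular_evalAt_ne_zero (sub_ne_zero.2 hne)
    apply hne'
    have h1 := conjugated_hamiltonian κ κ' q hx
    have h2 := h.eigen x hx
    simp only [mul_comm (evalAt q _)] at h2
    rw [h2] at h1
    have h3 : evalAt (euler q + (2 + 6 * κ + κ') • q - laplaceH κ κ' q - e • q) x
        = evalAt (euler q + (2 + 6 * κ + κ') • q - laplaceH κ κ' q) x - e * evalAt q x := by
      simp [evalAt, smul_eval]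
    rw [h3, ← h1]
    have := (psiZero_pos κ κ' hx).ne'
    field_simp
    ring

/-! ### Monomials -/

/-- The monomial `x^α`. -/
def mono (α : Fin N → ℕ) : MvPolynomial (Fin N) ℝ :=
  monomial (Finsupp.equivFunOnFinite.symm α) 1

/-- `coeffAt β` as a linear map. -/
def coeffAtLin (β : Fin N → ℕ) : MvPolynomial (Fin N) ℝ →ₗ[ℝ] ℝ :=
  lcoeff ℝ (Finsupp.equivFunOnFinite.symm β)

theorem coeffAt_mono (β α : Fin N → ℕ) : coeffAt β (mono α) = if α = β then 1 else 0 := by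
  rw [coeffAt, mono, coeff_monomial]
  simp

theorem coeffAt_add (β : Fin N → ℕ) (f g : MvPolynomial (Fin N) ℝ) :
    coeffAt β (f + g) = coeffAt β f + coeffAt β g := map_add (coeffAtLin β) f g

theorem coeffAt_sub (β : Fin N → ℕ) (f g : MvPolynomial (Fin N) ℝ) :
    coeffAt β (f - g) = coeffAt β f - coeffAt β g := map_sub (coeffAtLin β) f g

theorem coeffAt_smul (β : Fin N → ℕ) (c : ℝ) (f : MvPolynomial (Fin N) ℝ) :
    coeffAt β (c • f) = c * coeffAt β f := map_smul (coeffAtLin β) c f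

theorem coeffAt_sum {ι : Type*} (β : Fin N → ℕ) (s : Finset ι)
    (f : ι → MvPolynomial (Fin N) ℝ) : coeffAt β (∑ i ∈ s, f i) = ∑ i ∈ s, coeffAt β (f i) :=
  map_sum (coeffAtLin β) f s

@[simp] theorem coeffAt_zero (β : Fin N → ℕ) : coeffAt β 0 = 0 := map_zero (coeffAtLin β)

theorem coeff_eq_coeffAt (m : Fin N →₀ ℕ) (f : MvPolynomial (Fin N) ℝ) :
    coeff m f = coeffAt (⇑m) f := by
  rw [coeffAt]
  congr 1
  ext i
  simp

theorem ext_coeffAt {f g : MvPolynomial (Fin N) ℝ} (h : ∀ β, coeffAt β f = coeffAt β g) :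
    f = g := by
  ext m
  rw [coeff_eq_coeffAt, coeff_eq_coeffAt, h]

theorem eq_sum_mono (f : MvPolynomial (Fin N) ℝ) :
    f = ∑ m ∈ f.support, coeffAt (⇑m) f • mono (⇑m) := by
  conv_lhs => rw [f.as_sum]
  refine Finset.sum_congr rfl fun m _ => ?_
  rw [mono, coeff_eq_coeffAt, smul_monomial, smul_eq_mul, mul_one]
  congr 1
  ext i
  simp

theorem X_mul_mono (i : Fin N) (α : Fin N → ℕ) :
    X i * mono α = mono (Function.update α i (α i + 1)) := by
  rw [mono, mono, X, monomial_mul, one_mul]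
  refine congrArg (fun m => monomial m (1 : ℝ)) ?_
  ext j
  by_cases h : j = i
  · subst h; simp [add_comm]
  · simp [h]

theorem rename_mono (w : Equiv.Perm (Fin N)) (α : Fin N → ℕ) :
    rename w (mono α) = mono (α ∘ w.symm) := by
  rw [mono, rename_monomial, mono]
  refine congrArg (fun m => monomial m (1 : ℝ)) ?_
  ext j
  rw [← Finsupp.equivMapDomain_eq_mapDomain]
  simp

theorem coeffAt_rename (w : Equiv.Perm (Fin N)) (β : Fin N → ℕ) (f : MvPolynomial (Fin N) ℝ) :
    coeffAt β (rename w f) = coeffAt (β ∘ w) f := by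
  have h := coeff_rename_mapDomain w w.injective f (Finsupp.equivFunOnFinite.symm (β ∘ w))
  rw [coeffAt, coeffAt, ← h]
  congr 1
  ext j
  rw [← Finsupp.equivMapDomain_eq_mapDomain]
  simp

theorem exists_coeffAt_ne_zero {f : MvPolynomial (Fin N) ℝ} (hf : f ≠ 0) :
    ∃ β, coeffAt β f ≠ 0 := by
  by_contra! h
  exact hf (ext_coeffAt fun β => by rw [h, coeffAt_zero])

theorem finite_coeffAt (f : MvPolynomial (Fin N) ℝ) : {β | coeffAt β f ≠ 0}.Finite := by
  refine (f.support.finite_toSet.image fun m : Fin N →₀ ℕ => (m : Fin N → ℕ)).subset fun β hβ => ?_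
  exact ⟨Finsupp.equivFunOnFinite.symm β, by simpa [coeffAt] using hβ, by simp⟩

theorem isHomogeneous_of_coeffAt {f : MvPolynomial (Fin N) ℝ} {d : ℕ}
    (h : ∀ β, coeffAt β f ≠ 0 → ∑ i, β i = d) : f.IsHomogeneous d := by
  intro m hm
  rw [coeff_eq_coeffAt] at hm
  rw [← h _ hm, ← Finsupp.degree_eq_sum, Finsupp.degree_eq_weight_one (R := ℕ)]
  rfl

theorem sum_eq_of_isHomogeneous {f : MvPolynomial (Fin N) ℝ} {d : ℕ} (h : f.IsHomogeneous d)
    {β : Fin N → ℕ} (hβ : coeffAt β f ≠ 0) : ∑ i, β i = d := by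
  have := h hβ
  rw [← this]
  change _ = Finsupp.weight (fun _ => 1) _
  rw [← Finsupp.degree_eq_weight_one (R := ℕ), Finsupp.degree_eq_sum]
  rfl

/-! ### Divided differences of monomials -/

theorem linForm_rootA (i j : Fin N) : linForm (rootA i j) = X i - X j := by
  rw [rootA, linForm_sub, linForm_single, linForm_single]

theorem rootA_ne_zero {i j : Fin N} (h : i ≠ j) : rootA i j ≠ 0 := by
  intro h0
  have := congrFun h0 i
  simp [rootA, h] at this

/-- The composition with the entries `α_i`, `α_j` replaced by `a`, `b`. -/
def replace (α : Fin N → ℕ) (i j : Fin N) (a b : ℕ) : Fin N → ℕ :=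
  fun t => if t = i then a else if t = j then b else α t

theorem X_mul_mono_replace_left {i j : Fin N} (α : Fin N → ℕ) (a b : ℕ) :
    X i * mono (replace α i j a b) = mono (replace α i j (a + 1) b) := by
  rw [X_mul_mono]
  congr 1
  ext t
  by_cases h : t = i <;> simp [replace, h]

theorem X_mul_mono_replace_right {i j : Fin N} (h : i ≠ j) (α : Fin N → ℕ) (a b : ℕ) :
    X j * mono (replace α i j a b) = mono (replace α i j a (b + 1)) := by
  rw [X_mul_mono]
  congr 1
  ext t
  simp only [Function.update_apply, replace]
  split_ifs <;> simp_all

theorem replace_self (α : Fin N → ℕ) (i j : Fin N) : replace α i j (α i) (α j) = α := by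
  ext t
  simp only [replace]
  split_ifs <;> simp_all

theorem comp_swap_eq_replace (α : Fin N → ℕ) (i j : Fin N) :
    α ∘ Equiv.swap i j = replace α i j (α j) (α i) := by
  ext t
  simp only [replace, Function.comp, Equiv.swap_apply_def]
  split_ifs <;> rfl

theorem replace_comp_swap {i j : Fin N} (h : i ≠ j) (α : Fin N → ℕ) (a b : ℕ) :
    replace α i j a b ∘ Equiv.swap i j = replace α i j b a := by
  ext t
  simp only [replace, Function.comp, Equiv.swap_apply_def]
  split_ifs <;> simp_all

/-- The sum telescopes. The bound on `n` keeps every truncated subtraction exact. -/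
theorem linForm_rootA_mul_sum {i j : Fin N} (h : i ≠ j) (α : Fin N → ℕ) (a b n : ℕ)
    (hn : n ≤ a + 1) :
    linForm (rootA i j) * ∑ l ∈ Finset.range n, mono (replace α i j (a - l) (b + l))
      = mono (replace α i j (a + 1) b) - mono (replace α i j (a + 1 - n) (b + n)) := by
  rw [linForm_rootA, Finset.mul_sum]
  rw [Finset.sum_congr rfl (g := fun l => mono (replace α i j (a + 1 - l) (b + l))
    - mono (replace α i j (a + 1 - (l + 1)) (b + (l + 1))))]
  · rw [Finset.sum_range_sub']
    simp
  · intro l hl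
    have hl' := Finset.mem_range.1 hl
    rw [sub_mul, X_mul_mono_replace_left, X_mul_mono_replace_right h]
    rw [show a - l + 1 = a + 1 - l by omega, show a + 1 - (l + 1) = a - l by omega, add_assoc]

theorem X_mul_mono_eq_replace (i j : Fin N) (α : Fin N → ℕ) :
    X i * mono α = mono (replace α i j (α i + 1) (α j)) := by
  conv_lhs => rw [← replace_self α i j]
  rw [X_mul_mono_replace_left]

theorem rename_swap_mono (i j : Fin N) (α : Fin N → ℕ) :
    rename (Equiv.swap i j) (mono α) = mono (α ∘ Equiv.swap i j) := by
  rw [rename_mono, Equiv.symm_swap]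

/-- The ends of the sum are `α` itself (`l = 0`) and `α` with the two entries interchanged; the
remaining exponents lie strictly between. -/
theorem divDiff_X_mul_mono_of_le {i j : Fin N} (h : i ≠ j) {α : Fin N → ℕ} (hα : α j ≤ α i) :
    divDiff (rootA i j) (X i * mono α)
      = ∑ l ∈ Finset.range (α i - α j + 1), mono (replace α i j (α i - l) (α j + l)) := by
  refine divDiff_eq_of_mul (rootA_ne_zero h) ?_
  rw [linForm_rootA_mul_sum h _ _ _ _ (by omega), X_mul_mono_eq_replace i j, reflPoly_rootA,
    rename_swap_mono, replace_comp_swap h]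
  congr 3
  · omega
  · omega

/-- Here both ends are missing: all exponents lie strictly between `α i` and `α j`, and the sum is
empty when they differ by one. -/
theorem divDiff_X_mul_mono_of_lt {i j : Fin N} (h : i ≠ j) {α : Fin N → ℕ} (hα : α i < α j) :
    divDiff (rootA i j) (X i * mono α)
      = -∑ l ∈ Finset.range (α j - α i - 1),
        mono (replace α i j (α j - 1 - l) (α i + 1 + l)) := by
  refine divDiff_eq_of_mul (rootA_ne_zero h) ?_
  rw [mul_neg, linForm_rootA_mul_sum h _ _ _ _ (by omega), X_mul_mono_eq_replace i j,
    reflPoly_rootA, rename_swap_mono, replace_comp_swap h, neg_sub,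
    show α j - 1 + 1 - (α j - α i - 1) = α i + 1 by omega,
    show α i + 1 + (α j - α i - 1) = α j by omega, show α j - 1 + 1 = α j by omega]

/-! ### Ranks and eigenvalues -/

/-- `j` precedes `i` in the order that defines the ranks of `α`. -/
def Precedes (α : Fin N → ℕ) (j i : Fin N) : Prop := α i < α j ∨ (α j = α i ∧ j < i)

theorem compRank_eq_card (α : Fin N → ℕ) (i : Fin N) :
    compRank α i = (Finset.univ.filter fun j => α i < α j ∨ (j ≤ i ∧ α j = α i)).card := by
  rw [compRank, Finset.filter_or, Finset.card_union_of_disjoint]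
  rw [Finset.disjoint_filter]
  rintro j - h1 ⟨-, h2⟩
  omega

theorem compRank_lt {α : Fin N → ℕ} {i j : Fin N} (h : Precedes α j i) :
    compRank α j < compRank α i := by
  rw [compRank_eq_card, compRank_eq_card]
  refine Finset.card_lt_card (Finset.ssubset_iff_subset_ne.2 ⟨fun l hl => ?_, fun he => ?_⟩)
  · simp only [Finset.mem_filter, Finset.mem_univ, true_and] at hl ⊢
    rcases h with h | ⟨h, h'⟩ <;> rcases hl with hl | ⟨hl, hl'⟩
    · left; omega
    · left; omega
    · left; omega
    · right; exact ⟨hl.trans h'.le, by omega⟩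
  · have : i ∈ Finset.univ.filter fun l => α j < α l ∨ (l ≤ j ∧ α l = α j) := by
      rw [he]
      simp
    simp only [Finset.mem_filter, Finset.mem_univ, true_and] at this
    rcases h with h | ⟨h, h'⟩ <;> rcases this with hl | ⟨hl, hl'⟩
    · omega
    · omega
    · omega
    · exact absurd h' hl.not_gt

theorem xi_sub_xi (κ : ℝ) (α : Fin N → ℕ) (i j : Fin N) :
    xi κ α j - xi κ α i = ((compRank α i : ℝ) - compRank α j) * κ + (α j - α i) := by
  rw [xi, xi]
  ring

/-- The ranks of `j` and `i` differ by at least one. This gap keeps the denominators nonzero and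
separates eigenvalues. -/
theorem kappa_add_le_xi_sub_xi {κ : ℝ} (hκ : 0 ≤ κ) {α : Fin N → ℕ} {i j : Fin N}
    (h : Precedes α j i) : κ + ((α j : ℝ) - α i) ≤ xi κ α j - xi κ α i := by
  rw [xi_sub_xi]
  have h1 : (compRank α j : ℝ) + 1 ≤ compRank α i := by exact_mod_cast compRank_lt h
  nlinarith

theorem le_of_precedes {α : Fin N → ℕ} {i j : Fin N} (h : Precedes α j i) : α i ≤ α j := by
  rcases h with h | ⟨h, -⟩ <;> omega

theorem precedes_trichotomy (α : Fin N → ℕ) {i j : Fin N} (h : i ≠ j) :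
    Precedes α j i ∨ Precedes α i j := by
  rcases lt_trichotomy (α i) (α j) with h1 | h1 | h1
  · exact Or.inl (Or.inl h1)
  · rcases lt_or_gt_of_ne h with h2 | h2
    · exact Or.inr (Or.inr ⟨h1, h2⟩)
    · exact Or.inl (Or.inr ⟨h1.symm, h2⟩)
  · exact Or.inr (Or.inl h1)

theorem compRank_eq_card_xi {κ : ℝ} (hκ : 0 < κ) (α : Fin N → ℕ) (i : Fin N) :
    compRank α i = (Finset.univ.filter fun j => xi κ α i ≤ xi κ α j).card := by
  have key : ∀ {a b : Fin N}, Precedes α a b → xi κ α b < xi κ α a := by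
    intro a b h
    have h1 := kappa_add_le_xi_sub_xi hκ.le h
    have h2 : (α b : ℝ) ≤ α a := by exact_mod_cast le_of_precedes h
    linarith
  rw [compRank_eq_card]
  congr 1
  ext j
  simp only [Finset.mem_filter, Finset.mem_univ, true_and]
  by_cases hij : i = j
  · subst hij; simp
  · constructor
    · intro h
      refine (key (a := j) (b := i) ?_).le
      rcases h with h | ⟨h, h'⟩
      · exact Or.inl h
      · exact Or.inr ⟨h', lt_of_le_of_ne h (Ne.symm hij)⟩
    · intro h
      rcases precedes_trichotomy α hij with h1 | h1
      · rcases h1 with h1 | ⟨h1, h2⟩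
        · exact Or.inl h1
        · exact Or.inr ⟨h2.le, h1⟩
      · exact absurd h (key h1).not_ge

/-- For `κ > 0` the ordering of the eigenvalues recovers the ranks, and then the entries. For `κ =
0` the eigenvalues are `α i + 1`. -/
theorem xi_injective {κ : ℝ} (hκ : 0 ≤ κ) {α β : Fin N → ℕ} (h : ∀ i, xi κ α i = xi κ β i) :
    α = β := by
  ext i
  have hi := h i
  rcases hκ.eq_or_lt with rfl | hκ
  · simp only [xi, mul_zero, zero_add, add_left_inj] at hi
    exact_mod_cast hi
  · have hr : compRank α i = compRank β i := by
      rw [compRank_eq_card_xi hκ, compRank_eq_card_xi hκ]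
      simp only [h]
    rw [xi, xi, hr] at hi
    have : (α i : ℝ) = β i := by linarith
    exact_mod_cast this

/-! ### The order on compositions with three parts -/

/-- The largest part. -/
def maxPart (α : Fin 3 → ℕ) : ℕ := max (α 0) (max (α 1) (α 2))

/-- The smallest part. -/
def minPart (α : Fin 3 → ℕ) : ℕ := min (α 0) (min (α 1) (α 2))

theorem le_maxPart (α : Fin 3 → ℕ) (i : Fin 3) : α i ≤ maxPart α := by
  fin_cases i <;> simp [maxPart]

theorem minPart_le (α : Fin 3 → ℕ) (i : Fin 3) : minPart α ≤ α i := by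
  fin_cases i <;> simp [minPart]

theorem sortDesc_antitone (α : Fin N → ℕ) : Antitone (sortDesc α) := fun _ _ h =>
  Tuple.monotone_sort (fun i => OrderDual.toDual (α i)) h

theorem sum_sortDesc (α : Fin N → ℕ) : ∑ i, sortDesc α i = ∑ i, α i := Equiv.sum_comp _ _

theorem eq_sortDesc_apply (α : Fin N → ℕ) (i : Fin N) : ∃ j, α i = sortDesc α j :=
  ⟨(Tuple.sort fun i => OrderDual.toDual (α i)).symm i, by simp [sortDesc]⟩

theorem sortDesc_zero (α : Fin 3 → ℕ) : sortDesc α 0 = maxPart α := by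
  refine le_antisymm (le_maxPart α _) ?_
  have h : ∀ i, α i ≤ sortDesc α 0 := by
    intro i
    obtain ⟨j, hj⟩ := eq_sortDesc_apply α i
    rw [hj]
    exact sortDesc_antitone α (Fin.zero_le j)
  exact max_le (h 0) (max_le (h 1) (h 2))

theorem sortDesc_two (α : Fin 3 → ℕ) : sortDesc α 2 = minPart α := by
  refine le_antisymm ?_ (minPart_le α _)
  have h : ∀ i, sortDesc α 2 ≤ α i := by
    intro i
    obtain ⟨j, hj⟩ := eq_sortDesc_apply α i
    rw [hj]
    exact sortDesc_antitone α (Fin.le_last j)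
  exact le_min (h 0) (le_min (h 1) (h 2))

theorem sortDesc_one (α : Fin 3 → ℕ) :
    maxPart α + sortDesc α 1 + minPart α = α 0 + α 1 + α 2 := by
  have := sum_sortDesc α
  rwa [Fin.sum_univ_three, Fin.sum_univ_three, sortDesc_zero, sortDesc_two] at this

theorem fun_three_ext_iff {α β : Fin 3 → ℕ} : α = β ↔ α 0 = β 0 ∧ α 1 = β 1 ∧ α 2 = β 2 := by
  constructor
  · rintro rfl; simp
  · rintro ⟨h0, h1, h2⟩
    ext i
    fin_cases i <;> assumption

theorem dominates_iff {α β : Fin 3 → ℕ} (h : α 0 + α 1 + α 2 = β 0 + β 1 + β 2) :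
    Dominates α β ↔ ¬(α 0 = β 0 ∧ α 1 = β 1 ∧ α 2 = β 2) ∧ β 0 ≤ α 0 ∧
      β 0 + β 1 ≤ α 0 + α 1 := by
  have h0 : Finset.Iic (0 : Fin 3) = {0} := by decide
  have h1 : Finset.Iic (1 : Fin 3) = {0, 1} := by decide
  have h2 : Finset.Iic (2 : Fin 3) = {0, 1, 2} := by decide
  have e0 : ∀ γ : Fin 3 → ℕ, ∑ i ∈ Finset.Iic 0, γ i = γ 0 := fun γ => by rw [h0]; simp
  have e1 : ∀ γ : Fin 3 → ℕ, ∑ i ∈ Finset.Iic 1, γ i = γ 0 + γ 1 := fun γ => by rw [h1]; simp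
  have e2 : ∀ γ : Fin 3 → ℕ, ∑ i ∈ Finset.Iic 2, γ i = γ 0 + γ 1 + γ 2 := fun γ => by
    rw [h2]; simp [add_assoc]
  rw [Dominates, ne_eq, fun_three_ext_iff, Fin.forall_fin_succ, Fin.forall_fin_succ,
    Fin.forall_fin_one]
  change _ ∧ (∑ i ∈ Finset.Iic 0, β i ≤ ∑ i ∈ Finset.Iic 0, α i ∧
    ∑ i ∈ Finset.Iic 1, β i ≤ ∑ i ∈ Finset.Iic 1, α i ∧
    ∑ i ∈ Finset.Iic 2, β i ≤ ∑ i ∈ Finset.Iic 2, α i) ↔ _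
  rw [e0, e0, e1, e1, e2, e2]
  exact ⟨fun ⟨a, b, c, _⟩ => ⟨a, b, c⟩, fun ⟨a, b, c⟩ => ⟨a, b, c, h.ge⟩⟩

/-- A partition with three parts is determined by its largest part, its smallest part and its total.
Dominance then means a larger maximum and a smaller minimum, which makes the order accessible to
linear arithmetic. -/
theorem above_iff {α β : Fin 3 → ℕ} :
    Above α β ↔ α 0 + α 1 + α 2 = β 0 + β 1 + β 2 ∧
      ((maxPart β ≤ maxPart α ∧ minPart α ≤ minPart β ∧
        (maxPart β < maxPart α ∨ minPart α < minPart β)) ∨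
      (maxPart α = maxPart β ∧ minPart α = minPart β ∧
        ¬(α 0 = β 0 ∧ α 1 = β 1 ∧ α 2 = β 2) ∧ β 0 ≤ α 0 ∧ β 0 + β 1 ≤ α 0 + α 1)) := by
  rw [Above, Fin.sum_univ_three, Fin.sum_univ_three]
  refine and_congr_right fun h => ?_
  have hα := sortDesc_one α
  have hβ := sortDesc_one β
  have hs : sortDesc α 0 + sortDesc α 1 + sortDesc α 2
      = sortDesc β 0 + sortDesc β 1 + sortDesc β 2 := by
    rw [sortDesc_zero, sortDesc_zero, sortDesc_two, sortDesc_two]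
    omega
  rw [dominates_iff hs, dominates_iff h, fun_three_ext_iff, sortDesc_zero, sortDesc_zero,
    sortDesc_two, sortDesc_two]
  omega

theorem Above.trans {α β γ : Fin 3 → ℕ} (h1 : Above α β) (h2 : Above β γ) : Above α γ := by
  rw [above_iff] at *
  omega

theorem Above.irrefl (α : Fin 3 → ℕ) : ¬Above α α := by
  rw [above_iff]
  omega

theorem Above.sum_eq {α β : Fin N → ℕ} (h : Above α β) : ∑ i, α i = ∑ i, β i := h.1

theorem maxPart_le_iff {α : Fin 3 → ℕ} {m : ℕ} : maxPart α ≤ m ↔ ∀ i, α i ≤ m := by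
  simp [maxPart, Fin.forall_fin_succ]

theorem le_minPart_iff {α : Fin 3 → ℕ} {m : ℕ} : m ≤ minPart α ↔ ∀ i, m ≤ α i := by
  simp [minPart, Fin.forall_fin_succ]

theorem maxPart_comp (α : Fin 3 → ℕ) (w : Equiv.Perm (Fin 3)) :
    maxPart (α ∘ w) = maxPart α := by
  refine le_antisymm (maxPart_le_iff.2 fun i => le_maxPart α _) (maxPart_le_iff.2 fun i => ?_)
  simpa using le_maxPart (α ∘ w) (w.symm i)

theorem minPart_comp (α : Fin 3 → ℕ) (w : Equiv.Perm (Fin 3)) :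
    minPart (α ∘ w) = minPart α := by
  refine le_antisymm (le_minPart_iff.2 fun i => ?_) (le_minPart_iff.2 fun i => minPart_le α _)
  simpa using minPart_le (α ∘ w) (w.symm i)

theorem above_swap {α : Fin 3 → ℕ} {i j : Fin 3} (hij : i < j) (h : α j < α i) :
    Above α (α ∘ Equiv.swap i j) := by
  rw [above_iff, maxPart_comp, minPart_comp, comp_swap_eq_replace]
  have hc : (i = 0 ∧ j = 1) ∨ (i = 0 ∧ j = 2) ∨ (i = 1 ∧ j = 2) := by omega
  rcases hc with ⟨rfl, rfl⟩ | ⟨rfl, rfl⟩ | ⟨rfl, rfl⟩ <;>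
    simp [replace] <;> omega

/-- Moving two entries strictly towards each other with the same sum lowers the sorted partition. -/
theorem above_replace {α : Fin 3 → ℕ} {i j : Fin 3} (hij : i ≠ j) {a b : ℕ}
    (h : a + b = α i + α j) (h1 : min (α i) (α j) < a) (h2 : a < max (α i) (α j)) :
    Above α (replace α i j a b) := by
  have hsum : ∑ t, replace α i j a b t = ∑ t, α t := by
    have hc : (i = 0 ∧ j = 1) ∨ (i = 0 ∧ j = 2) ∨ (i = 1 ∧ j = 2) ∨
        (i = 1 ∧ j = 0) ∨ (i = 2 ∧ j = 0) ∨ (i = 2 ∧ j = 1) := by omega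
    rw [Fin.sum_univ_three, Fin.sum_univ_three]
    rcases hc with ⟨rfl, rfl⟩ | ⟨rfl, rfl⟩ | ⟨rfl, rfl⟩ | ⟨rfl, rfl⟩ | ⟨rfl, rfl⟩ | ⟨rfl, rfl⟩ <;>
      simp only [replace, Fin.reduceEq, if_true, if_false] <;> omega
  rw [Fin.sum_univ_three, Fin.sum_univ_three] at hsum
  have hM : max (α i) (α j) ≤ maxPart α := max_le (le_maxPart α i) (le_maxPart α j)
  have hm : minPart α ≤ min (α i) (α j) := le_min (minPart_le α i) (minPart_le α j)
  have hb1 : min (α i) (α j) < b := by omega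
  have hb2 : b < max (α i) (α j) := by omega
  rw [above_iff]
  refine ⟨hsum.symm, Or.inl ⟨maxPart_le_iff.2 fun t => ?_, le_minPart_iff.2 fun t => ?_, ?_⟩⟩
  · simp only [replace]
    have := le_maxPart α t
    split_ifs <;> omega
  · simp only [replace]
    have := minPart_le α t
    split_ifs <;> omega
  -- If the third entry is at least the larger of the two, the smaller one was the minimum and the
  -- minimum rises. Otherwise the maximum drops.
  · by_cases hex : ∃ t, t ≠ i ∧ t ≠ j ∧ max (α i) (α j) ≤ α t
    · right
      obtain ⟨t, hti, htj, ht⟩ := hex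
      refine hm.trans_lt (le_minPart_iff.2 fun s => ?_)
      simp only [replace]
      split_ifs with hs1 hs2
      · omega
      · omega
      · have : s = t := by omega
        subst this
        omega
    · left
      push Not at hex
      have hle : maxPart (replace α i j a b) ≤ max (α i) (α j) - 1 := by
        refine maxPart_le_iff.2 fun s => ?_
        have := hex s
        simp only [replace]
        split_ifs with hs1 hs2
        · omega
        · omega
        · have := hex s hs1 hs2
          omega
      omega

/-! ### Commutation of the Cherednik operators -/

/-- The operator `f ↦ D_i (x_i f)`. -/
def dunklX (κ : ℝ) (i : Fin N) (f : MvPolynomial (Fin N) ℝ) : MvPolynomial (Fin N) ℝ :=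
  dunklA κ i (X i * f)

theorem cherednikA_apply (κ : ℝ) (i : Fin N) (f : MvPolynomial (Fin N) ℝ) :
    cherednikA κ i f
      = dunklX κ i f - κ • ∑ j ∈ Finset.Iio i, rename (Equiv.swap j i) f := by
  simp [cherednikA, dunklX, reflPoly_rootA]

theorem dunklX_sub (κ : ℝ) (i : Fin N) (f g : MvPolynomial (Fin N) ℝ) :
    dunklX κ i (f - g) = dunklX κ i f - dunklX κ i g := by
  rw [dunklX, mul_sub, map_sub, dunklX, dunklX]

theorem dunklX_smul (κ : ℝ) (i : Fin N) (c : ℝ) (f : MvPolynomial (Fin N) ℝ) :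
    dunklX κ i (c • f) = c • dunklX κ i f := by
  rw [dunklX, mul_smul_comm, map_smul, dunklX]

theorem dunklA_comm (κ : ℝ) (i j : Fin N) (f : MvPolynomial (Fin N) ℝ) :
    dunklA κ i (dunklA κ j f) = dunklA κ j (dunklA κ i f) := by
  rw [dunklA_eq, dunklA_eq]
  exact dunkl_comm (reflStable_rootsA _) _ _ f

theorem dunklA_X_mul (κ : ℝ) {i j : Fin N} (h : i ≠ j) (f : MvPolynomial (Fin N) ℝ) :
    dunklA κ i (X j * f) = X j * dunklA κ i f - κ • rename (Equiv.swap i j) f := by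
  have hl : ∀ l, divDiff (rootA i l) (X j * f) = X j * divDiff (rootA i l) f
      - if l = j then rename (Equiv.swap i j) f else 0 := by
    intro l
    rw [← linForm_single j, divDiff_linForm_mul, coroot_rootA, rootA_dot, reflPoly_rootA]
    by_cases hlj : l = j
    · subst hlj
      simp [h, sub_eq_add_neg]
    · simp [h, hlj]
  have hp : pderiv i (X j * f) = X j * pderiv i f := by
    rw [Derivation.leibniz, pderiv_X_of_ne (Ne.symm h)]
    simp
  rw [dunklA_apply, dunklA_apply, hp]
  simp only [hl, Finset.sum_sub_distrib, Finset.sum_ite_eq', Finset.mem_univ, if_true,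
    ← Finset.mul_sum, mul_add, mul_smul_comm, smul_sub]
  abel

theorem rename_pderiv (w : Equiv.Perm (Fin N)) (i : Fin N) (f : MvPolynomial (Fin N) ℝ) :
    rename w (pderiv i f) = pderiv (w i) (rename w f) := by
  rw [pderiv_rename w.injective]

theorem rename_divDiff_rootA (w : Equiv.Perm (Fin N)) (i j : Fin N)
    (f : MvPolynomial (Fin N) ℝ) :
    rename w (divDiff (rootA i j) f) = divDiff (rootA (w i) (w j)) (rename w f) := by
  by_cases h : i = j
  · subst h
    simp [rootA_self]
  refine (divDiff_eq_of_mul (rootA_ne_zero (w.injective.ne h)) ?_).symm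
  have h1 := congrArg (rename w) (linForm_mul_divDiff (rootA i j) f)
  rw [map_mul, linForm_rootA, map_sub, map_sub, rename_X, rename_X, reflPoly_rootA,
    rename_rename] at h1
  rw [linForm_rootA, h1, reflPoly_rootA, rename_rename]
  congr 2
  ext t
  simp [Equiv.swap_apply_def, apply_ite w, w.injective.eq_iff]

theorem rename_dunklX (κ : ℝ) (w : Equiv.Perm (Fin N)) (i : Fin N)
    (f : MvPolynomial (Fin N) ℝ) :
    rename w (dunklX κ i f) = dunklX κ (w i) (rename w f) := by
  rw [dunklX, dunklX, dunklA_apply, dunklA_apply, map_add, map_smul, map_sum, rename_pderiv,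
    ← Equiv.sum_comp w fun j => divDiff (rootA (w i) j) (X (w i) * rename w f)]
  simp only [rename_divDiff_rootA, map_mul, rename_X]

/-- Moving `X i` to the right through `dunklA κ j` gives $D_ix_iD_jx_j=D_iD_jx_ix_j+\kappa
D_ix_i(i,j)$, and the first term is symmetric in `i` and `j`. -/
theorem dunklX_dunklX_sub (κ : ℝ) {i j : Fin N} (h : i ≠ j) (f : MvPolynomial (Fin N) ℝ) :
    dunklX κ i (dunklX κ j f) - dunklX κ j (dunklX κ i f)
      = κ • (dunklX κ i (rename (Equiv.swap i j) f) - dunklX κ j (rename (Equiv.swap i j) f)) := by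
  have key : ∀ {i j : Fin N}, i ≠ j → dunklX κ i (dunklX κ j f)
      = dunklA κ i (dunklA κ j (X i * (X j * f))) + κ • dunklX κ i (rename (Equiv.swap i j) f) := by
    intro i j h
    have h1 := dunklA_X_mul κ (Ne.symm h) (X j * f)
    rw [map_mul (rename (Equiv.swap j i)), rename_X, Equiv.swap_apply_left] at h1
    have h2 : X i * dunklA κ j (X j * f) = dunklA κ j (X i * (X j * f))
        + κ • (X i * rename (Equiv.swap i j) f) := by
      rw [h1, Equiv.swap_comm]
      abel
    rw [dunklX, dunklX, h2, map_add, map_smul, dunklX]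
  rw [key h, key (Ne.symm h), dunklA_comm κ j i, mul_left_comm (X j), Equiv.swap_comm j i]
  module

theorem rename_swap_swap (i j : Fin N) (f : MvPolynomial (Fin N) ℝ) :
    rename (Equiv.swap i j) (rename (Equiv.swap i j) f) = f := by
  rw [rename_rename]
  convert rename_id_apply f
  ext t
  simp

theorem Iio_three : Finset.Iio (0 : Fin 3) = ∅ ∧ Finset.Iio (1 : Fin 3) = {0} ∧
    Finset.Iio (2 : Fin 3) = {0, 1} := by
  decide

theorem cherednikA_zero_apply (κ : ℝ) (f : MvPolynomial (Fin 3) ℝ) :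
    cherednikA κ 0 f = dunklX κ 0 f := by
  rw [cherednikA_apply, Iio_three.1, Finset.sum_empty, smul_zero, sub_zero]

theorem cherednikA_one_apply (κ : ℝ) (f : MvPolynomial (Fin 3) ℝ) :
    cherednikA κ 1 f = dunklX κ 1 f - κ • rename (Equiv.swap 0 1) f := by
  rw [cherednikA_apply, Iio_three.2.1, Finset.sum_singleton]

theorem cherednikA_two_apply (κ : ℝ) (f : MvPolynomial (Fin 3) ℝ) :
    cherednikA κ 2 f = dunklX κ 2 f - κ • rename (Equiv.swap 0 2) f
      - κ • rename (Equiv.swap 1 2) f := by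
  rw [cherednikA_apply, Iio_three.2.2, Finset.sum_pair (by decide)]
  module

theorem rename_swap_dunklX (κ : ℝ) (i j l : Fin N) (f : MvPolynomial (Fin N) ℝ) :
    rename (Equiv.swap i j) (dunklX κ l f)
      = dunklX κ (Equiv.swap i j l) (rename (Equiv.swap i j) f) := rename_dunklX κ _ l f

theorem swap_apply_three : (Equiv.swap (0 : Fin 3) 1 2 = 2) ∧ (Equiv.swap (0 : Fin 3) 2 1 = 1) ∧
    (Equiv.swap (1 : Fin 3) 2 0 = 0) := by
  decide

/-- The subtracted transpositions are chosen to absorb the commutators of the operators $D_ix_i$.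
For the last pair the products of transpositions `hs1`, `hs2` are also compared. -/
theorem cherednikA_comm (κ : ℝ) (i j : Fin 3) (f : MvPolynomial (Fin 3) ℝ) :
    cherednikA κ i (cherednikA κ j f) = cherednikA κ j (cherednikA κ i f) := by
  have h01 := dunklX_dunklX_sub κ (show (0 : Fin 3) ≠ 1 by decide) f
  have h02 := dunklX_dunklX_sub κ (show (0 : Fin 3) ≠ 2 by decide) f
  have h12 := dunklX_dunklX_sub κ (show (1 : Fin 3) ≠ 2 by decide) f
  rw [sub_eq_iff_eq_add] at h01 h02 h12
  have hs1 : rename (Equiv.swap (0 : Fin 3) 1) (rename (Equiv.swap 0 2) f)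
      = rename (Equiv.swap 1 2) (rename (Equiv.swap 0 1) f) := by
    rw [rename_rename, rename_rename]
    congr 2
    decide
  have hs2 : rename (Equiv.swap (0 : Fin 3) 1) (rename (Equiv.swap 1 2) f)
      = rename (Equiv.swap 0 2) (rename (Equiv.swap 0 1) f) := by
    rw [rename_rename, rename_rename]
    congr 2
    decide
  obtain ⟨e1, e2, e3⟩ := swap_apply_three
  have c01 : cherednikA κ 0 (cherednikA κ 1 f) = cherednikA κ 1 (cherednikA κ 0 f) := by
    simp only [cherednikA_zero_apply, cherednikA_one_apply, dunklX_sub, dunklX_smul,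
      rename_swap_dunklX, h01, Equiv.swap_apply_left]
    module
  have c02 : cherednikA κ 0 (cherednikA κ 2 f) = cherednikA κ 2 (cherednikA κ 0 f) := by
    simp only [cherednikA_zero_apply, cherednikA_two_apply, dunklX_sub, dunklX_smul,
      rename_swap_dunklX, h02, Equiv.swap_apply_left, e3]
    module
  have c12 : cherednikA κ 1 (cherednikA κ 2 f) = cherednikA κ 2 (cherednikA κ 1 f) := by
    simp only [cherednikA_one_apply, cherednikA_two_apply,
      rename_swap_dunklX, h12, Equiv.swap_apply_left, e1, e2, map_sub, map_smul, hs1, hs2]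
    module
  have hi : ∀ t : Fin 3, t = 0 ∨ t = 1 ∨ t = 2 := by decide
  rcases hi i with rfl | rfl | rfl <;> rcases hi j with rfl | rfl | rfl
  exacts [rfl, c01, c02, c01.symm, rfl, c12, c02.symm, c12.symm, rfl]

/-! ### Triangularity -/

/-- The span of the monomials strictly below `x^α`. -/
def low (α : Fin 3 → ℕ) : Submodule ℝ (MvPolynomial (Fin 3) ℝ) where
  carrier := {f | ∀ β, coeffAt β f ≠ 0 → Above α β}
  add_mem' {f g} hf hg β h := by
    by_cases h1 : coeffAt β f = 0
    · refine hg β fun h2 => h ?_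
      rw [coeffAt_add, h1, h2, add_zero]
    · exact hf β h1
  zero_mem' β h := absurd (coeffAt_zero β) h
  smul_mem' c f hf β h := by
    refine hf β fun h2 => h ?_
    rw [coeffAt_smul, h2, mul_zero]

theorem mono_mem_low {α β : Fin 3 → ℕ} (h : Above α β) : mono β ∈ low α := by
  intro γ hγ
  rw [coeffAt_mono] at hγ
  by_cases hb : β = γ
  · rwa [← hb]
  · exact absurd (if_neg hb) hγ

theorem low_le_low {α β : Fin 3 → ℕ} (h : Above α β) : low β ≤ low α :=
  fun _ hf γ hγ => h.trans (hf γ hγ)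

/-- A measure that decreases along the order on compositions. -/
def height (α : Fin 3 → ℕ) : ℕ :=
  (maxPart α - minPart α) * (3 * (α 0 + α 1 + α 2) + 1) + (2 * α 0 + α 1)

/-- If the sorted partition drops, so does max minus min, and the weight $3S+1$ for the total $S$
exceeds the tie-breaker $2\alpha_0+\alpha_1\le2S$. Among rearrangements the tie-breaker, a sum of
partial sums, drops. -/
theorem Above.height_lt {α β : Fin 3 → ℕ} (h : Above α β) : height β < height α := by
  rw [above_iff] at h
  obtain ⟨hs, h | ⟨h1, h2, h3, h4, h5⟩⟩ := h
  · rw [height, height, hs]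
    have h0 : minPart β ≤ maxPart β := (minPart_le β 0).trans (le_maxPart β 0)
    have h1 : maxPart β - minPart β + 1 ≤ maxPart α - minPart α := by omega
    have := Nat.mul_le_mul_right (3 * (β 0 + β 1 + β 2) + 1) h1
    rw [add_mul] at this
    omega
  · rw [height, height, hs, h1, h2]
    omega

/-- `U` is triangular with respect to the monomials, with diagonal entries `d`. -/
def Triangular (U : Module.End ℝ (MvPolynomial (Fin 3) ℝ)) (d : (Fin 3 → ℕ) → ℝ) : Prop :=
  ∀ α, U (mono α) - d α • mono α ∈ low α

section Triangular

variable {U V : Module.End ℝ (MvPolynomial (Fin 3) ℝ)} {d e : (Fin 3 → ℕ) → ℝ}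

theorem Triangular.map_low (h : Triangular U d) {α : Fin 3 → ℕ} {f : MvPolynomial (Fin 3) ℝ}
    (hf : f ∈ low α) : U f ∈ low α := by
  rw [eq_sum_mono f, map_sum]
  refine Submodule.sum_mem _ fun m hm => ?_
  rw [map_smul]
  refine Submodule.smul_mem _ _ ?_
  have hm' : Above α m := hf m (by rw [← coeff_eq_coeffAt]; exact mem_support_iff.1 hm)
  have h1 := Submodule.add_mem _ (low_le_low hm' (h m))
    (Submodule.smul_mem _ (d m) (mono_mem_low hm'))
  rwa [sub_add_cancel] at h1

theorem Triangular.sub_scalar (h : Triangular U d) (c : ℝ) :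
    Triangular (U - c • LinearMap.id) fun α => d α - c := by
  intro α
  convert h α using 1
  simp only [LinearMap.sub_apply, LinearMap.smul_apply, LinearMap.id_apply]
  module

theorem Triangular.add (hU : Triangular U d) (hV : Triangular V e) :
    Triangular (U + V) fun α => d α + e α := by
  intro α
  convert Submodule.add_mem _ (hU α) (hV α) using 1
  rw [LinearMap.add_apply]
  module

theorem Triangular.mul (hU : Triangular U d) (hV : Triangular V e) :
    Triangular (U * V) fun α => d α * e α := by
  intro α
  convert Submodule.add_mem _ (hU.map_low (hV α)) (Submodule.smul_mem _ (e α) (hU α)) using 1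
  rw [Module.End.mul_apply, map_sub, map_smul]
  module

/-- If no monomial of `f` lies above `β`, only the diagonal entry can contribute to the coefficient
at `β`. -/
theorem Triangular.coeffAt_of_forall (h : Triangular U d) {f : MvPolynomial (Fin 3) ℝ}
    {β : Fin 3 → ℕ} (hβ : ∀ γ, coeffAt γ f ≠ 0 → ¬Above γ β) :
    coeffAt β (U f) = d β * coeffAt β f := by
  have key : ∀ m ∈ f.support, coeffAt β (U (coeffAt (⇑m) f • mono m))
      = d β * coeffAt β (coeffAt (⇑m) f • mono m) := by
    intro m hm
    have hm' : ¬Above m β := hβ m (by rw [← coeff_eq_coeffAt]; exact mem_support_iff.1 hm)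
    have h0 : coeffAt β (U (mono m) - d m • mono m) = 0 := by
      by_contra hc
      exact hm' (h m β hc)
    rw [coeffAt_sub, coeffAt_smul, sub_eq_zero] at h0
    rw [map_smul, coeffAt_smul, coeffAt_smul, h0, coeffAt_mono]
    split_ifs with he
    · rw [he]; ring
    · ring
  conv_lhs => rw [eq_sum_mono f, map_sum, coeffAt_sum, Finset.sum_congr rfl key]
  conv_rhs => rw [eq_sum_mono f, coeffAt_sum, Finset.mul_sum]

theorem exists_maximal_coeffAt {f : MvPolynomial (Fin 3) ℝ} (hf : f ≠ 0) :
    ∃ β, coeffAt β f ≠ 0 ∧ ∀ γ, coeffAt γ f ≠ 0 → ¬Above γ β := by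
  obtain ⟨β, hβ, h⟩ := Set.exists_max_image _ height (finite_coeffAt f) (exists_coeffAt_ne_zero hf)
  exact ⟨β, hβ, fun γ hγ ha => (h γ hγ).not_gt ha.height_lt⟩

theorem Triangular.eq_zero_of_mem_low (h : Triangular U d) {α : Fin 3 → ℕ}
    (hd : ∀ β, Above α β → d β ≠ 0) {f : MvPolynomial (Fin 3) ℝ} (hf : f ∈ low α)
    (hU : U f = 0) : f = 0 := by
  by_contra h0
  obtain ⟨β, hβ, hm⟩ := exists_maximal_coeffAt h0
  have h1 := h.coeffAt_of_forall hm
  rw [hU, coeffAt_zero] at h1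
  exact mul_ne_zero (hd β (hf β hβ)) hβ h1.symm

/-- Back-substitution: each monomial is inverted on the diagonal and the remainder, of smaller
height, by induction. -/
theorem Triangular.exists_preimage (h : Triangular U d) (n : ℕ) :
    ∀ α : Fin 3 → ℕ, height α = n → (∀ β, Above α β → d β ≠ 0) → ∀ g ∈ low α,
      ∃ f ∈ low α, U f = g := by
  induction n using Nat.strong_induction_on with
  | _ n ih =>
    intro α hα hd g hg
    have hm : ∀ m ∈ g.support, ∃ f ∈ low α, U f = mono m := by
      intro m hm
      have hm' : Above α m := hg m (by rw [← coeff_eq_coeffAt]; exact mem_support_iff.1 hm)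
      obtain ⟨f, hf, hUf⟩ := ih (height m) (hα ▸ hm'.height_lt) m rfl
        (fun β hβ => hd β (hm'.trans hβ)) _ (h m)
      refine ⟨(d m)⁻¹ • (mono m - f), Submodule.smul_mem _ _
        (Submodule.sub_mem _ (mono_mem_low hm') (low_le_low hm' hf)), ?_⟩
      rw [map_smul, map_sub, hUf, sub_sub_cancel, smul_smul, inv_mul_cancel₀ (hd m hm'), one_smul]
    choose! F hF hUF using hm
    refine ⟨∑ m ∈ g.support, coeffAt (⇑m) g • F m,
      Submodule.sum_mem _ fun m hm => Submodule.smul_mem _ _ (hF m hm), ?_⟩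
    conv_rhs => rw [eq_sum_mono g]
    rw [map_sum]
    exact Finset.sum_congr rfl fun m hm => by rw [map_smul, hUF m hm]

end Triangular

/-- The swapped monomial for `j < i` is the one that the transposition terms of `cherednikA` remove,
and `mono α` is the contribution to the diagonal; all the rest is strictly lower. -/
theorem divDiff_term_mem_low {i j : Fin 3} (h : i ≠ j) (α : Fin 3 → ℕ) :
    divDiff (rootA i j) (X i * mono α) - (if j < i then mono (α ∘ Equiv.swap j i) else 0)
      - (if α j < α i ∨ (α j = α i ∧ i < j) then mono α else 0) ∈ low α := by
  rcases lt_trichotomy (α i) (α j) with h1 | h1 | h1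
  · rw [divDiff_X_mul_mono_of_lt h h1, if_neg (by omega : ¬(α j < α i ∨ (α j = α i ∧ i < j))),
      sub_zero]
    refine Submodule.sub_mem _ (Submodule.neg_mem _ (Submodule.sum_mem _ fun l hl => ?_)) ?_
    · have := Finset.mem_range.1 hl
      exact mono_mem_low (above_replace h (by omega) (by omega) (by omega))
    · split_ifs with hji
      · exact mono_mem_low (above_swap hji h1)
      · exact Submodule.zero_mem _
  -- For equal entries the quotient is the single monomial `mono α`, which counts as the swap when
  -- `j < i` and as a diagonal term when `i < j`.
  · rw [divDiff_X_mul_mono_of_le h h1.ge, comp_swap_eq_replace, ← h1, Nat.sub_self]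
    have h2 : replace α j i (α i) (α i) = α := by
      conv_rhs => rw [← replace_self α j i, ← h1]
    have h3 : replace α i j (α i) (α i) = α := by
      conv_rhs => rw [← replace_self α i j, ← h1]
    rw [h2]
    have h4 : ∑ l ∈ Finset.range (0 + 1), mono (replace α i j (α i - l) (α i + l)) = mono α := by
      simp [h3]
    rw [h4]
    rcases lt_or_gt_of_ne h with h5 | h5
    · rw [if_neg h5.not_gt, if_pos (Or.inr ⟨rfl, h5⟩), sub_zero, sub_self]
      exact Submodule.zero_mem _
    · rw [if_pos h5, if_neg (by omega : ¬(α i < α i ∨ (α i = α i ∧ i < j))), sub_self, sub_zero]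
      exact Submodule.zero_mem _
  · rw [divDiff_X_mul_mono_of_le h h1.le, if_pos (Or.inl h1), Finset.sum_range_succ',
      Nat.sub_zero, add_zero, replace_self, sub_right_comm, add_sub_cancel_right]
    obtain ⟨n, hn⟩ := Nat.exists_eq_add_of_lt h1
    rw [show α i - α j = n + 1 by omega, Finset.sum_range_succ, add_sub_assoc]
    refine Submodule.add_mem _ (Submodule.sum_mem _ fun l hl => ?_) ?_
    · have := Finset.mem_range.1 hl
      exact mono_mem_low (above_replace h (by omega) (by omega) (by omega))
    · rw [Equiv.swap_comm, comp_swap_eq_replace, show α i - (n + 1) = α j by omega,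
        show α j + (n + 1) = α i by omega, ← comp_swap_eq_replace]
      split_ifs with hji
      · rw [sub_self]; exact Submodule.zero_mem _
      · rw [sub_zero]
        exact mono_mem_low (above_swap (by omega) h1)

/-- The diagonal contributions of the divided differences add up to the coefficient of `κ` in `xi`.
-/
theorem sub_compRank_eq_sum (α : Fin N → ℕ) (i : Fin N) :
    (N : ℝ) - compRank α i
      = ∑ j ∈ Finset.univ.erase i, if α j < α i ∨ (α j = α i ∧ i < j) then (1 : ℝ) else 0 := by
  have h1 : (N : ℝ) = ∑ j : Fin N, (1 : ℝ) := by simp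
  rw [compRank_eq_card, h1, Finset.card_filter, Nat.cast_sum, ← Finset.sum_sub_distrib,
    ← Finset.add_sum_erase _ _ (Finset.mem_univ i)]
  have h0 : ∀ j, ((1 : ℝ) - ((if α i < α j ∨ (j ≤ i ∧ α j = α i) then 1 else 0 : ℕ) : ℝ))
      = if α j < α i ∨ (α j = α i ∧ i < j) then (1 : ℝ) else 0 := by
    intro j
    by_cases hc : α i < α j ∨ (j ≤ i ∧ α j = α i)
    · rw [if_pos hc, if_neg (by omega)]
      simp
    · rw [if_neg hc, if_pos (by omega)]
      simp
  simp only [h0]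
  simp

theorem triangular_cherednikA (κ : ℝ) (i : Fin 3) :
    Triangular (cherednikA κ i) fun α => xi κ α i := by
  intro α
  have h1 := Submodule.smul_mem _ κ (Submodule.sum_mem (low α) fun j (hj : j ∈ Finset.univ.erase i) =>
    divDiff_term_mem_low (Ne.symm (Finset.ne_of_mem_erase hj)) α)
  convert h1 using 1
  have hp : pderiv i (X i * mono α) = ((α i : ℝ) + 1) • mono α := by
    have hm : Finsupp.equivFunOnFinite.symm (Function.update α i (α i + 1)) - Finsupp.single i 1
        = Finsupp.equivFunOnFinite.symm α := by
      ext t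
      by_cases h : t = i
      · subst h; simp
      · simp [h]
    rw [X_mul_mono, mono, pderiv_monomial, mono, smul_monomial, hm]
    simp
  have hI : ∑ j ∈ Finset.univ.erase i, (if j < i then mono (α ∘ Equiv.swap j i) else 0)
      = ∑ j ∈ Finset.Iio i, mono (α ∘ Equiv.swap j i) := by
    rw [← Finset.sum_filter]
    congr 1
    ext j
    simp only [Finset.mem_filter, Finset.mem_erase, Finset.mem_univ, Finset.mem_Iio, and_true]
    exact ⟨fun h => h.2, fun h => ⟨h.ne, h⟩⟩
  have hx : xi κ α i = κ * ((3 : ℝ) - compRank α i) + (α i + 1) := by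
    rw [xi]
    push_cast
    ring
  have hc := sub_compRank_eq_sum α i
  push_cast at hc
  beta_reduce
  rw [cherednikA_apply, dunklX, dunklA, LinearMap.add_apply, LinearMap.smul_apply,
    LinearMap.sum_apply, Finset.sum_sub_distrib, Finset.sum_sub_distrib, hI, hx, hc]
  simp only [rename_swap_mono, add_smul, mul_smul, Finset.sum_smul, ite_smul, one_smul, zero_smul]
  rw [Derivation.coeFn_coe, hp]
  module

/-- The eigenvalues can be read off at a maximal monomial of the joint eigenfunction. -/
theorem exists_eq_xi {κ : ℝ} {g : MvPolynomial (Fin 3) ℝ} (hg : g ≠ 0) {χ : Fin 3 → ℝ}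
    (h : ∀ i, cherednikA κ i g = χ i • g) : ∃ β, coeffAt β g ≠ 0 ∧ ∀ i, χ i = xi κ β i := by
  obtain ⟨β, hβ, hm⟩ := exists_maximal_coeffAt hg
  refine ⟨β, hβ, fun i => ?_⟩
  have h1 := (triangular_cherednikA κ i).coeffAt_of_forall hm
  rw [h, coeffAt_smul] at h1
  exact mul_right_cancel₀ hβ h1

/-- The difference has the eigenvalues of `α` but no `α`-coefficient. If it were nonzero, its
maximal monomial would have those eigenvalues, hence be `α`. -/
theorem IsNSJack.eq_smul {κ : ℝ} (hκ : 0 ≤ κ) {α : Fin 3 → ℕ} {z g : MvPolynomial (Fin 3) ℝ}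
    (hz : IsNSJack κ α z) (h : ∀ i, cherednikA κ i g = xi κ α i • g) : g = coeffAt α g • z := by
  rw [← sub_eq_zero]
  by_contra h0
  obtain ⟨β, hβ, hx⟩ := exists_eq_xi (κ := κ) (χ := xi κ α) h0 fun i => by
    rw [map_sub, map_smul, h, hz.1, smul_sub, smul_comm]
  have := xi_injective hκ hx
  subst this
  rw [coeffAt_sub, coeffAt_smul, hz.2.1, mul_one, sub_self] at hβ
  exact hβ rfl

/-- With $Q=\sum(\mathcal U_i-\xi_i(\alpha))^2$, solve $Qz=0$ for $z=x^\alpha-h$ with $h$ strictly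
lower. Each $(\mathcal U_i-\xi_i(\alpha))z$ is strictly lower and, by commutativity, killed by $Q$,
so it vanishes. -/
theorem exists_isNSJack {κ : ℝ} (hκ : 0 ≤ κ) (α : Fin 3 → ℕ) : ∃ z, IsNSJack κ α z := by
  let T : Fin 3 → Module.End ℝ (MvPolynomial (Fin 3) ℝ) := fun i =>
    cherednikA κ i - xi κ α i • LinearMap.id
  have hT : ∀ i, Triangular (T i) fun β => xi κ β i - xi κ α i := fun i =>
    (triangular_cherednikA κ i).sub_scalar _
  have hcomm : ∀ i j f, T i (T j f) = T j (T i f) := by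
    intro i j f
    simp only [T, LinearMap.sub_apply, LinearMap.smul_apply, LinearMap.id_apply, map_sub, map_smul,
      cherednikA_comm κ i j]
    module
  -- A diagonal entry of this sum of squares vanishes only if all three eigenvalues agree, so it is
  -- nonzero strictly below `α`.
  let Q := T 0 * T 0 + T 1 * T 1 + T 2 * T 2
  have hQ := (((hT 0).mul (hT 0)).add ((hT 1).mul (hT 1))).add ((hT 2).mul (hT 2))
  have hd : ∀ β, Above α β → (xi κ β 0 - xi κ α 0) * (xi κ β 0 - xi κ α 0)
      + (xi κ β 1 - xi κ α 1) * (xi κ β 1 - xi κ α 1)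
      + (xi κ β 2 - xi κ α 2) * (xi κ β 2 - xi κ α 2) ≠ 0 := by
    intro β hβ h0
    have h1 := mul_self_nonneg (xi κ β 0 - xi κ α 0)
    have h2 := mul_self_nonneg (xi κ β 1 - xi κ α 1)
    have h3 := mul_self_nonneg (xi κ β 2 - xi κ α 2)
    have e0 := mul_self_eq_zero.1 (show (xi κ β 0 - xi κ α 0) * (xi κ β 0 - xi κ α 0) = 0 by linarith)
    have e1 := mul_self_eq_zero.1 (show (xi κ β 1 - xi κ α 1) * (xi κ β 1 - xi κ α 1) = 0 by linarith)
    have e2 := mul_self_eq_zero.1 (show (xi κ β 2 - xi κ α 2) * (xi κ β 2 - xi κ α 2) = 0 by linarith)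
    have : β = α := xi_injective hκ fun i => by
      fin_cases i
      · exact sub_eq_zero.1 e0
      · exact sub_eq_zero.1 e1
      · exact sub_eq_zero.1 e2
    subst this
    exact Above.irrefl _ hβ
  have hTα : ∀ i, T i (mono α) ∈ low α := fun i => by
    simpa using hT i α
  have hQα : Q (mono α) ∈ low α := by
    have := hQ α
    simp only [sub_self, mul_zero, add_zero, zero_smul, sub_zero] at this
    exact this
  obtain ⟨h, hl, hh⟩ := hQ.exists_preimage _ α rfl hd _ hQα
  have hz0 : Q (mono α - h) = 0 := by rw [map_sub, sub_eq_zero]; exact hh.symm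
  refine ⟨mono α - h, fun i => ?_, ?_, fun β hβ => ?_⟩
  · have hg : T i (mono α - h) ∈ low α := by
      rw [map_sub]
      exact Submodule.sub_mem _ (hTα i) ((hT i).map_low hl)
    have hQg : Q (T i (mono α - h)) = 0 := by
      have : Q (T i (mono α - h)) = T i (Q (mono α - h)) := by
        simp only [Q, LinearMap.add_apply, Module.End.mul_apply]
        rw [map_add, map_add]
        simp only [hcomm _ i]
      rw [this, hz0, map_zero]
    have := hQ.eq_zero_of_mem_low hd hg hQg
    simpa [T, sub_eq_zero] using this
  · have : coeffAt α h = 0 := by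
      by_contra hc
      exact Above.irrefl _ (hl α hc)
    rw [coeffAt_sub, coeffAt_mono, if_pos rfl, this, sub_zero]
  · rw [coeffAt_sub, coeffAt_mono] at hβ
    by_cases hαβ : α = β
    · exact Or.inl hαβ.symm
    · rw [if_neg hαβ, zero_sub, neg_ne_zero] at hβ
      exact Or.inr (hl β hβ)

theorem existsUnique_isNSJack {κ : ℝ} (hκ : 0 ≤ κ) (α : Fin 3 → ℕ) : ∃! z, IsNSJack κ α z := by
  obtain ⟨z, hz⟩ := exists_isNSJack hκ α
  refine ⟨z, hz, fun w hw => ?_⟩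
  have := hz.eq_smul hκ hw.1
  rwa [hw.2.1, one_smul] at this

theorem isNSJack_nsJack {κ : ℝ} (hκ : 0 ≤ κ) (α : Fin 3 → ℕ) : IsNSJack κ α (nsJack κ α) :=
  Classical.epsilon_spec (exists_isNSJack hκ α)

/-! ### Adjacent transpositions and nonsymmetric Jack polynomials -/

/-- `j = i + 1`. -/
def Adjacent (i j : Fin 3) : Prop := (i = 0 ∧ j = 1) ∨ (i = 1 ∧ j = 2)

/-- With the two lemmas that follow, these are the relations of the degenerate affine Hecke algebra.
-/
theorem rename_cherednikA_left (κ : ℝ) {i j : Fin 3} (h : Adjacent i j)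
    (f : MvPolynomial (Fin 3) ℝ) :
    rename (Equiv.swap i j) (cherednikA κ i f)
      = cherednikA κ j (rename (Equiv.swap i j) f) + κ • f := by
  obtain ⟨e1, e2, e3⟩ := swap_apply_three
  rcases h with ⟨rfl, rfl⟩ | ⟨rfl, rfl⟩
  · simp only [cherednikA_zero_apply, cherednikA_one_apply, rename_swap_dunklX,
      Equiv.swap_apply_left, rename_swap_swap]
    module
  · have hs : rename (Equiv.swap (1 : Fin 3) 2) (rename (Equiv.swap 0 1) f)
        = rename (Equiv.swap 0 2) (rename (Equiv.swap 1 2) f) := by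
      rw [rename_rename, rename_rename]
      congr 2
      decide
    simp only [cherednikA_one_apply, cherednikA_two_apply, rename_swap_dunklX, map_sub, map_smul,
      Equiv.swap_apply_left, rename_swap_swap, hs]
    module

theorem rename_cherednikA_right (κ : ℝ) {i j : Fin 3} (h : Adjacent i j)
    (f : MvPolynomial (Fin 3) ℝ) :
    rename (Equiv.swap i j) (cherednikA κ j f)
      = cherednikA κ i (rename (Equiv.swap i j) f) - κ • f := by
  have h1 := congrArg (rename (Equiv.swap i j))
    (rename_cherednikA_left κ h (rename (Equiv.swap i j) f))
  rw [rename_swap_swap, map_add, rename_swap_swap, map_smul, rename_swap_swap] at h1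
  rw [h1, add_sub_cancel_right]

theorem rename_cherednikA_of_ne (κ : ℝ) {i j l : Fin 3} (h : Adjacent i j) (hi : l ≠ i)
    (hj : l ≠ j) (f : MvPolynomial (Fin 3) ℝ) :
    rename (Equiv.swap i j) (cherednikA κ l f)
      = cherednikA κ l (rename (Equiv.swap i j) f) := by
  obtain ⟨e1, e2, e3⟩ := swap_apply_three
  rcases h with ⟨rfl, rfl⟩ | ⟨rfl, rfl⟩
  · have hl : l = 2 := by omega
    subst hl
    have hs1 : rename (Equiv.swap (0 : Fin 3) 1) (rename (Equiv.swap 0 2) f)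
        = rename (Equiv.swap 1 2) (rename (Equiv.swap 0 1) f) := by
      rw [rename_rename, rename_rename]
      congr 2
      decide
    have hs2 : rename (Equiv.swap (0 : Fin 3) 1) (rename (Equiv.swap 1 2) f)
        = rename (Equiv.swap 0 2) (rename (Equiv.swap 0 1) f) := by
      rw [rename_rename, rename_rename]
      congr 2
      decide
    simp only [cherednikA_two_apply, rename_swap_dunklX, map_sub, map_smul, e1, hs1, hs2]
    module
  · have hl : l = 0 := by omega
    subst hl
    simp only [cherednikA_zero_apply, rename_swap_dunklX, e3]

/-- If `z` is a joint eigenfunction with eigenvalues `χ` and `ρ (χ_i - χ_j) = κ` then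
`s z - ρ z` is a joint eigenfunction with the eigenvalues `χ_i`, `χ_j` interchanged. -/
theorem cherednikA_rename_sub {κ ρ : ℝ} {i j : Fin 3} (h : Adjacent i j)
    {z : MvPolynomial (Fin 3) ℝ} {χ : Fin 3 → ℝ} (hz : ∀ l, cherednikA κ l z = χ l • z)
    (hρ : ρ * (χ i - χ j) = κ) (l : Fin 3) :
    cherednikA κ l (rename (Equiv.swap i j) z - ρ • z)
      = χ (Equiv.swap i j l) • (rename (Equiv.swap i j) z - ρ • z) := by
  rw [map_sub, map_smul, hz]
  by_cases hi : l = i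
  · subst hi
    have h1 := rename_cherednikA_right κ h z
    rw [hz, map_smul, eq_sub_iff_add_eq] at h1
    rw [← h1, Equiv.swap_apply_left, ← hρ]
    module
  · by_cases hj : l = j
    · subst hj
      have h1 := rename_cherednikA_left κ h z
      rw [hz, map_smul, ← sub_eq_iff_eq_add] at h1
      rw [← h1, Equiv.swap_apply_right, ← hρ]
      module
    · rw [← rename_cherednikA_of_ne κ h hi hj, hz, map_smul, Equiv.swap_apply_of_ne_of_ne hi hj]
      module

/-! ### The action of adjacent transpositions -/

theorem compRank_three (α : Fin 3 → ℕ) :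
    compRank α 0 = (if α 0 < α 1 then 1 else 0) + (if α 0 < α 2 then 1 else 0) + 1 ∧
    compRank α 1 = (if α 1 ≤ α 0 then 1 else 0) + (if α 1 < α 2 then 1 else 0) + 1 ∧
    compRank α 2 = (if α 2 ≤ α 0 then 1 else 0) + (if α 2 ≤ α 1 then 1 else 0) + 1 := by
  refine ⟨?_, ?_, ?_⟩
  · simp only [compRank_eq_card, Finset.card_filter, Fin.sum_univ_three]
    simp
    split_ifs <;> omega
  · simp only [compRank_eq_card, Finset.card_filter, Fin.sum_univ_three]
    simp
    split_ifs <;> omega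
  · simp only [compRank_eq_card, Finset.card_filter, Fin.sum_univ_three]
    simp
    split_ifs <;> omega

theorem compRank_comp_swap {α : Fin 3 → ℕ} {i j : Fin 3} (h : Adjacent i j) (hα : α j < α i)
    (l : Fin 3) : compRank (α ∘ Equiv.swap i j) l = compRank α (Equiv.swap i j l) := by
  obtain ⟨e1, e2, e3⟩ := swap_apply_three
  obtain ⟨a1, a2, a3⟩ := compRank_three α
  obtain ⟨b1, b2, b3⟩ := compRank_three (α ∘ Equiv.swap i j)
  have hl : l = 0 ∨ l = 1 ∨ l = 2 := by omega
  rcases h with ⟨rfl, rfl⟩ | ⟨rfl, rfl⟩ <;> rcases hl with rfl | rfl | rfl <;>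
    simp only [Function.comp_apply, Equiv.swap_apply_left, Equiv.swap_apply_right, e1, e3]
      at b1 b2 b3 ⊢ <;>
    simp only [a1, a2, a3, b1, b2, b3] <;> split_ifs <;> omega

theorem xi_comp_swap (κ : ℝ) {α : Fin 3 → ℕ} {i j : Fin 3} (h : Adjacent i j) (hα : α j < α i)
    (l : Fin 3) : xi κ (α ∘ Equiv.swap i j) l = xi κ α (Equiv.swap i j l) := by
  rw [xi, xi, compRank_comp_swap h hα, Function.comp_apply]

theorem xi_sub_of_eq (κ : ℝ) {α : Fin 3 → ℕ} {i j : Fin 3} (h : Adjacent i j) (hα : α i = α j) :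
    xi κ α i - xi κ α j = κ := by
  obtain ⟨a1, a2, a3⟩ := compRank_three α
  have hr : compRank α j = compRank α i + 1 := by
    rcases h with ⟨rfl, rfl⟩ | ⟨rfl, rfl⟩
    · rw [a1, a2, hα]; split_ifs <;> omega
    · rw [a2, a3, hα]; split_ifs <;> omega
  rw [xi_sub_xi, hr, hα]
  push_cast
  ring

theorem Adjacent.lt {i j : Fin 3} (h : Adjacent i j) : i < j := by
  rcases h with ⟨rfl, rfl⟩ | ⟨rfl, rfl⟩ <;> decide

theorem comp_swap_comp_swap (α : Fin N → ℕ) (i j : Fin N) :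
    (α ∘ Equiv.swap i j) ∘ Equiv.swap i j = α := by
  ext t
  simp

/-- The difference would be a joint eigenfunction with $\xi_i,\xi_j$ interchanged. -/
theorem rename_nsJack_of_eq {κ : ℝ} (hκ : 0 ≤ κ) {α : Fin 3 → ℕ} {i j : Fin 3} (h : Adjacent i j)
    (hα : α i = α j) : rename (Equiv.swap i j) (nsJack κ α) = nsJack κ α := by
  have hz := isNSJack_nsJack hκ α
  rw [← sub_eq_zero]
  by_contra h0
  have hg := cherednikA_rename_sub (ρ := 1) h hz.1 (by rw [one_mul, xi_sub_of_eq κ h hα])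
  rw [one_smul] at hg
  obtain ⟨β, hβ, hx⟩ := exists_eq_xi h0 hg
  have hi := hx i
  have hj := hx j
  rw [Equiv.swap_apply_left] at hi
  rw [Equiv.swap_apply_right] at hj
  have hd := xi_sub_of_eq κ h hα
  -- The interchanged eigenvalues have $\xi_i-\xi_j=-\kappa$, which no composition realises for `κ >
  -- 0`. For `κ = 0` they are those of `α`, but the `α`-coefficient of the difference cancels.
  have hκ0 : κ = 0 := by
    rcases precedes_trichotomy β h.lt.ne' with h1 | h1
    · have h2 := kappa_add_le_xi_sub_xi hκ h1
      have h3 : (β j : ℝ) ≤ β i := by exact_mod_cast le_of_precedes h1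
      linarith
    · rcases h1 with h1 | ⟨-, h1⟩
      · have h2 := kappa_add_le_xi_sub_xi hκ (Or.inl h1 : Precedes β j i)
        have h3 : (β i : ℝ) + 1 ≤ β j := by exact_mod_cast h1
        linarith
      · exact absurd h1 h.lt.not_gt
  have hβα : β = α := xi_injective hκ fun l => by
    rw [← hx]
    by_cases hli : l = i
    · subst hli
      rw [Equiv.swap_apply_left]
      linarith
    · by_cases hlj : l = j
      · subst hlj
        rw [Equiv.swap_apply_right]
        linarith
      · rw [Equiv.swap_apply_of_ne_of_ne hli hlj]
  subst hβα
  rw [coeffAt_sub, coeffAt_rename, comp_swap_eq_replace, ← hα] at hβ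
  conv at hβ => rw [show replace β i j (β i) (β i) = β by conv_rhs => rw [← replace_self β i j, ← hα]]
  exact hβ (sub_self _)

/-- Applying $s+\kappa/(\xi_i-\xi_j)$ to the lower polynomial gives the eigenvalues of `α`, hence a
multiple of the upper one. The multiple is one: $x^\alpha$ does not occur in the lower polynomial,
and `s` creates it with coefficient one. -/
theorem rename_nsJack_swap {κ : ℝ} (hκ : 0 ≤ κ) {α : Fin 3 → ℕ} {i j : Fin 3} (h : Adjacent i j)
    (hα : α j < α i) :
    rename (Equiv.swap i j) (nsJack κ (α ∘ Equiv.swap i j))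
      = nsJack κ α - (κ / (xi κ α i - xi κ α j)) • nsJack κ (α ∘ Equiv.swap i j) := by
  have hz := isNSJack_nsJack hκ (α ∘ Equiv.swap i j)
  have hpos : 0 < xi κ α i - xi κ α j := by
    have h1 := kappa_add_le_xi_sub_xi hκ (Or.inl hα : Precedes α i j)
    have h2 : (α j : ℝ) + 1 ≤ α i := by exact_mod_cast hα
    linarith
  have hg := cherednikA_rename_sub (κ := κ) (ρ := -(κ / (xi κ α i - xi κ α j))) h hz.1 (by
    rw [xi_comp_swap κ h hα, xi_comp_swap κ h hα, Equiv.swap_apply_left, Equiv.swap_apply_right]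
    field_simp
    ring)
  have hg' := (isNSJack_nsJack hκ α).eq_smul hκ fun l => by
    rw [hg, xi_comp_swap κ h hα, Equiv.swap_apply_self]
  have hc : coeffAt α (nsJack κ (α ∘ Equiv.swap i j)) = 0 := by
    by_contra hc
    have hab := above_swap h.lt hα
    rcases hz.2.2 α hc with h1 | h1
    · exact Above.irrefl α (by rwa [← h1] at hab)
    · exact Above.irrefl α (hab.trans h1)
  rw [coeffAt_sub, coeffAt_smul, hc, coeffAt_rename, hz.2.1, mul_zero, sub_zero, one_smul,
    neg_smul, sub_neg_eq_add] at hg'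
  rw [← hg']
  module

/-! ### Symmetric Jack polynomials -/

theorem jackCoeff_three (κ : ℝ) (α : Fin 3 → ℕ) :
    jackCoeff (-1) κ α = (if α 0 < α 1 then 1 - κ / (xi κ α 1 - xi κ α 0) else 1)
      * (if α 0 < α 2 then 1 - κ / (xi κ α 2 - xi κ α 0) else 1)
      * (if α 1 < α 2 then 1 - κ / (xi κ α 2 - xi κ α 1) else 1) := by
  have hx : ∀ p q, ((compRank α p : ℝ) - compRank α q) * κ + α q - α p = xi κ α q - xi κ α p := by
    intro p q
    rw [xi_sub_xi]
    ring
  simp only [jackCoeff, hx, Finset.prod_filter, Fintype.prod_prod_type, Fin.prod_univ_three]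
  simp [neg_div, ← sub_eq_add_neg, mul_assoc]

/-- The swap adds the ascent `(i, j)` and merely renames the other factors. -/
theorem jackCoeff_swap {κ : ℝ} {α : Fin 3 → ℕ} {i j : Fin 3} (h : Adjacent i j) (hα : α j < α i) :
    jackCoeff (-1) κ (α ∘ Equiv.swap i j)
      = (1 - κ / (xi κ α i - xi κ α j)) * jackCoeff (-1) κ α := by
  obtain ⟨e1, e2, e3⟩ := swap_apply_three
  rw [jackCoeff_three, jackCoeff_three]
  simp only [xi_comp_swap κ h hα, Function.comp_apply]
  rcases h with ⟨rfl, rfl⟩ | ⟨rfl, rfl⟩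
  · simp only [Equiv.swap_apply_left, Equiv.swap_apply_right, e1, if_pos hα, if_neg hα.not_gt]
    ring
  · simp only [Equiv.swap_apply_left, Equiv.swap_apply_right, e3, if_pos hα, if_neg hα.not_gt]
    ring

/-- The set of distinct rearrangements of `μ`. -/
def rearrangements (μ : Fin N → ℕ) : Finset (Fin N → ℕ) :=
  (Finset.univ : Finset (Equiv.Perm (Fin N))).image fun w i => μ (w i)

theorem mem_rearrangements {μ α : Fin N → ℕ} :
    α ∈ rearrangements μ ↔ ∃ w : Equiv.Perm (Fin N), μ ∘ w = α := by
  simp only [rearrangements, Finset.mem_image, Finset.mem_univ, true_and]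
  rfl

theorem comp_mem_rearrangements {μ α : Fin N → ℕ} (h : α ∈ rearrangements μ)
    (w : Equiv.Perm (Fin N)) : α ∘ w ∈ rearrangements μ := by
  obtain ⟨u, rfl⟩ := mem_rearrangements.1 h
  exact mem_rearrangements.2 ⟨u * w, rfl⟩

theorem jack_eq (κ : ℝ) (μ : Fin N → ℕ) :
    jack κ μ = ∑ α ∈ rearrangements μ, jackCoeff (-1) κ α • nsJack κ α := rfl

/-- Writing $\zeta_\alpha=s\zeta'+\rho\zeta'$ with $\zeta'$ the lower polynomial, the weights $1$
and $1-\rho$ give $s\zeta'+\zeta'$. -/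
theorem rename_pair_of_lt {κ : ℝ} (hκ : 0 ≤ κ) {α : Fin 3 → ℕ} {i j : Fin 3} (h : Adjacent i j)
    (hα : α j < α i) :
    rename (Equiv.swap i j) (jackCoeff (-1) κ α • nsJack κ α
        + jackCoeff (-1) κ (α ∘ Equiv.swap i j) • nsJack κ (α ∘ Equiv.swap i j))
      = jackCoeff (-1) κ α • nsJack κ α
        + jackCoeff (-1) κ (α ∘ Equiv.swap i j) • nsJack κ (α ∘ Equiv.swap i j) := by
  have h1 := rename_nsJack_swap hκ h hα
  have h2 : nsJack κ α = rename (Equiv.swap i j) (nsJack κ (α ∘ Equiv.swap i j))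
      + (κ / (xi κ α i - xi κ α j)) • nsJack κ (α ∘ Equiv.swap i j) := by
    rw [h1, sub_add_cancel]
  rw [jackCoeff_swap h hα, h2]
  simp only [map_add, map_smul, rename_swap_swap]
  module

theorem rename_swap_jack {κ : ℝ} (hκ : 0 ≤ κ) (μ : Fin 3 → ℕ) {i j : Fin 3} (h : Adjacent i j) :
    rename (Equiv.swap i j) (jack κ μ) = jack κ μ := by
  -- Doubling the sum pairs every rearrangement with its swap without choosing representatives of
  -- the pairs.
  have h2 : (2 : ℝ) • jack κ μ = ∑ α ∈ rearrangements μ, (jackCoeff (-1) κ α • nsJack κ α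
      + jackCoeff (-1) κ (α ∘ Equiv.swap i j) • nsJack κ (α ∘ Equiv.swap i j)) := by
    rw [Finset.sum_add_distrib, two_smul, jack_eq]
    congr 1
    refine Finset.sum_nbij' (fun α => α ∘ Equiv.swap i j) (fun α => α ∘ Equiv.swap i j)
      (fun α hα => comp_mem_rearrangements hα _) (fun α hα => comp_mem_rearrangements hα _)
      (fun α _ => comp_swap_comp_swap α i j) (fun α _ => comp_swap_comp_swap α i j) fun α _ => ?_
    rw [comp_swap_comp_swap]
  have h3 : rename (Equiv.swap i j) ((2 : ℝ) • jack κ μ) = (2 : ℝ) • jack κ μ := by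
    rw [h2, map_sum]
    refine Finset.sum_congr rfl fun α _ => ?_
    rcases lt_trichotomy (α j) (α i) with h1 | h1 | h1
    · exact rename_pair_of_lt hκ h h1
    · have hs : α ∘ Equiv.swap i j = α := by
        rw [comp_swap_eq_replace]
        conv_rhs => rw [← replace_self α i j]
        rw [h1]
      rw [hs, map_add, map_smul, rename_nsJack_of_eq hκ h h1.symm]
    · have h4 := rename_pair_of_lt hκ (α := α ∘ Equiv.swap i j) h (by simpa using h1)
      rw [comp_swap_comp_swap] at h4
      rw [add_comm]
      exact h4
  rw [map_smul] at h3
  exact smul_right_injective _ (two_ne_zero' ℝ) h3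

theorem isSymmetric_of_adjacent {f : MvPolynomial (Fin 3) ℝ}
    (h : ∀ i j, Adjacent i j → rename (Equiv.swap i j) f = f) : f.IsSymmetric := by
  intro w
  have hw : w ∈ Submonoid.closure
      (Set.range fun i : Fin 2 => Equiv.swap i.castSucc i.succ) := by
    rw [Equiv.Perm.mclosure_swap_castSucc_succ]
    trivial
  induction hw using Submonoid.closure_induction with
  | mem x hx =>
    obtain ⟨i, rfl⟩ := hx
    refine h _ _ ?_
    fin_cases i
    · exact Or.inl ⟨rfl, rfl⟩
    · exact Or.inr ⟨rfl, rfl⟩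
  | one => exact rename_id_apply f
  | mul x y _ _ hx hy =>
    rw [Equiv.Perm.coe_mul, ← rename_rename, hy, hx]

theorem isSymmetric_jack {κ : ℝ} (hκ : 0 ≤ κ) (μ : Fin 3 → ℕ) : (jack κ μ).IsSymmetric :=
  isSymmetric_of_adjacent fun _ _ h => rename_swap_jack hκ μ h

theorem isHomogeneous_nsJack {κ : ℝ} (hκ : 0 ≤ κ) (α : Fin 3 → ℕ) :
    (nsJack κ α).IsHomogeneous (∑ i, α i) := by
  refine isHomogeneous_of_coeffAt fun β hβ => ?_
  rcases (isNSJack_nsJack hκ α).2.2 β hβ with rfl | h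
  · rfl
  · exact h.sum_eq.symm

theorem nsJack_ne_zero {κ : ℝ} (hκ : 0 ≤ κ) (α : Fin 3 → ℕ) : nsJack κ α ≠ 0 := by
  intro h
  have := (isNSJack_nsJack hκ α).2.1
  rw [h, coeffAt_zero] at this
  exact zero_ne_one this

theorem isHomogeneous_jack {κ : ℝ} (hκ : 0 ≤ κ) (μ : Fin 3 → ℕ) :
    (jack κ μ).IsHomogeneous (∑ i, μ i) := by
  rw [jack_eq]
  refine IsHomogeneous.sum _ _ _ fun α hα => ?_
  obtain ⟨w, rfl⟩ := mem_rearrangements.1 hα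
  rw [smul_eq_C_mul, ← zero_add (∑ i, μ i), ← Equiv.sum_comp w]
  exact (isHomogeneous_C _ _).mul (isHomogeneous_nsJack hκ (μ ∘ w))

theorem maxPart_of_mem_rearrangements {μ α : Fin 3 → ℕ} (h : α ∈ rearrangements μ) :
    maxPart α = maxPart μ ∧ minPart α = minPart μ ∧ α 0 + α 1 + α 2 = μ 0 + μ 1 + μ 2 := by
  obtain ⟨w, rfl⟩ := mem_rearrangements.1 h
  refine ⟨maxPart_comp μ w, minPart_comp μ w, ?_⟩
  have := Equiv.sum_comp w μ
  rwa [Fin.sum_univ_three, Fin.sum_univ_three] at this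

theorem maxPart_of_antitone {μ : Fin 3 → ℕ} (h : Antitone μ) : maxPart μ = μ 0 :=
  le_antisymm (maxPart_le_iff.2 fun i => h (Fin.zero_le i)) (le_maxPart μ 0)

theorem minPart_of_antitone {μ : Fin 3 → ℕ} (h : Antitone μ) : minPart μ = μ 2 :=
  le_antisymm (minPart_le μ 2) (le_minPart_iff.2 fun i => h (Fin.le_last i))

/-- A monomial strictly below a rearrangement of `μ` either has smaller max minus min, or is itself
a rearrangement and then cannot be non-increasing, since the partition is the highest one. -/
theorem coeffAt_jack {κ : ℝ} (hκ : 0 ≤ κ) {μ ν : Fin 3 → ℕ} (hμ : Antitone μ) (hν : Antitone ν)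
    (h : maxPart μ - minPart μ ≤ maxPart ν - minPart ν) :
    coeffAt ν (jack κ μ) = if ν = μ then 1 else 0 := by
  have key : ∀ α ∈ rearrangements μ, coeffAt ν (nsJack κ α) ≠ 0 → ν = α := by
    intro α hα hc
    rcases (isNSJack_nsJack hκ α).2.2 ν hc with h1 | h1
    · exact h1
    · rw [above_iff] at h1
      obtain ⟨h2, h3, h4⟩ := maxPart_of_mem_rearrangements hα
      have h5 := maxPart_of_antitone hν
      have h6 := minPart_of_antitone hν
      have h7 := le_maxPart α 0
      have h8 := minPart_le α 2
      have h9 := minPart_le ν 0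
      have h10 := minPart_le μ 0
      have h11 := le_maxPart μ 0
      omega
  rw [jack_eq, coeffAt_sum]
  have hmem : μ ∈ rearrangements μ := mem_rearrangements.2 ⟨1, rfl⟩
  rw [Finset.sum_eq_single μ]
  · split_ifs with he
    · subst he
      rw [coeffAt_smul, (isNSJack_nsJack hκ ν).2.1, mul_one, jackCoeff_three,
        if_neg (hν (by decide)).not_gt, if_neg (hν (by decide)).not_gt,
        if_neg (hν (by decide)).not_gt]
      norm_num
    · rw [coeffAt_smul]
      by_cases hc : coeffAt ν (nsJack κ μ) = 0
      · rw [hc, mul_zero]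
      · exact absurd (key μ hmem hc) he
  · intro α hα hne
    rw [coeffAt_smul]
    by_cases hc : coeffAt ν (nsJack κ α) = 0
    · rw [hc, mul_zero]
    · refine absurd ?_ hne
      have h1 := key α hα hc
      subst h1
      obtain ⟨h2, h3, h4⟩ := maxPart_of_mem_rearrangements hα
      rw [maxPart_of_antitone hν, maxPart_of_antitone hμ] at h2
      rw [minPart_of_antitone hν, minPart_of_antitone hμ] at h3
      exact fun_three_ext_iff.2 ⟨h2, by omega, h3⟩
  · exact fun h => absurd hmem h

theorem isSymmetric_coeffAt {f : MvPolynomial (Fin 3) ℝ} (hf : f.IsSymmetric) (β : Fin 3 → ℕ)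
    (w : Equiv.Perm (Fin 3)) : coeffAt (β ∘ w) f = coeffAt β f := by
  rw [← coeffAt_rename, hf w]

/-- Induction on a bound for max minus min of the exponents: subtracting the Jack polynomials of the
extremal partitions lowers the bound. -/
theorem mem_span_jack {κ : ℝ} (hκ : 0 ≤ κ) (m n : ℕ) : ∀ g : MvPolynomial (Fin 3) ℝ,
    g.IsSymmetric → g.IsHomogeneous m →
    (∀ β, coeffAt β g ≠ 0 → maxPart β - minPart β < n) →
    g ∈ Submodule.span ℝ {p | ∃ μ : Fin 3 → ℕ, Antitone μ ∧ ∑ i, μ i = m ∧ p = jack κ μ} := by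
  classical
  induction n with
  | zero =>
    intro g _ _ h
    have : g = 0 := ext_coeffAt fun β => by
      by_contra hc
      rw [coeffAt_zero] at hc
      exact absurd (h β hc) (Nat.not_lt_zero _)
    rw [this]
    exact Submodule.zero_mem _
  | succ n ih =>
    intro g hs hh h
    obtain ⟨T, hT⟩ : ∃ T : Finset (Fin 3 → ℕ), ∀ μ, μ ∈ T ↔
        coeffAt μ g ≠ 0 ∧ Antitone μ ∧ maxPart μ - minPart μ = n :=
      ⟨(finite_coeffAt g).toFinset.filter fun μ => Antitone μ ∧ maxPart μ - minPart μ = n,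
        fun μ => by simp⟩
    have hsum : ∑ μ ∈ T, coeffAt μ g • jack κ μ ∈ Submodule.span ℝ
        {p | ∃ μ : Fin 3 → ℕ, Antitone μ ∧ ∑ i, μ i = m ∧ p = jack κ μ} :=
      Submodule.sum_mem _ fun μ hμ => Submodule.smul_mem _ _ (Submodule.subset_span
        ⟨μ, ((hT μ).1 hμ).2.1, sum_eq_of_isHomogeneous hh ((hT μ).1 hμ).1, rfl⟩)
    rw [← sub_add_cancel g (∑ μ ∈ T, coeffAt μ g • jack κ μ)]
    have hsym : (g - ∑ μ ∈ T, coeffAt μ g • jack κ μ).IsSymmetric := by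
      intro w
      have h1 : rename w (∑ μ ∈ T, coeffAt μ g • jack κ μ) = ∑ μ ∈ T, coeffAt μ g • jack κ μ := by
        rw [map_sum]
        exact Finset.sum_congr rfl fun μ _ => by rw [map_smul, isSymmetric_jack hκ μ w]
      rw [map_sub, h1, hs w]
    refine Submodule.add_mem _ (ih _ hsym (hh.sub (IsHomogeneous.sum _ _ _ fun μ hμ => ?_))
      fun β hβ => ?_) hsum
    · have h1 := isHomogeneous_jack hκ μ
      rw [sum_eq_of_isHomogeneous hh ((hT μ).1 hμ).1] at h1
      exact (homogeneousSubmodule (Fin 3) ℝ m).smul_mem _ h1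
    · by_contra hn
      rw [not_lt] at hn
      -- By symmetry the coefficient may be tested at the sorted exponent, where `coeffAt_jack`
      -- applies.
      have hν : Antitone (sortDesc β) := sortDesc_antitone β
      have hmax : maxPart (sortDesc β) = maxPart β := maxPart_comp β _
      have hmin : minPart (sortDesc β) = minPart β := minPart_comp β _
      have hβ' : coeffAt (sortDesc β) (g - ∑ μ ∈ T, coeffAt μ g • jack κ μ) ≠ 0 := by
        rwa [sortDesc, isSymmetric_coeffAt hsym]
      apply hβ'
      rw [coeffAt_sub, coeffAt_sum]
      have he : ∀ μ ∈ T, coeffAt (sortDesc β) (coeffAt μ g • jack κ μ)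
          = if sortDesc β = μ then coeffAt μ g else 0 := by
        intro μ hμ
        obtain ⟨-, h1, h2⟩ := (hT μ).1 hμ
        rw [coeffAt_smul, coeffAt_jack hκ h1 hν (by omega), mul_ite, mul_one, mul_zero]
      rw [Finset.sum_congr rfl he, Finset.sum_ite_eq]
      split_ifs with hc
      · rw [sub_self]
      · rw [sub_zero]
        by_contra h0
        have := h _ h0
        exact hc ((hT _).2 ⟨h0, hν, by omega⟩)

/-! ### Eigenfunctions from homogeneous polynomials -/

theorem neg_smul_end (c : ℝ) (L : Module.End ℝ (MvPolynomial (Fin N) ℝ)) :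
    -(c • L) = (-c) • L :=
  LinearMap.ext fun f => by simp

theorem polyExp_half_ne_zero {L : Module.End ℝ (MvPolynomial (Fin N) ℝ)} (hL : LowersTwo L)
    (c : ℝ) {p : MvPolynomial (Fin N) ℝ} (hp : p ≠ 0) : polyExp (c • L) p ≠ 0 := by
  intro h
  have h1 := polyExp_neg_polyExp (hL.smul c) p
  rw [h, ← zero_smul ℝ (0 : MvPolynomial (Fin N) ℝ), neg_smul_end, polyExp_smul (hL.smul (-c)),
    zero_smul] at h1
  exact hp h1.symm

theorem polyExp_smul_apply {L : Module.End ℝ (MvPolynomial (Fin N) ℝ)} (hL : LowersTwo L)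
    (c : ℝ) (f : MvPolynomial (Fin N) ℝ) :
    L (polyExp (c • L) f) = polyExp (c • L) (L f) :=
  polyExp_comm (hL.smul c) (fun g => by simp) f

/-- $e^{-\Delta_h/2}$ intertwines $E$ with $E-\Delta_h$, so a homogeneous polynomial of degree `d`
becomes an eigenvector. -/
theorem isEigenfunction_polyExp {κ κ' : ℝ} (hκ : 0 ≤ κ) (hκ' : 0 ≤ κ') {d : ℕ}
    {p : MvPolynomial (Fin 4) ℝ} (hp : p ≠ 0) (hd : p.IsHomogeneous d) :
    IsEigenfunction κ κ' (d + 6 * κ + κ' + 2) fun x =>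
      evalAt (polyExp ((-1 / 2 : ℝ) • laplaceH κ κ') p) x * psiZero κ κ' x := by
  have hL := lowersTwo_laplaceH κ κ'
  refine isEigenfunction_of_eq hκ hκ' (polyExp_half_ne_zero hL _ hp) ?_
  have h1 : euler p - (2 : ℝ) • ((-1 / 2 : ℝ) • laplaceH κ κ') p
      = (d : ℝ) • p + laplaceH κ κ' p := by
    rw [euler_of_isHomogeneous hd, LinearMap.smul_apply]
    module
  rw [euler_polyExp (hL.smul _), h1, polyExp_add_right (hL.smul _), polyExp_smul (hL.smul _),
    polyExp_smul_apply hL]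
  module

/-- The converse: $e^{\Delta_h/2}q$ is an Euler eigenvector, hence homogeneous, and the energy is
determined by its degree. -/
theorem isHomogeneous_of_isEigenfunction {κ κ' E : ℝ} {q : MvPolynomial (Fin 4) ℝ}
    (h : IsEigenfunction κ κ' E fun x => evalAt q x * psiZero κ κ' x) :
    ∃ d : ℕ, E = d + 6 * κ + κ' + 2 ∧
      (polyExp ((1 / 2 : ℝ) • laplaceH κ κ') q).IsHomogeneous d := by
  have hL := lowersTwo_laplaceH κ κ'
  obtain ⟨hq, he⟩ := eq_of_isEigenfunction h
  have h1 : euler q - (2 : ℝ) • ((1 / 2 : ℝ) • laplaceH κ κ') q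
      = (E - (2 + 6 * κ + κ')) • q := by
    rw [LinearMap.smul_apply, sub_smul, ← he]
    module
  obtain ⟨d, hd, hh⟩ := isHomogeneous_of_euler (polyExp_half_ne_zero hL (1 / 2) hq)
    (c := E - (2 + 6 * κ + κ')) (by
      rw [euler_polyExp (hL.smul _), h1, polyExp_smul (hL.smul _)])
  exact ⟨d, by linarith, hh⟩

theorem polyExp_half_polyExp (κ κ' : ℝ) (q : MvPolynomial (Fin 4) ℝ) :
    polyExp ((-1 / 2 : ℝ) • laplaceH κ κ') (polyExp ((1 / 2 : ℝ) • laplaceH κ κ') q) = q := by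
  have h := polyExp_neg_polyExp ((lowersTwo_laplaceH κ κ').smul (1 / 2)) q
  rwa [neg_smul_end, ← neg_div] at h

/-! ### The coordinates `y` -/

/-- Substitution of `(y_0, y_1, y_2, y_3)`. -/
def atY4 : MvPolynomial (Fin 4) ℝ →ₐ[ℝ] MvPolynomial (Fin 4) ℝ := aeval y

@[simp] theorem atY4_X (i : Fin 4) : atY4 (X i) = y i := aeval_X _ _

theorem v_symm (i j : Fin 4) : v i j = v j i := by
  fin_cases i <;> fin_cases j <;> simp [v]

theorem atY4_linForm (u : Fin 4 → ℝ) : atY4 (linForm u) = linForm (∑ i, u i • v i) := by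
  have hsum : linForm (∑ i, u i • v i) = ∑ i, linForm (u i • v i) := by
    simp only [Fin.sum_univ_four, linForm_add]
  rw [hsum, linForm, map_sum]
  refine Finset.sum_congr rfl fun i _ => ?_
  rw [map_mul, atY4_X, y, linForm_smul, ← algebraMap_eq, AlgHom.commutes]

/-- The matrix with rows `v i` is orthogonal and symmetric, so the change of coordinates is its own
inverse. -/
theorem atY4_atY4 (f : MvPolynomial (Fin 4) ℝ) : atY4 (atY4 f) = f := by
  have h : atY4.comp atY4 = AlgHom.id ℝ _ := by
    refine algHom_ext fun i => ?_
    rw [AlgHom.comp_apply, atY4_X, y, atY4_linForm, AlgHom.id_apply, ← linForm_single]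
    congr 1
    have h1 := sum_v_dot_smul (Pi.single i 1)
    simp only [dotProduct_single, mul_one] at h1
    rw [← h1]
    exact Finset.sum_congr rfl fun j _ => by rw [v_symm]
  exact DFunLike.congr_fun h f

theorem atY4_injective : Function.Injective atY4 :=
  Function.LeftInverse.injective atY4_atY4

theorem atY_eq (f : MvPolynomial (Fin 3) ℝ) : atY f = atY4 (rename Fin.succ f) := by
  rw [atY, atY4, aeval_rename]
  rfl

theorem atY_ne_zero {f : MvPolynomial (Fin 3) ℝ} (hf : f ≠ 0) : atY f ≠ 0 := by
  rw [atY_eq, ← map_zero atY4]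
  refine atY4_injective.ne ?_
  rw [← map_zero (rename Fin.succ)]
  exact (rename_injective _ (Fin.succ_injective 3)).ne hf

@[simp] theorem atY_X (i : Fin 3) : atY (X i) = y i.succ := aeval_X _ _

theorem isHomogeneous_y (i : Fin 4) : (y i).IsHomogeneous 1 := isHomogeneous_linForm _

theorem y_ne_zero (i : Fin 4) : y i ≠ 0 := linForm_ne_zero (v_ne_zero i)

theorem isHomogeneous_atY {f : MvPolynomial (Fin 3) ℝ} {d : ℕ} (h : f.IsHomogeneous d) :
    (atY f).IsHomogeneous d := by
  have := h.aeval (fun i => y i.succ) fun i => isHomogeneous_y i.succ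
  rwa [one_mul] at this

theorem isHomogeneous_atY4 {f : MvPolynomial (Fin 4) ℝ} {d : ℕ} (h : f.IsHomogeneous d) :
    (atY4 f).IsHomogeneous d := by
  have := h.aeval y isHomogeneous_y
  rwa [one_mul] at this

theorem isHomogeneous_expand_two {f : MvPolynomial (Fin N) ℝ} {d : ℕ} (h : f.IsHomogeneous d) :
    (expand 2 f).IsHomogeneous (2 * d) := by
  have h1 : expand 2 f = aeval (fun i => (X i : MvPolynomial (Fin N) ℝ) ^ 2) f := by
    have : expand 2 = aeval (R := ℝ) (fun i => (X i : MvPolynomial (Fin N) ℝ) ^ 2) :=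
      algHom_ext fun i => by rw [expand_X, aeval_X]
    rw [this]
  rw [h1]
  exact h.aeval _ fun i => by simpa using (isHomogeneous_X ℝ i).pow 2

/-! ### The eigenfunctions attached to nonsymmetric Jack polynomials -/

theorem card_filter_val_lt {k : ℕ} (hk : k ≤ 3) :
    (Finset.univ.filter fun i : Fin 3 => i.val < k).card = k := by
  interval_cases k <;> decide

theorem isHomogeneous_pPoly {κ : ℝ} (hκ : 0 ≤ κ) (γ : Fin 3 → ℕ) :
    (pPoly κ γ).IsHomogeneous (∑ i, γ i) := by
  rw [pPoly]
  refine IsHomogeneous.rename_isHomogeneous ?_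
  have h1 : (∏ i ∈ Finset.univ.filter
      (fun i : Fin 3 => i.val < (Finset.univ.filter fun j => Odd (γ j)).card),
      (X i : MvPolynomial (Fin 3) ℝ)).IsHomogeneous (∑ j, γ j % 2) := by
    have hk : (Finset.univ.filter fun j => Odd (γ j)).card = ∑ j, γ j % 2 := by
      rw [Finset.card_filter]
      refine Finset.sum_congr rfl fun j _ => ?_
      split_ifs with h
      · exact (Nat.odd_iff.1 h).symm
      · exact (Nat.even_iff.1 (Nat.not_odd_iff_even.1 h)).symm
    have hle : (Finset.univ.filter fun j => Odd (γ j)).card ≤ 3 :=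
      (Finset.card_le_univ _).trans (by simp)
    have h2 := IsHomogeneous.prod (Finset.univ.filter
      (fun i : Fin 3 => i.val < (Finset.univ.filter fun j => Odd (γ j)).card))
      (fun i => (X i : MvPolynomial (Fin 3) ℝ)) (fun _ => 1) fun i _ => isHomogeneous_X ℝ i
    rw [Finset.sum_const, smul_eq_mul, mul_one, card_filter_val_lt hle] at h2
    rwa [hk] at h2 ⊢
  have h3 := h1.mul (isHomogeneous_expand_two
    (isHomogeneous_nsJack hκ fun i => γ (parityPerm γ i) / 2))
  convert h3 using 1
  rw [Equiv.sum_comp (parityPerm γ) fun i => γ i / 2, Finset.mul_sum, ← Finset.sum_add_distrib]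
  exact Finset.sum_congr rfl fun i _ => (Nat.mod_add_div _ _).symm

theorem pPoly_ne_zero {κ : ℝ} (hκ : 0 ≤ κ) (γ : Fin 3 → ℕ) : pPoly κ γ ≠ 0 := by
  rw [pPoly, ← map_zero (rename (parityPerm γ))]
  refine (rename_injective _ (parityPerm γ).injective).ne (mul_ne_zero ?_ ?_)
  · exact Finset.prod_ne_zero_iff.2 fun i _ => X_ne_zero i
  · exact (expand_ne_zero two_pos).2 (nsJack_ne_zero hκ _)

theorem isEigenfunction_hermitePoly {κ κ' : ℝ} (hκ : 0 ≤ κ) (hκ' : 0 ≤ κ') (γ : Fin 3 → ℕ)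
    (n : ℕ) : IsEigenfunction κ κ' ((∑ i, (γ i : ℝ)) + n + 6 * κ + κ' + 2) fun x =>
      evalAt (hermitePoly κ κ' γ n) x * psiZero κ κ' x := by
  have h := isEigenfunction_polyExp hκ hκ' (p := atY (pPoly κ γ) * y 0 ^ n)
    (mul_ne_zero (atY_ne_zero (pPoly_ne_zero hκ γ)) (pow_ne_zero _ (y_ne_zero 0)))
    ((isHomogeneous_atY (isHomogeneous_pPoly hκ γ)).mul ((isHomogeneous_y 0).pow n))
  push_cast at h
  rwa [one_mul] at h

/-! ### Separation of the variable `y_0` -/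

theorem v_zero_dot_rootA (i j : Fin 4) : rootA i j ⬝ᵥ v 0 = 0 := by
  rw [rootA_dot, v_zero_apply, v_zero_apply, sub_self]

theorem dunkl4_linForm_mul (κ κ' : ℝ) (ξ u : Fin 4 → ℝ) (f : MvPolynomial (Fin 4) ℝ) :
    dunkl4 κ κ' ξ (linForm u * f) = linForm u * dunkl4 κ κ' ξ f + (ξ ⬝ᵥ u) • f
      + ((2 * κ' * (v 0 ⬝ᵥ ξ) * (v 0 ⬝ᵥ u)) • reflPoly (v 0) f
      + ∑ p : Fin 4 × Fin 4, (κ / 2 * (rootA p.1 p.2 ⬝ᵥ ξ) * (rootA p.1 p.2 ⬝ᵥ u))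
        • reflPoly (rootA p.1 p.2) f) := by
  rw [dunkl4, dunkl_linForm_mul, Fintype.sum_option]
  simp only [roots4, mult4, coroot_rootA, coroot_v, smul_dotProduct, smul_eq_mul]
  congr 3
  ring

/-- `v 0` is orthogonal to the direction and to all roots `e_i - e_j`, so every commutator term
vanishes. -/
theorem dunklB_y_zero_mul (κ : ℝ) (i : Fin 3) (f : MvPolynomial (Fin 4) ℝ) :
    dunklB κ i (y 0 * f) = y 0 * dunklB κ i f := by
  rw [dunklB_eq κ 0, y, dunkl4_linForm_mul, v_dot_v, v_dot_v, if_neg (Fin.succ_ne_zero i),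
    if_neg (Fin.succ_ne_zero i).symm]
  simp [v_zero_dot_rootA]

theorem dunklZero_y_succ_mul (κ' : ℝ) (i : Fin 3) (f : MvPolynomial (Fin 4) ℝ) :
    dunklZero κ' (y i.succ * f) = y i.succ * dunklZero κ' f := by
  rw [dunklZero_eq 0, y, dunkl4_linForm_mul, v_dot_v, v_dot_v, if_neg (Fin.succ_ne_zero i).symm]
  simp

theorem dunklZero_y_zero_mul (κ' : ℝ) (f : MvPolynomial (Fin 4) ℝ) :
    dunklZero κ' (y 0 * f) = y 0 * dunklZero κ' f + f + (2 * κ') • reflPoly (v 0) f := by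
  rw [dunklZero_eq 0, y, dunkl4_linForm_mul, v_dot_v, if_pos rfl]
  simp

theorem dunklZero_atY_mul (κ' : ℝ) (a : MvPolynomial (Fin 3) ℝ) (f : MvPolynomial (Fin 4) ℝ) :
    dunklZero κ' (atY a * f) = atY a * dunklZero κ' f := by
  induction a using MvPolynomial.induction_on generalizing f with
  | C c => rw [← algebraMap_eq, AlgHom.commutes, ← Algebra.smul_def, ← Algebra.smul_def, map_smul]
  | add p q hp hq => rw [map_add, add_mul, map_add, hp, hq, add_mul]
  | mul_X p i hp => rw [map_mul atY, atY_X, mul_assoc, hp, dunklZero_y_succ_mul, mul_assoc]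

theorem laplaceB_y_zero_mul (κ : ℝ) (f : MvPolynomial (Fin 4) ℝ) :
    laplaceB κ (y 0 * f) = y 0 * laplaceB κ f := by
  simp only [laplaceB, LinearMap.sum_apply, pow_two, Module.End.mul_apply, dunklB_y_zero_mul,
    Finset.mul_sum]

theorem laplaceB_aeval_mul (κ : ℝ) (P : Polynomial ℝ) (f : MvPolynomial (Fin 4) ℝ) :
    laplaceB κ (Polynomial.aeval (y 0) P * f) = Polynomial.aeval (y 0) P * laplaceB κ f := by
  induction P using Polynomial.induction_on' generalizing f with
  | add p q hp hq => rw [map_add, add_mul, map_add, hp, hq, add_mul]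
  | monomial n a =>
    rw [Polynomial.aeval_monomial, mul_assoc, mul_assoc, ← Algebra.smul_def, ← Algebra.smul_def,
      map_smul]
    congr 1
    induction n with
    | zero => simp
    | succ n ih => rw [pow_succ', mul_assoc, mul_assoc, laplaceB_y_zero_mul, ih]

theorem reflPoly_v_zero_y_zero : reflPoly (v 0) (y 0) = -y 0 := by
  rw [y, reflPoly_linForm, vecRefl_v_self, linForm_neg]

/-- `y 0` changes sign under `σ_0`, so `κ'` contributes on odd powers only. -/
theorem dunklZero_y_zero_pow_even (κ' : ℝ) (m : ℕ) :
    dunklZero κ' (y 0 ^ (2 * m)) = (2 * m : ℝ) • y 0 ^ (2 * m - 1) ∧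
    dunklZero κ' (y 0 ^ (2 * m + 1)) = (2 * m + 1 + 2 * κ') • y 0 ^ (2 * m) := by
  have hodd : ∀ m : ℕ, dunklZero κ' (y 0 ^ (2 * m)) = (2 * m : ℝ) • y 0 ^ (2 * m - 1) →
      dunklZero κ' (y 0 ^ (2 * m + 1)) = (2 * m + 1 + 2 * κ') • y 0 ^ (2 * m) := by
    intro m hm
    rw [pow_succ', dunklZero_y_zero_mul, hm, map_pow, reflPoly_v_zero_y_zero, neg_pow,
      pow_mul (-1 : MvPolynomial (Fin 4) ℝ), neg_one_sq, one_pow, one_mul, mul_smul_comm]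
    rcases Nat.eq_zero_or_pos m with rfl | hpos
    · simp
      module
    · rw [← pow_succ', Nat.sub_add_cancel (by omega)]
      module
  induction m with
  | zero =>
    -- The truncated exponent `2 * 0 - 1` is harmless because its coefficient is zero.
    have h0 : dunklZero κ' (y 0 ^ (2 * 0)) = (2 * (0 : ℕ) : ℝ) • y 0 ^ (2 * 0 - 1) := by
      rw [mul_zero, pow_zero, dunklZero_eq 0, dunkl4, dunkl_one]
      simp
    exact ⟨h0, hodd 0 h0⟩
  | succ m ih =>
    have h0 : dunklZero κ' (y 0 ^ (2 * (m + 1)))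
        = (2 * (m + 1 : ℕ) : ℝ) • y 0 ^ (2 * (m + 1) - 1) := by
      rw [show 2 * (m + 1) = 2 * m + 1 + 1 by ring, pow_succ', dunklZero_y_zero_mul, ih.2, map_pow,
        reflPoly_v_zero_y_zero, neg_pow, pow_succ (-1 : MvPolynomial (Fin 4) ℝ),
        pow_mul (-1 : MvPolynomial (Fin 4) ℝ), neg_one_sq, one_pow, one_mul, mul_smul_comm,
        ← pow_succ', Nat.add_sub_cancel, neg_one_mul]
      push_cast
      module
    exact ⟨h0, hodd _ h0⟩

/-! ### Powers of `y 0` and Laguerre polynomials -/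

theorem half_dunklZero_sq_pow (κ' : ℝ) (m : ℕ) :
    ((-1 / 2 : ℝ) • dunklZero κ' ^ 2) (y 0 ^ (2 * m))
      = (-2 * (m * (m + (κ' - 1 / 2)))) • y 0 ^ (2 * (m - 1)) := by
  rw [LinearMap.smul_apply, pow_two, Module.End.mul_apply, (dunklZero_y_zero_pow_even κ' m).1,
    map_smul]
  rcases Nat.eq_zero_or_pos m with rfl | hpos
  · simp
  · rw [show 2 * m - 1 = 2 * (m - 1) + 1 by omega, (dunklZero_y_zero_pow_even κ' (m - 1)).2,
      Nat.cast_sub hpos]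
    push_cast
    module

theorem half_dunklZero_sq_pow_pow (κ' : ℝ) (n k : ℕ) :
    (((-1 / 2 : ℝ) • dunklZero κ' ^ 2) ^ k) (y 0 ^ (2 * n))
      = ((-2) ^ k * n.descFactorial k * ∏ j ∈ Finset.range k, (κ' - 1 / 2 + n - j))
        • y 0 ^ (2 * (n - k)) := by
  induction k with
  | zero => simp
  | succ k ih =>
    rw [pow_succ', Module.End.mul_apply, ih, map_smul, half_dunklZero_sq_pow, smul_smul,
      Nat.sub_sub, Nat.descFactorial_succ, Finset.prod_range_succ, Nat.cast_mul, pow_succ]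
    congr 1
    rcases le_or_gt k n with h | h
    · rw [Nat.cast_sub h]
      ring
    · rw [Nat.descFactorial_eq_zero_iff_lt.2 h]
      simp

theorem ascPochhammer_eval_add (a : ℝ) (i k : ℕ) :
    (ascPochhammer ℝ (i + k)).eval (a + 1)
      = (ascPochhammer ℝ i).eval (a + 1)
        * ∏ j ∈ Finset.range k, (a + (i + k : ℕ) - j) := by
  induction k with
  | zero => simp
  | succ k ih =>
    rw [← add_assoc, ascPochhammer_succ_eval, ih, Finset.prod_range_succ']
    have : ∏ j ∈ Finset.range k, (a + (i + k : ℕ) - j)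
        = ∏ j ∈ Finset.range k, (a + (i + k + 1 : ℕ) - (j + 1 : ℕ)) :=
      Finset.prod_congr rfl fun j _ => by push_cast; ring
    rw [this]
    push_cast
    ring

theorem ascPochhammer_eval_neg_nat (n i : ℕ) :
    (ascPochhammer ℝ i).eval (-(n : ℝ)) = (-1) ^ i * n.descFactorial i := by
  induction i with
  | zero => simp
  | succ i ih =>
    rw [ascPochhammer_succ_eval, ih, Nat.descFactorial_succ, pow_succ, Nat.cast_mul]
    rcases le_or_gt i n with h | h
    · rw [Nat.cast_sub h]
      ring
    · rw [Nat.descFactorial_eq_zero_iff_lt.2 h]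
      simp

/-- The factor `(-2)^n n!`. -/
def hermiteScale (n : ℕ) : ℝ := (-2) ^ n * n.factorial

theorem hermiteScale_ne_zero (n : ℕ) : hermiteScale n ≠ 0 :=
  mul_ne_zero (pow_ne_zero _ (by norm_num)) (Nat.cast_ne_zero.2 n.factorial_ne_zero)

/-- Term `k` of the exponential series is matched with term `i = n - k` of the Laguerre sum.
Positivity of `a + 1` keeps $(a+1)_i$ nonzero; for `a = κ' - 1/2` it follows from `κ' ≥ 0`. -/
theorem laguerre_coeff_eq {a : ℝ} (ha : 0 < a + 1) {n i k : ℕ} (h : i + k = n) :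
    (1 / (k.factorial : ℝ)) * ((-2) ^ k * n.descFactorial k
        * ∏ j ∈ Finset.range k, (a + n - j))
      = hermiteScale n * ((ascPochhammer ℝ n).eval (a + 1) / n.factorial
        * ((ascPochhammer ℝ i).eval (-(n : ℝ)) / (ascPochhammer ℝ i).eval (a + 1)
          / i.factorial) * (1 / 2) ^ i) := by
  have h1 : (i.factorial : ℝ) * n.descFactorial k = n.factorial := by
    have := Nat.factorial_mul_descFactorial (show k ≤ n by omega)
    rw [show n - k = i by omega] at this
    exact_mod_cast this
  have h2 : (k.factorial : ℝ) * n.descFactorial i = n.factorial := by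
    have := Nat.factorial_mul_descFactorial (show i ≤ n by omega)
    rw [show n - i = k by omega] at this
    exact_mod_cast this
  have hp := (ascPochhammer_pos i _ ha).ne'
  have hi : (i.factorial : ℝ) ≠ 0 := Nat.cast_ne_zero.2 i.factorial_ne_zero
  have hk : (k.factorial : ℝ) ≠ 0 := Nat.cast_ne_zero.2 k.factorial_ne_zero
  have hn : (n.factorial : ℝ) ≠ 0 := Nat.cast_ne_zero.2 n.factorial_ne_zero
  have d1 : (n.descFactorial k : ℝ) = n.factorial / i.factorial := by
    rw [← h1]; field_simp
  have d2 : (n.descFactorial i : ℝ) = n.factorial / k.factorial := by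
    rw [← h2]; field_simp
  have hpow : (-2 : ℝ) ^ n * ((-1) ^ i * (1 / 2) ^ i) = (-2) ^ k := by
    rw [← mul_pow, ← h, pow_add, mul_right_comm, ← mul_pow]
    norm_num
  have hP := ascPochhammer_eval_add a i k
  rw [h] at hP
  rw [hermiteScale, ascPochhammer_eval_neg_nat, hP, d1, d2, ← hpow]
  field_simp

theorem polyExp_y_zero_pow {κ' : ℝ} (hκ' : 0 ≤ κ') (n : ℕ) :
    polyExp ((-1 / 2 : ℝ) • dunklZero κ' ^ 2) (y 0 ^ (2 * n))
      = hermiteScale n •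
        Polynomial.aeval ((1 / 2 : ℝ) • y 0 ^ 2) (laguerre n (κ' - 1 / 2)) := by
  rw [polyExp_eq_sum (M := n + 1) fun m hm => by
    rw [half_dunklZero_sq_pow_pow, Nat.descFactorial_eq_zero_iff_lt.2 (by omega)]
    simp]
  -- Term `k` of the exponential carries the power `2 (n - k)`, so one of the two sums is reversed.
  rw [laguerre, map_mul, Polynomial.aeval_C, ← Algebra.smul_def, map_sum, Finset.smul_sum,
    Finset.smul_sum, ← Finset.sum_range_reflect]
  refine Finset.sum_congr rfl fun i hi => ?_
  have hi' := Finset.mem_range.1 hi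
  have h := laguerre_coeff_eq (a := κ' - 1 / 2) (by linarith) (n := n) (i := i) (k := n - i)
    (by omega)
  rw [show n + 1 - 1 - i = n - i by omega, half_dunklZero_sq_pow_pow, smul_smul, h, map_mul,
    Polynomial.aeval_C, ← Algebra.smul_def, map_pow, Polynomial.aeval_X, smul_pow, smul_smul,
    smul_smul, smul_smul, ← pow_mul, show n - (n - i) = i by omega]
  congr 1
  ring

/-- `(y_1 y_2 y_3)^s f(y²) y_0^{2n}`. -/
def seed (s n : ℕ) (f : MvPolynomial (Fin 3) ℝ) : MvPolynomial (Fin 4) ℝ :=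
  (y 1 * y 2 * y 3) ^ s * atY (expand 2 f) * y 0 ^ (2 * n)

theorem seed_prefix_eq (s : ℕ) (f : MvPolynomial (Fin 3) ℝ) :
    (y 1 * y 2 * y 3) ^ s * atY (expand 2 f) = atY ((X 0 * X 1 * X 2) ^ s * expand 2 f) := by
  simp only [map_mul, map_pow, atY_X]
  rfl

/-- The exponential of the sum factors. The part with `dunklZero` passes through polynomials in
$y_1,y_2,y_3$, and the part with `laplaceB` through polynomials in $y_0$. -/
theorem polyExp_seed_jack {κ κ' : ℝ} (hκ' : 0 ≤ κ') (μ : Fin 3 → ℕ) (s n : ℕ) :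
    polyExp ((-1 / 2 : ℝ) • laplaceH κ κ') (seed s n (jack κ μ))
      = hermiteScale n • invariantPoly κ κ' μ s n := by
  have hB := lowersTwo_laplaceB κ
  have h0 := lowersTwo_dunklZero_sq κ'
  have hc : Commute ((-1 / 2 : ℝ) • laplaceB κ) ((-1 / 2 : ℝ) • dunklZero κ' ^ 2) :=
    ((commute_laplaceB_dunklZero_sq κ κ').smul_left _).smul_right _
  have hadd : (-1 / 2 : ℝ) • laplaceH κ κ'
      = (-1 / 2 : ℝ) • laplaceB κ + (-1 / 2 : ℝ) • dunklZero κ' ^ 2 := by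
    rw [laplaceH_eq_add, smul_add]
  set A := atY ((X 0 * X 1 * X 2) ^ s * expand 2 (jack κ μ)) with hA
  have h1 : polyExp ((-1 / 2 : ℝ) • dunklZero κ' ^ 2) (A * y 0 ^ (2 * n))
      = A * polyExp ((-1 / 2 : ℝ) • dunklZero κ' ^ 2) (y 0 ^ (2 * n)) := by
    refine (polyExp_comm (h0.smul _) (S := LinearMap.mulLeft ℝ A) (fun f => ?_) _).symm
    simp only [LinearMap.mulLeft_apply, LinearMap.smul_apply, pow_two, Module.End.mul_apply, hA,
      dunklZero_atY_mul, mul_smul_comm]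
  have h2 : ∀ P : Polynomial ℝ, polyExp ((-1 / 2 : ℝ) • laplaceB κ)
      (A * Polynomial.aeval ((1 / 2 : ℝ) • y 0 ^ 2) P)
      = polyExp ((-1 / 2 : ℝ) • laplaceB κ) A
        * Polynomial.aeval ((1 / 2 : ℝ) • y 0 ^ 2) P := by
    intro P
    have hP : Polynomial.aeval ((1 / 2 : ℝ) • y 0 ^ 2) P
        = Polynomial.aeval (y 0) (P.comp ((1 / 2 : ℝ) • Polynomial.X ^ 2)) := by
      rw [Polynomial.aeval_comp]
      simp
    rw [hP, mul_comm A, mul_comm (polyExp _ A)]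
    refine (polyExp_comm (hB.smul _) (S := LinearMap.mulLeft ℝ _) (fun f => ?_) _).symm
    simp only [LinearMap.mulLeft_apply, LinearMap.smul_apply, laplaceB_aeval_mul, mul_smul_comm]
  rw [seed, seed_prefix_eq, ← hA, hadd, polyExp_add (hB.smul _) (h0.smul _) hc, h1,
    polyExp_y_zero_pow hκ', mul_smul_comm, polyExp_smul (hB.smul _), h2, invariantPoly,
    seed_prefix_eq]

theorem isHomogeneous_seed {f : MvPolynomial (Fin 3) ℝ} {d : ℕ} (h : f.IsHomogeneous d)
    (s n : ℕ) : (seed s n f).IsHomogeneous (3 * s + 2 * d + 2 * n) := by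
  have h1 := ((((isHomogeneous_y 1).mul (isHomogeneous_y 2)).mul (isHomogeneous_y 3)).pow s).mul
    (isHomogeneous_atY (isHomogeneous_expand_two h))
  have h2 := h1.mul ((isHomogeneous_y 0).pow (2 * n))
  rwa [show (1 + 1 + 1) * s + 2 * d + 1 * (2 * n) = 3 * s + 2 * d + 2 * n by ring] at h2

/-! ### Invariance -/

/-- Invariance of a polynomial under the transpositions and `σ_0`. -/
def ReflInvariant (f : MvPolynomial (Fin 4) ℝ) : Prop :=
  (∀ i j, reflPoly (rootA i j) f = f) ∧ reflPoly (v 0) f = f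

theorem reflInvariant_iff (f : MvPolynomial (Fin 4) ℝ) :
    ReflInvariant f ↔ ∀ t, reflPoly (roots4 t) f = f :=
  ⟨fun h t => match t with
    | none => h.2
    | some p => h.1 p.1 p.2, fun h => ⟨fun i j => h (some (i, j)), h none⟩⟩

theorem ReflInvariant.polyExp {f : MvPolynomial (Fin 4) ℝ} (h : ReflInvariant f)
    (κ κ' c : ℝ) : ReflInvariant (polyExp (c • laplaceH κ κ') f) := by
  rw [reflInvariant_iff] at h ⊢
  intro t
  have h1 := polyExp_comm ((lowersTwo_laplaceH κ κ').smul c)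
    (S := (reflPoly (roots4 t)).toLinearMap) (fun g => by
      simp only [LinearMap.smul_apply, map_smul, AlgHom.toLinearMap_apply]
      rw [laplaceH_eq, reflPoly_dunklLap (reflStable_roots4 κ κ') sum_single_dot_smul t]) f
  rw [AlgHom.toLinearMap_apply, AlgHom.toLinearMap_apply, h t] at h1
  exact h1

theorem ReflInvariant.rename_eq {f : MvPolynomial (Fin 4) ℝ} (h : ReflInvariant f)
    (w : Equiv.Perm (Fin 4)) : rename w f = f := by
  induction w using Equiv.Perm.swap_induction_on with
  | one => exact rename_id_apply f
  | swap_mul g i j _ ih =>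
    rw [Equiv.Perm.coe_mul, ← rename_rename, ih, ← reflPoly_rootA, h.1]

theorem ReflInvariant.wInvariant {f : MvPolynomial (Fin 4) ℝ} (h : ReflInvariant f)
    (κ κ' : ℝ) : WInvariant fun x => evalAt f x * psiZero κ κ' x := by
  refine ⟨fun w x => ?_, fun x => ?_⟩
  · beta_reduce
    rw [evalAt_permAct, h.rename_eq, psiZero_permAct]
  · beta_reduce
    rw [evalAt_sigmaZero, h.2, psiZero_sigmaZero]

theorem eq_of_evalAt_regular {f g : MvPolynomial (Fin 4) ℝ}
    (h : ∀ x ∈ regularSet, evalAt f x = evalAt g x) : f = g := by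
  rw [← sub_eq_zero]
  by_contra h0
  obtain ⟨x, hx, hne⟩ := exists_regular_evalAt_ne_zero h0
  refine hne ?_
  have := h x hx
  simp only [evalAt, map_sub] at this ⊢
  rw [this, sub_self]

/-- $\psi_0$ is itself invariant, and positive on the regular set, so it can be cancelled. -/
theorem reflInvariant_of_wInvariant {κ κ' : ℝ} {f : MvPolynomial (Fin 4) ℝ}
    (h : WInvariant fun x => evalAt f x * psiZero κ κ' x) : ReflInvariant f := by
  refine ⟨fun i j => eq_of_evalAt_regular fun x hx => ?_, eq_of_evalAt_regular fun x hx => ?_⟩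
  · have := h.1 (Equiv.swap i j) x
    beta_reduce at this
    rw [evalAt_permAct, psiZero_permAct] at this
    rw [reflPoly_rootA]
    exact mul_right_cancel₀ (psiZero_pos κ κ' hx).ne' this
  · have := h.2 x
    beta_reduce at this
    rw [evalAt_sigmaZero, psiZero_sigmaZero] at this
    exact mul_right_cancel₀ (psiZero_pos κ κ' hx).ne' this

theorem coroot_of_dot {a : Fin N → ℝ} (h : a ⬝ᵥ a = 2) : coroot a = a := by
  rw [coroot_eq, h, div_self two_ne_zero, one_smul]

theorem reflPoly_sub_y {i j : Fin 4} (h : i ≠ j) (k : Fin 4) :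
    reflPoly (v i - v j) (y k) = y (Equiv.swap i j k) := by
  have hd : (v i - v j) ⬝ᵥ (v i - v j) = 2 := by
    simp only [sub_dotProduct, dotProduct_sub, v_dot_v, if_pos, if_neg h, if_neg h.symm]
    norm_num
  rw [y, reflPoly_linForm, vecRefl, coroot_of_dot hd, sub_dotProduct, v_dot_v, v_dot_v, y]
  congr 1
  by_cases hi : k = i
  · subst hi
    rw [if_pos rfl, if_neg h.symm, Equiv.swap_apply_left]
    module
  · by_cases hj : k = j
    · subst hj
      rw [if_pos rfl, if_neg h, Equiv.swap_apply_right]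
      module
    · rw [if_neg (Ne.symm hi), if_neg (Ne.symm hj), Equiv.swap_apply_of_ne_of_ne hi hj]
      module

theorem reflPoly_add_y {i j : Fin 4} (h : i ≠ j) (k : Fin 4) :
    reflPoly (v i + v j) (y k)
      = (if k = i ∨ k = j then -1 else 1 : ℝ) • y (Equiv.swap i j k) := by
  have hd : (v i + v j) ⬝ᵥ (v i + v j) = 2 := by
    simp only [add_dotProduct, dotProduct_add, v_dot_v, if_pos, if_neg h, if_neg h.symm]
    norm_num
  rw [y, reflPoly_linForm, vecRefl, coroot_of_dot hd, add_dotProduct, v_dot_v, v_dot_v, y,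
    smul_eq_C_mul, ← linForm_smul]
  congr 1
  by_cases hi : k = i
  · subst hi
    rw [if_pos rfl, if_neg h.symm, Equiv.swap_apply_left, if_pos (Or.inl rfl)]
    module
  · by_cases hj : k = j
    · subst hj
      rw [if_pos rfl, if_neg h, Equiv.swap_apply_right, if_pos (Or.inr rfl)]
      module
    · rw [if_neg (Ne.symm hi), if_neg (Ne.symm hj), Equiv.swap_apply_of_ne_of_ne hi hj,
        if_neg (by tauto)]
      module

theorem swap_succ (i j k : Fin 3) : Equiv.swap i.succ j.succ k.succ = (Equiv.swap i j k).succ := by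
  simp only [Equiv.swap_apply_def, Fin.succ_inj]
  split_ifs <;> rfl

theorem swap_succ_zero (i j : Fin 3) : Equiv.swap i.succ j.succ 0 = 0 :=
  Equiv.swap_apply_of_ne_of_ne (Fin.succ_ne_zero i).symm (Fin.succ_ne_zero j).symm

/-- Signs disappear in the squares, and their product is one on $y_1y_2y_3$; only the permutation
`π` of the variables of `f` survives. -/
theorem reflPoly_seed {R : MvPolynomial (Fin 4) ℝ →ₐ[ℝ] MvPolynomial (Fin 4) ℝ}
    {π : Equiv.Perm (Fin 3)} {ε : Fin 3 → ℝ} (hR : ∀ k : Fin 3, R (y k.succ) = ε k • y (π k).succ)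
    (hε : ∀ k, ε k ^ 2 = 1) (hp : ∏ k, ε k = 1) (h0 : R (y 0) ^ 2 = y 0 ^ 2) (s n : ℕ)
    (f : MvPolynomial (Fin 3) ℝ) : R (seed s n f) = seed s n (rename π f) := by
  have h1 : R (y 1 * y 2 * y 3) = y 1 * y 2 * y 3 := by
    have h2 : y 1 * y 2 * y 3 = ∏ k : Fin 3, y k.succ := by
      rw [Fin.prod_univ_three]
      rfl
    rw [h2, map_prod]
    simp only [hR]
    rw [Finset.prod_smul, hp, one_smul, Equiv.prod_comp π fun k => y k.succ]
  have h2 : R (atY (expand 2 f)) = atY (expand 2 (rename π f)) := by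
    have : (R.comp atY).comp (expand 2) = (atY.comp (expand 2)).comp (rename π) := by
      refine algHom_ext fun k => ?_
      simp only [AlgHom.comp_apply, expand_X, map_pow, atY_X, hR, rename_X, smul_pow, hε, one_smul]
    exact DFunLike.congr_fun this f
  rw [seed, map_mul, map_mul, map_pow, h1, h2, pow_mul, map_pow, map_pow, h0, ← pow_mul, seed]

theorem reflPoly_rootSigma_seed {i j : Fin 3} (h : i ≠ j) (s n : ℕ)
    (f : MvPolynomial (Fin 3) ℝ) :
    reflPoly (rootSigma i j) (seed s n f) = seed s n (rename (Equiv.swap i j) f) := by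
  have h' : i.succ ≠ j.succ := (Fin.succ_injective 3).ne h
  refine reflPoly_seed (ε := fun _ => 1) (fun k => ?_) (fun _ => one_pow 2) (by simp) ?_ s n f
  · rw [rootSigma, reflPoly_sub_y h', swap_succ, one_smul]
  · rw [rootSigma, reflPoly_sub_y h', swap_succ_zero]

theorem reflPoly_rootTau_seed {i j : Fin 3} (h : i ≠ j) (s n : ℕ)
    (f : MvPolynomial (Fin 3) ℝ) :
    reflPoly (rootTau i j) (seed s n f) = seed s n (rename (Equiv.swap i j) f) := by
  have h' : i.succ ≠ j.succ := (Fin.succ_injective 3).ne h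
  refine reflPoly_seed (ε := fun k => if k = i ∨ k = j then -1 else 1) (fun k => ?_) (fun k => ?_)
    ?_ ?_ s n f
  · rw [rootTau, reflPoly_add_y h', swap_succ]
    simp only [Fin.succ_inj]
  · split_ifs <;> norm_num
  · revert h
    fin_cases i <;> fin_cases j <;> simp [Fin.prod_univ_three]
  · rw [rootTau, reflPoly_add_y h', swap_succ_zero, if_neg, one_smul]
    simp [(Fin.succ_ne_zero _).symm]

theorem reflPoly_v_zero_y_succ (k : Fin 3) : reflPoly (v 0) (y k.succ) = y k.succ := by
  rw [y, reflPoly_linForm, vecRefl, coroot_v, smul_dotProduct, v_dot_v,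
    if_neg (Fin.succ_ne_zero k).symm, smul_zero, zero_smul, sub_zero]

theorem reflInvariant_seed {f : MvPolynomial (Fin 3) ℝ} (hf : f.IsSymmetric) (s n : ℕ) :
    ReflInvariant (seed s n f) := by
  have hσ : ∀ {i j : Fin 3}, i ≠ j → reflPoly (rootSigma i j) (seed s n f) = seed s n f :=
    fun h => by rw [reflPoly_rootSigma_seed h, hf]
  have hτ : ∀ {i j : Fin 3}, i ≠ j → reflPoly (rootTau i j) (seed s n f) = seed s n f :=
    fun h => by rw [reflPoly_rootTau_seed h, hf]
  have h01 : (0 : Fin 3) ≠ 1 := by decide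
  have h02 : (0 : Fin 3) ≠ 2 := by decide
  have h12 : (1 : Fin 3) ≠ 2 := by decide
  have hlt : ∀ i j : Fin 4, i < j → reflPoly (rootA i j) (seed s n f) = seed s n f := by
    intro i j h
    have hc : (i = 0 ∧ j = 1) ∨ (i = 0 ∧ j = 2) ∨ (i = 0 ∧ j = 3) ∨ (i = 1 ∧ j = 2) ∨
        (i = 1 ∧ j = 3) ∨ (i = 2 ∧ j = 3) := by omega
    rcases hc with ⟨rfl, rfl⟩ | ⟨rfl, rfl⟩ | ⟨rfl, rfl⟩ | ⟨rfl, rfl⟩ | ⟨rfl, rfl⟩ | ⟨rfl, rfl⟩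
    · rw [← rootTau_one_two, hτ h12]
    · rw [← rootTau_zero_two, hτ h02]
    · rw [← rootTau_zero_one, hτ h01]
    · rw [← rootSigma_zero_one, hσ h01]
    · rw [← rootSigma_zero_two, hσ h02]
    · rw [← rootSigma_one_two, hσ h12]
  refine ⟨fun i j => ?_, ?_⟩
  · rcases lt_trichotomy i j with h | h | h
    · exact hlt i j h
    · subst h
      rw [reflPoly_rootA, Equiv.swap_self]
      exact rename_id_apply _
    · rw [reflPoly_rootA, Equiv.swap_comm, ← reflPoly_rootA, hlt j i h]
  · have h := reflPoly_seed (R := reflPoly (v 0)) (π := 1) (ε := fun _ => 1)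
      (fun k => by rw [reflPoly_v_zero_y_succ, one_smul, Equiv.Perm.one_apply])
      (fun _ => one_pow 2) (by simp) (by rw [reflPoly_v_zero_y_zero, neg_sq]) s n f
    rw [h, hf]

theorem invariantPoly_eq {κ κ' : ℝ} (hκ' : 0 ≤ κ') (μ : Fin 3 → ℕ) (s n : ℕ) :
    invariantPoly κ κ' μ s n = polyExp ((-1 / 2 : ℝ) • laplaceH κ κ')
      ((hermiteScale n)⁻¹ • seed s n (jack κ μ)) := by
  rw [polyExp_smul ((lowersTwo_laplaceH κ κ').smul _), polyExp_seed_jack hκ', smul_smul,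
    inv_mul_cancel₀ (hermiteScale_ne_zero n), one_smul]

theorem seed_ne_zero {f : MvPolynomial (Fin 3) ℝ} (hf : f ≠ 0) (s n : ℕ) : seed s n f ≠ 0 :=
  mul_ne_zero (mul_ne_zero (pow_ne_zero _ (mul_ne_zero (mul_ne_zero (y_ne_zero 1) (y_ne_zero 2))
    (y_ne_zero 3))) (atY_ne_zero ((expand_ne_zero two_pos).2 hf))) (pow_ne_zero _ (y_ne_zero 0))

theorem jack_ne_zero {κ : ℝ} (hκ : 0 ≤ κ) {μ : Fin 3 → ℕ} (hμ : Antitone μ) : jack κ μ ≠ 0 := by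
  intro h
  have := coeffAt_jack hκ hμ hμ le_rfl
  rw [h, coeffAt_zero, if_pos rfl] at this
  exact zero_ne_one this

theorem ReflInvariant.smul {f : MvPolynomial (Fin 4) ℝ} (h : ReflInvariant f) (c : ℝ) :
    ReflInvariant (c • f) :=
  ⟨fun i j => by rw [map_smul, h.1], by rw [map_smul, h.2]⟩

theorem wInvariant_invariantPoly {κ κ' : ℝ} (hκ : 0 ≤ κ) (hκ' : 0 ≤ κ') (μ : Fin 3 → ℕ)
    (s n : ℕ) : WInvariant fun x => evalAt (invariantPoly κ κ' μ s n) x * psiZero κ κ' x := by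
  rw [invariantPoly_eq hκ']
  exact (((reflInvariant_seed (isSymmetric_jack hκ μ) s n).smul _).polyExp κ κ' _).wInvariant κ κ'

theorem isEigenfunction_invariantPoly {κ κ' : ℝ} (hκ : 0 ≤ κ) (hκ' : 0 ≤ κ') {μ : Fin 3 → ℕ}
    (hμ : Antitone μ) (s n : ℕ) :
    IsEigenfunction κ κ' (2 * (∑ i, (μ i : ℝ)) + 3 * s + 2 * n + 6 * κ + κ' + 2) fun x =>
      evalAt (invariantPoly κ κ' μ s n) x * psiZero κ κ' x := by
  rw [invariantPoly_eq hκ']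
  have h := isEigenfunction_polyExp hκ hκ'
    (smul_ne_zero (inv_ne_zero (hermiteScale_ne_zero n)) (seed_ne_zero (jack_ne_zero hκ hμ) s n))
    ((homogeneousSubmodule (Fin 4) ℝ _).smul_mem _
      (isHomogeneous_seed (isHomogeneous_jack hκ μ) s n))
  convert h using 2
  push_cast
  ring

/-! ### Completeness of the invariant eigenfunctions -/

theorem mono_eq_prod (β : Fin N → ℕ) : mono β = ∏ i, X i ^ β i := by
  rw [mono, monomial_eq, C_1, one_mul, Finsupp.prod_fintype _ _ fun i => pow_zero _]
  simp

/-- The substitution `x_i ↦ ε_i x_i`. -/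
def rescale (ε : Fin N → ℝ) : MvPolynomial (Fin N) ℝ →ₐ[ℝ] MvPolynomial (Fin N) ℝ :=
  aeval fun i => ε i • X i

theorem coeffAt_rescale (ε : Fin N → ℝ) (β : Fin N → ℕ) (f : MvPolynomial (Fin N) ℝ) :
    coeffAt β (rescale ε f) = (∏ i, ε i ^ β i) * coeffAt β f := by
  have h : ∀ α : Fin N → ℕ, rescale ε (mono α) = (∏ i, ε i ^ α i) • mono α := by
    intro α
    rw [mono_eq_prod, map_prod, ← Finset.prod_smul]
    refine Finset.prod_congr rfl fun i _ => ?_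
    rw [map_pow, rescale, aeval_X, smul_pow]
  conv_lhs => rw [eq_sum_mono f]
  conv_rhs => rw [eq_sum_mono f]
  rw [map_sum, coeffAt_sum, coeffAt_sum, Finset.mul_sum]
  refine Finset.sum_congr rfl fun m _ => ?_
  rw [map_smul, h, coeffAt_smul, coeffAt_smul, coeffAt_smul, coeffAt_mono]
  split_ifs with he
  · rw [he]; ring
  · ring

/-- An element of the group that is diagonal in the coordinates `y` becomes a rescaling of the
variables, so its invariants can be tested monomial by monomial. -/
theorem rescale_atY4 {R : MvPolynomial (Fin 4) ℝ →ₐ[ℝ] MvPolynomial (Fin 4) ℝ} {ε : Fin 4 → ℝ}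
    (hR : ∀ k, R (y k) = ε k • y k) {p : MvPolynomial (Fin 4) ℝ} (hp : R p = p) :
    rescale ε (atY4 p) = atY4 p := by
  have h : atY4.comp (rescale ε) = R.comp atY4 := by
    refine algHom_ext fun k => ?_
    rw [AlgHom.comp_apply, AlgHom.comp_apply, rescale, aeval_X, map_smul, atY4_X, hR]
  refine atY4_injective ?_
  have h1 := DFunLike.congr_fun h (atY4 p)
  rw [AlgHom.comp_apply, AlgHom.comp_apply, atY4_atY4, hp] at h1
  rw [h1, atY4_atY4]

theorem ReflInvariant.rootSigma {p : MvPolynomial (Fin 4) ℝ} (h : ReflInvariant p) :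
    reflPoly (rootSigma 0 1) p = p ∧ reflPoly (rootSigma 0 2) p = p ∧
      reflPoly (rootSigma 1 2) p = p := by
  rw [rootSigma_zero_one, rootSigma_zero_two, rootSigma_one_two]
  exact ⟨h.1 _ _, h.1 _ _, h.1 _ _⟩

theorem reflPoly_sub_reflPoly_add_y {i j : Fin 4} (h : i ≠ j) (k : Fin 4) :
    ((reflPoly (v i - v j)).comp (reflPoly (v i + v j))) (y k)
      = (if k = i ∨ k = j then -1 else 1 : ℝ) • y k := by
  rw [AlgHom.comp_apply, reflPoly_add_y h, map_smul, reflPoly_sub_y h, Equiv.swap_apply_self]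

/-- `σ_0` negates only $y_0$, and $\sigma_{ij}\tau_{ij}$ negates exactly $y_i$ and $y_j$. Hence the
exponent of $y_0$ is even and the other three have the same parity. -/
theorem even_of_coeffAt_atY4 {p : MvPolynomial (Fin 4) ℝ} (h : ReflInvariant p) {β : Fin 4 → ℕ}
    (hβ : coeffAt β (atY4 p) ≠ 0) : Even (β 0) ∧ Even (β 1 + β 2) ∧ Even (β 1 + β 3) := by
  have key : ∀ {R : MvPolynomial (Fin 4) ℝ →ₐ[ℝ] MvPolynomial (Fin 4) ℝ} {ε : Fin 4 → ℝ},
      (∀ k, R (y k) = ε k • y k) → R p = p → ∏ i, ε i ^ β i = 1 := by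
    intro R ε hR hp
    have h1 := coeffAt_rescale ε β (atY4 p)
    rw [rescale_atY4 hR hp] at h1
    exact mul_right_cancel₀ hβ (by rw [← h1, one_mul])
  obtain ⟨h1, h2, -⟩ := h.rootSigma
  refine ⟨?_, ?_, ?_⟩
  · have := key (R := reflPoly (v 0)) (ε := fun k => if k = 0 then -1 else 1) (fun k => by
      refine Fin.cases ?_ (fun k => ?_) k
      · rw [reflPoly_v_zero_y_zero]
        simp
      · rw [reflPoly_v_zero_y_succ]
        simp) h.2
    rw [Fin.prod_univ_four] at this
    simp only [if_true, Fin.reduceEq, if_false, one_pow, mul_one] at this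
    exact neg_one_pow_eq_one_iff_even (by norm_num) |>.1 this
  · have := key (fun k => reflPoly_sub_reflPoly_add_y (show (1 : Fin 4) ≠ 2 by decide) k) (by
      have ht : reflPoly (v 1 + v 2) p = p := by
        have := h.1 0 3
        rwa [← rootTau_zero_one] at this
      rw [AlgHom.comp_apply, ht]
      exact h1)
    rw [Fin.prod_univ_four] at this
    simp [← pow_add] at this
    exact neg_one_pow_eq_one_iff_even (by norm_num) |>.1 this
  · have := key (fun k => reflPoly_sub_reflPoly_add_y (show (1 : Fin 4) ≠ 3 by decide) k) (by
      have ht : reflPoly (v 1 + v 3) p = p := by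
        have := h.1 0 2
        rwa [← rootTau_zero_two] at this
      rw [AlgHom.comp_apply, ht]
      exact h2)
    rw [Fin.prod_univ_four] at this
    simp [← pow_add] at this
    exact neg_one_pow_eq_one_iff_even (by norm_num) |>.1 this

theorem atY4_mono_eq_seed {β : Fin 4 → ℕ} {s n : ℕ} {μ : Fin 3 → ℕ} (h0 : β 0 = 2 * n)
    (h : ∀ i : Fin 3, β i.succ = 2 * μ i + s) : atY4 (mono β) = seed s n (mono μ) := by
  have h1 : β 1 = 2 * μ 0 + s := h 0
  have h2 : β 2 = 2 * μ 1 + s := h 1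
  have h3 : β 3 = 2 * μ 2 + s := h 2
  have e1 : y (Fin.succ (0 : Fin 3)) = y 1 := rfl
  have e2 : y (Fin.succ (1 : Fin 3)) = y 2 := rfl
  have e3 : y (Fin.succ (2 : Fin 3)) = y 3 := rfl
  rw [seed, mono_eq_prod, mono_eq_prod, Fin.prod_univ_four, Fin.prod_univ_three, h0, h1, h2, h3]
  simp only [map_mul, map_pow, atY4_X, expand_X, atY_X, e1, e2, e3]
  ring

/-- The sum of the images of `f` under all permutations of the three variables. -/
def symmetrize (f : MvPolynomial (Fin 3) ℝ) : MvPolynomial (Fin 3) ℝ :=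
  f + rename (Equiv.swap 1 2) f + rename (Equiv.swap 0 1) f
    + rename (Equiv.swap 0 1) (rename (Equiv.swap 1 2) f) + rename (Equiv.swap 0 2) f
    + rename (Equiv.swap 0 2) (rename (Equiv.swap 1 2) f)

theorem isSymmetric_symmetrize (f : MvPolynomial (Fin 3) ℝ) : (symmetrize f).IsSymmetric := by
  have h1 : ∀ f : MvPolynomial (Fin 3) ℝ, rename (Equiv.swap (0 : Fin 3) 1)
      (rename (Equiv.swap 0 2) f) = rename (Equiv.swap 0 2) (rename (Equiv.swap 1 2) f) := by
    intro f
    rw [rename_rename, rename_rename]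
    congr 2
    decide
  have h2 : ∀ f : MvPolynomial (Fin 3) ℝ, rename (Equiv.swap (1 : Fin 3) 2)
      (rename (Equiv.swap 0 1) f) = rename (Equiv.swap 0 2) (rename (Equiv.swap 1 2) f) := by
    intro f
    rw [rename_rename, rename_rename]
    congr 2
    decide
  have h3 : ∀ f : MvPolynomial (Fin 3) ℝ, rename (Equiv.swap (1 : Fin 3) 2)
      (rename (Equiv.swap 0 2) f) = rename (Equiv.swap 0 1) (rename (Equiv.swap 1 2) f) := by
    intro f
    rw [rename_rename, rename_rename]
    congr 2
    decide
  refine isSymmetric_of_adjacent fun i j h => ?_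
  rcases h with ⟨rfl, rfl⟩ | ⟨rfl, rfl⟩
  · simp only [symmetrize, map_add, rename_swap_swap, h1]
    abel
  · simp only [symmetrize, map_add, rename_swap_swap, h2, h3]
    abel

theorem isHomogeneous_symmetrize {f : MvPolynomial (Fin 3) ℝ} {d : ℕ} (h : f.IsHomogeneous d) :
    (symmetrize f).IsHomogeneous d :=
  ((((h.add h.rename_isHomogeneous).add h.rename_isHomogeneous).add
    h.rename_isHomogeneous.rename_isHomogeneous).add h.rename_isHomogeneous).add
    h.rename_isHomogeneous.rename_isHomogeneous

theorem seed_add (s n : ℕ) (f g : MvPolynomial (Fin 3) ℝ) :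
    seed s n (f + g) = seed s n f + seed s n g := by
  simp only [seed, map_add, mul_add, add_mul]

theorem seed_smul (s n : ℕ) (c : ℝ) (f : MvPolynomial (Fin 3) ℝ) :
    seed s n (c • f) = c • seed s n f := by
  simp only [seed, map_smul, mul_smul_comm, smul_mul_assoc]

/-- The six-fold sum over the group generated by the reflections `σ_ij`. -/
def reflSum (p : MvPolynomial (Fin 4) ℝ) : MvPolynomial (Fin 4) ℝ :=
  p + reflPoly (rootSigma 1 2) p + reflPoly (rootSigma 0 1) p
    + reflPoly (rootSigma 0 1) (reflPoly (rootSigma 1 2) p) + reflPoly (rootSigma 0 2) p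
    + reflPoly (rootSigma 0 2) (reflPoly (rootSigma 1 2) p)

/-- A single monomial of an invariant polynomial is not invariant. Averaging over the group of the
$\sigma_{ij}$ makes each contribution symmetric, so that monomials can be treated separately. -/
theorem reflSum_seed (s n : ℕ) (f : MvPolynomial (Fin 3) ℝ) :
    reflSum (seed s n f) = seed s n (symmetrize f) := by
  simp only [reflSum, symmetrize, seed_add, reflPoly_rootSigma_seed (show (0 : Fin 3) ≠ 1 by decide),
    reflPoly_rootSigma_seed (show (0 : Fin 3) ≠ 2 by decide),
    reflPoly_rootSigma_seed (show (1 : Fin 3) ≠ 2 by decide)]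

theorem polyExp_seed_mem_span {κ κ' : ℝ} (hκ' : 0 ≤ κ') {m s n : ℕ} (hs : s ≤ 1) {E : ℝ}
    (hE : E = 2 * m + 3 * s + 2 * n + 6 * κ + κ' + 2) {f : MvPolynomial (Fin 3) ℝ}
    (hf : f ∈ Submodule.span ℝ {p | ∃ μ : Fin 3 → ℕ, Antitone μ ∧ ∑ i, μ i = m ∧ p = jack κ μ}) :
    polyExp ((-1 / 2 : ℝ) • laplaceH κ κ') (seed s n f) ∈
      Submodule.span ℝ {p | ∃ (μ : Fin 3 → ℕ) (s n : ℕ), Antitone μ ∧ s ≤ 1 ∧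
        E = 2 * (∑ i, (μ i : ℝ)) + 3 * s + 2 * n + 6 * κ + κ' + 2 ∧
        p = invariantPoly κ κ' μ s n} := by
  have hL := (lowersTwo_laplaceH κ κ').smul (-1 / 2)
  induction hf using Submodule.span_induction with
  | mem x hx =>
    obtain ⟨μ, hμ, hm, rfl⟩ := hx
    rw [polyExp_seed_jack hκ']
    refine Submodule.smul_mem _ _ (Submodule.subset_span ⟨μ, s, n, hμ, hs, ?_, rfl⟩)
    rw [hE, ← hm]
    push_cast
    ring
  | zero =>
    have h0 : seed s n (0 : MvPolynomial (Fin 3) ℝ) = (0 : ℝ) • 0 := by simp [seed]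
    rw [h0, polyExp_smul hL, zero_smul]
    exact Submodule.zero_mem _
  | add f g _ _ hf hg =>
    rw [seed_add, polyExp_add_right hL]
    exact Submodule.add_mem _ hf hg
  | smul c f _ hf =>
    rw [seed_smul, polyExp_smul hL]
    exact Submodule.smul_mem _ _ hf

theorem mem_span_invariantPoly {κ κ' : ℝ} (hκ : 0 ≤ κ) (hκ' : 0 ≤ κ') {E : ℝ}
    {q : MvPolynomial (Fin 4) ℝ} (hW : WInvariant fun x => evalAt q x * psiZero κ κ' x)
    (hq : IsEigenfunction κ κ' E fun x => evalAt q x * psiZero κ κ' x) :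
    q ∈ Submodule.span ℝ {p | ∃ (μ : Fin 3 → ℕ) (s n : ℕ), Antitone μ ∧ s ≤ 1 ∧
        E = 2 * (∑ i, (μ i : ℝ)) + 3 * s + 2 * n + 6 * κ + κ' + 2 ∧
        p = invariantPoly κ κ' μ s n} := by
  have hL := (lowersTwo_laplaceH κ κ').smul (-1 / 2)
  obtain ⟨d, hE, hd⟩ := isHomogeneous_of_isEigenfunction hq
  have hinv := (reflInvariant_of_wInvariant hW).polyExp κ κ' (1 / 2)
  have hqp := polyExp_half_polyExp κ κ' q
  generalize polyExp ((1 / 2 : ℝ) • laplaceH κ κ') q = p at hd hinv hqp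
  -- By invariance, `p` is recovered as one sixth of its six-fold sum, and this sum is then expanded
  -- over the monomials in `y`.
  have h6 : (6 : ℝ) • p = reflSum p := by
    obtain ⟨h1, h2, h3⟩ := hinv.rootSigma
    rw [reflSum, h3, h1, h2]
    module
  have hsum : reflSum p
      = ∑ m ∈ (atY4 p).support, coeffAt (⇑m) (atY4 p) • reflSum (atY4 (mono m)) := by
    have h1 : p = ∑ m ∈ (atY4 p).support, coeffAt (⇑m) (atY4 p) • atY4 (mono m) := by
      conv_lhs => rw [← atY4_atY4 p, eq_sum_mono (atY4 p), map_sum]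
      exact Finset.sum_congr rfl fun m _ => map_smul atY4 _ _
    conv_lhs => rw [h1]
    simp only [reflSum, map_sum, map_smul, smul_add, Finset.sum_add_distrib]
  have hq6 : q = (1 / 6 : ℝ) • polyExpLin hL (reflSum p) := by
    rw [← h6, map_smul, smul_smul, show (1 / 6 : ℝ) * 6 = 1 by norm_num, one_smul]
    exact hqp.symm
  rw [hq6, hsum, map_sum]
  refine Submodule.smul_mem _ _ (Submodule.sum_mem _ fun m hm => ?_)
  rw [map_smul]
  refine Submodule.smul_mem _ _ ?_
  have hc : coeffAt (⇑m) (atY4 p) ≠ 0 := by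
    rw [← coeff_eq_coeffAt]
    exact mem_support_iff.1 hm
  obtain ⟨h0, h12, h13⟩ := even_of_coeffAt_atY4 hinv hc
  rw [Nat.even_iff] at h0 h12 h13
  have hdeg := sum_eq_of_isHomogeneous (isHomogeneous_atY4 hd) hc
  rw [Fin.sum_univ_four] at hdeg
  have hβ0 : m 0 = 2 * (m 0 / 2) := by omega
  have hβ : ∀ i : Fin 3, m i.succ = 2 * (m i.succ / 2) + m 1 % 2 := by
    intro i
    have e : i.succ = 1 ∨ i.succ = 2 ∨ i.succ = 3 := by
      fin_cases i
      · exact Or.inl rfl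
      · exact Or.inr (Or.inl rfl)
      · exact Or.inr (Or.inr rfl)
    rcases e with e | e | e <;> rw [e] <;> omega
  rw [atY4_mono_eq_seed (μ := fun i => m i.succ / 2) hβ0 hβ, reflSum_seed]
  have hm' : (mono fun i : Fin 3 => m i.succ / 2).IsHomogeneous (∑ i : Fin 3, m i.succ / 2) :=
    isHomogeneous_of_coeffAt fun γ hγ => by
      rw [coeffAt_mono] at hγ
      by_cases he : (fun i : Fin 3 => m i.succ / 2) = γ
      · rw [← he]
      · exact absurd (if_neg he) hγ
  -- Max minus min is at most the degree, so the degree plus one starts the induction.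
  have hspan := mem_span_jack hκ (∑ i : Fin 3, m i.succ / 2) ((∑ i : Fin 3, m i.succ / 2) + 1) _
    (isSymmetric_symmetrize _) (isHomogeneous_symmetrize hm') fun γ hγ => by
      have h1 := sum_eq_of_isHomogeneous (isHomogeneous_symmetrize hm') hγ
      rw [← h1, Fin.sum_univ_three]
      have h2 : maxPart γ ≤ γ 0 + γ 1 + γ 2 := by
        simp only [maxPart]
        omega
      omega
  refine polyExp_seed_mem_span hκ' (by omega) ?_ hspan
  have hnat : d = 2 * (∑ i : Fin 3, m i.succ / 2) + 3 * (m 1 % 2) + 2 * (m 0 / 2) := by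
    have e1 := hβ 0
    have e2 := hβ 1
    have e3 := hβ 2
    change m 1 = 2 * (m 1 / 2) + _ at e1
    change m 2 = 2 * (m 2 / 2) + _ at e2
    change m 3 = 2 * (m 3 / 2) + _ at e3
    rw [Fin.sum_univ_three]
    change d = 2 * (m 1 / 2 + m 2 / 2 + m 3 / 2) + _ + _
    omega
  rw [hE, hnat]
  push_cast
  ring

end DunklFour

end

/-! ### The main theorem -/

theorem mainTheorem3 (κ κ' : ℝ) (hκ : 0 ≤ κ) (hκ' : 0 ≤ κ') :
    -- the nonsymmetric Jack polynomials in three variables are well defined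
    (∀ α : Fin 3 → ℕ, ∃! z : MvPolynomial (Fin 3) ℝ, IsNSJack κ α z) ∧
    -- the conjugated Hamiltonian, as an operator on polynomials
    (∀ (f : MvPolynomial (Fin 4) ℝ), ∀ x ∈ regularSet,
      (psiZero κ κ' x)⁻¹ * hamiltonian κ κ' (fun z => psiZero κ κ' z * evalAt f z) x =
        evalAt (polyExp ((-1 / 2 : ℝ) • laplaceH κ κ')
          (gaugeOp κ κ' (polyExp ((1 / 2 : ℝ) • laplaceH κ κ') f))) x) ∧
    -- the eigenfunctions and their energies
    (∀ (γ : Fin 3 → ℕ) (n : ℕ),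
      IsEigenfunction κ κ' ((∑ i, (γ i : ℝ)) + n + 6 * κ + κ' + 2)
        (fun x => evalAt (hermitePoly κ κ' γ n) x * psiZero κ κ' x)) ∧
    -- the two families of invariant eigenfunctions
    (∀ (μ : Fin 3 → ℕ), Antitone μ → ∀ s : ℕ, s ≤ 1 → ∀ n : ℕ,
      WInvariant (fun x => evalAt (invariantPoly κ κ' μ s n) x * psiZero κ κ' x) ∧
      IsEigenfunction κ κ' (2 * (∑ i, (μ i : ℝ)) + 3 * s + 2 * n + 6 * κ + κ' + 2)
        (fun x => evalAt (invariantPoly κ κ' μ s n) x * psiZero κ κ' x)) ∧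
    -- every invariant eigenfunction (polynomial times base state) comes from these families
    (∀ (E : ℝ) (q : MvPolynomial (Fin 4) ℝ),
      WInvariant (fun x => evalAt q x * psiZero κ κ' x) →
      IsEigenfunction κ κ' E (fun x => evalAt q x * psiZero κ κ' x) →
      q ∈ Submodule.span ℝ {p | ∃ (μ : Fin 3 → ℕ) (s n : ℕ), Antitone μ ∧ s ≤ 1 ∧
        E = 2 * (∑ i, (μ i : ℝ)) + 3 * s + 2 * n + 6 * κ + κ' + 2 ∧
        p = invariantPoly κ κ' μ s n}) := by
  refine ⟨existsUnique_isNSJack hκ, fun f x hx => ?_, isEigenfunction_hermitePoly hκ hκ',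
    fun μ hμ s _ n => ⟨wInvariant_invariantPoly hκ hκ' μ s n,
      isEigenfunction_invariantPoly hκ hκ' hμ s n⟩,
    fun _ _ hW hq => mem_span_invariantPoly hκ hκ' hW hq⟩
  -- Both sides equal $E+(2+6\kappa+\kappa')-\Delta_h$ applied to `f`.
  rw [conjugated_hamiltonian κ κ' f hx, polyExp_gaugeOp_polyExp]
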